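/- **Setting.** Fix $p$, true values $\dot\beta\in\mathbb R^p$, $\dot\phi>0$, a covariance matrix $\dot G\in\mathbb R^{p\times p}$, and an exponential family $f(y\mid\eta,\phi)=\exp[\phi^{-1}\{y\eta-a(\eta)\}+c(y,\phi)]$ (canonical parameter $\eta\in\mathbb R$, density with respect to a $\sigma$-finite measure on $\mathbb R$, a probability density at $\phi=\dot\phi$ for every $\eta$). Consider a sequence of independent-cluster generalized linear mixed models: there are $m$ clusters, cluster $i$ has $n_i$ responses $y_{i1},\dots,y_{in_i}$ and deterministic covariates $x_{ij}\in\mathbb R^p$, which serve both the fixed and the random effects. The clusters are independent; $\dot b_i\sim N(0,\dot G)$; and given $\dot b_i$ the $y_{ij}$, $j\le n_i$, are independent with densities $f(\cdot\mid\dot\eta_{ij},\dot\phi)$, $\dot\eta_{ij}=x_{ij}^\top\dot\beta+x_{ij}^\top\dot b_i$. The quantities $m,n_i,x_{ij}$ and the random variables may depend on the stage of the sequence; write $n_L=\min_{i\le m}n_i$, $n=m^{-1}\sum_{i\le m}n_i$, and assume $m\to\infty$, $n_L\to\infty$ and $n_i=O(n_L)$ uniformly in $i\le m$. With a working covariance matrix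 $\hat G$ and a working dispersion $\hat\phi$ (possibly random), the penalized quasi-likelihood (PQL) estimator $(\hat\beta,\hat b_1,\dots,\hat b_m)$ is a (measurable) maximiser of $$Q(\beta,b)=\sum_{i=1}^m\sum_{j=1}^{n_i}\ln f(y_{ij}\mid x_{ij}^\top\beta+x_{ij}^\top b_i,\hat\phi)-\tfrac12\sum_{i=1}^m b_i^\top\hat G^{-1}b_i .$$ Let $X_i$ be the matrix with rows $x_{ij}^\top$, $\dot W_i=\hat\phi^{-1}\operatorname{diag}\{a''(\dot\eta_{ij})\}_j$, $\dot\mu_i=(a'(\dot\eta_{ij}))_j$, and $\dot H_i=(n_i^{-1}\hat\phi\dot\phi^{-1}X_i^\top\dot W_iX_i)^{-1}$, which is a function $\dot H_i(\dot b_i)$ of $\dot b_i$ not involving $\hat\phi$. **Conditions.** - (C1) $a$ is three times continuously differentiable on $\mathbb R$, and for some $c_0>0$: $c_0\le a''\le c_0^{-1}$ and $|a'''|\le c_0^{-1}$. - (C2) The $x_{ij}$ are uniformly bounded; the inverses $\dot H_i$, $i\le m$, exist from some stage on; for every $i$ and $N(0,\dot G)$-almost every $b$, $\dot H_i(b)\to\dot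 K_i(b)$; $m^{-1}\sum_{i\le m}n\,n_i^{-1}\dot H_i(\dot b_i)\to\dot K$ in probability, with $\dot K$ a constant matrix; and for some $c_1>0$, $\dot K$ and, for all $i$ and almost every $b$, $\dot K_i(b)$ are positive definite with eigenvalues in $[c_1,c_1^{-1}]$. - (C3) $(\dot\beta,\dot b_1,\dots,\dot b_m)$ is an interior point of some compact subset of $\mathbb R^{(m+1)p}$ (which may depend on the stage and on the realisation). - (C4) Almost surely $\hat G$ is positive definite and $\hat\phi>0$; $\hat G^{-1}=O_p(1)$ and $\hat\phi=O_p(1)$. - (C5) At every stage and for every $i\le m$, all components of $n_i^{1/2}(X_i^\top\dot W_iX_i+\hat G^{-1})^{-1}\{\hat\phi^{-1}X_i^\top(y_i-\dot\mu_i)-\hat G^{-1}\dot b_i\}$ have finite fourth moments. Let $\mathrm{mixN}(0,\dot K_i,F_{\dot b_i})$ denote the law of a random vector which, given $b\sim N(0,\dot G)$, is $N(0,\dot K_i(b))$-distributed, and let $*$ denote convolution of laws. **Theorem.** Assume (C1)–(C5) and $m/n_L^2\to0$. Then, unconditionally on the random effects, for each fixed $i$: (a) if $m/n_i\to\infty$,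 then $n_i^{1/2}(\hat b_i-\dot b_i)\overset{D}{\to}\mathrm{mixN}(0,\dot K_i,F_{\dot b_i})$; (b) if $m/n_i\to\gamma_i\in(0,\infty)$, then $n_i^{1/2}(\hat b_i-\dot b_i)\overset{D}{\to}\mathrm{mixN}(0,\dot K_i,F_{\dot b_i})*N(0,\gamma_i^{-1}\dot G)$; (c) if $m/n_i\to0$, then $m^{1/2}(\hat b_i-\dot b_i)\overset{D}{\to}N(0,\dot G)$. -/

import Mathlib

open MeasureTheory ProbabilityTheory Filter Topology
open scoped Matrix

noncomputable section

namespace PQL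

/-- The space of coefficient vectors. -/
abbrev Vec (p : ℕ) : Type := EuclideanSpace ℝ (Fin p)

/-- The population quantities of the mixed model: the functions `a`, `c` and the dominating
measure `ν` of the exponential family, and the true values of the dispersion parameter, of the
fixed effects and of the random effects covariance matrix. -/
structure Model (p : ℕ) where
  a : ℝ → ℝ
  c : ℝ → ℝ → ℝ
  ν : Measure ℝ
  φ : ℝ
  β : Vec p
  G : Matrix (Fin p) (Fin p) ℝ

/-- One design: `m` clusters, cluster `i < m` has `n i` measurements, and `x i j` with `j < n i`
is the covariate vector of measurement `j` of cluster `i`, for the fixed and the random effects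
alike. Values of `n` and `x` at other indices are never used. -/
structure Design (p : ℕ) where
  m : ℕ
  n : ℕ → ℕ
  x : ℕ → ℕ → Vec p

/-- The random effects `b i` and the responses `y i j`, as random variables on `Ω`. -/
structure Sample (p : ℕ) (Ω : Type*) where
  b : ℕ → Ω → Vec p
  y : ℕ → ℕ → Ω → ℝ

/-- The working covariance matrix and dispersion, and the estimators of the fixed and of the
random effects, as random variables on `Ω`. -/
structure Fit (p : ℕ) (Ω : Type*) where
  Ghat : Ω → Matrix (Fin p) (Fin p) ℝ
  φhat : Ω → ℝ
  βhat : Ω → Vec p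
  bhat : ℕ → Ω → Vec p

variable {p : ℕ}

namespace Design

/-- Minimum cluster size. -/
def nL (D : Design p) : ℕ := ⨅ i : Fin D.m, D.n i

/-- Average cluster size. -/
def nbar (D : Design p) : ℝ := (∑ i ∈ Finset.range D.m, (D.n i : ℝ)) / D.m

/-- The design matrix of cluster `i`. -/
def X (D : Design p) (i : ℕ) : Matrix (Fin (D.n i)) (Fin p) ℝ :=
  Matrix.of fun j k => D.x i j k

end Design

/-- The linear predictor with equal covariates for the fixed and the random effects. -/
def linPred (x β b : Vec p) : ℝ := inner ℝ x β + inner ℝ x b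

namespace Model

/-- The exponential family density at `y`, with canonical parameter `η` and dispersion `φ`. -/
def density (M : Model p) (φ η y : ℝ) : ℝ :=
  Real.exp (φ⁻¹ * (y * η - M.a η) + M.c y φ)

/-- The exponential family at the true dispersion consists of probability densities with respect
to `ν`, for all canonical parameters; the dispersion is positive and `G` is a covariance
matrix. -/
structure IsValid (M : Model p) : Prop where
  sigmaFinite : SigmaFinite M.ν
  measurable_c : Measurable fun y => M.c y M.φ
  φ_pos : 0 < M.φ
  lintegral_density : ∀ η, ∫⁻ y, ENNReal.ofReal (M.density M.φ η y) ∂M.ν = 1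
  posSemidef_G : M.G.PosSemidef

/-- The weight matrix `φ⁻¹ diag (a'' η)` of cluster `i` with random effect `b`, at the
dispersion `φ`. -/
def W (M : Model p) (D : Design p) (φ : ℝ) (i : ℕ) (b : Vec p) :
    Matrix (Fin (D.n i)) (Fin (D.n i)) ℝ :=
  φ⁻¹ • Matrix.diagonal fun j : Fin (D.n i) => iteratedDeriv 2 M.a (linPred (D.x i j) M.β b)

/-- The vector of conditional means of cluster `i` with random effect `b`. -/
def mean (M : Model p) (D : Design p) (i : ℕ) (b : Vec p) : Fin (D.n i) → ℝ :=
  fun j => deriv M.a (linPred (D.x i j) M.β b)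

/-- The normalised information matrix of cluster `i` with random effect `b`, at the true
dispersion. -/
def info (M : Model p) (D : Design p) (i : ℕ) (b : Vec p) : Matrix (Fin p) (Fin p) ℝ :=
  (D.n i : ℝ)⁻¹ • ((D.X i)ᵀ * M.W D M.φ i b * D.X i)

/-- The inverse of the normalised information matrix. -/
def H (M : Model p) (D : Design p) (i : ℕ) (b : Vec p) : Matrix (Fin p) (Fin p) ℝ :=
  (M.info D i b)⁻¹

/-- The PQL objective function, given the responses `y`, the working covariance matrix `G` and
the working dispersion `φ`. -/
def objective (M : Model p) (D : Design p) (y : ℕ → ℕ → ℝ) (G : Matrix (Fin p) (Fin p) ℝ)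
    (φ : ℝ) (β : Vec p) (b : ℕ → Vec p) : ℝ :=
  (∑ i ∈ Finset.range D.m, ∑ j ∈ Finset.range (D.n i),
      Real.log (M.density φ (linPred (D.x i j) β (b i)) (y i j)))
    - 1 / 2 * ∑ i ∈ Finset.range D.m, WithLp.ofLp (b i) ⬝ᵥ (G⁻¹ *ᵥ WithLp.ofLp (b i))

end Model

/-- The sample follows the independent-cluster generalized linear mixed model: the clusters are
independent, `b i` is `N(0, G)`, and given `b i` the responses of cluster `i` are independent with
the exponential family density at their linear predictors. -/
structure IsGLMM {Ω : Type*} [MeasurableSpace Ω] (P : Measure Ω) (M : Model p) (D : Design p)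
    (S : Sample p Ω) : Prop where
  measurable_b : ∀ i, Measurable (S.b i)
  measurable_y : ∀ i j, Measurable (S.y i j)
  indep : iIndepFun
    (fun (i : Fin D.m) ω => (S.b i ω, fun j : Fin (D.n i) => S.y i j ω)) P
  law : ∀ i < D.m, P.map (fun ω => (S.b i ω, fun j : Fin (D.n i) => S.y i j ω)) =
    ((multivariateGaussian 0 M.G).prod (Measure.pi fun _ : Fin (D.n i) => M.ν)).withDensity
      fun q => ∏ j : Fin (D.n i),
        ENNReal.ofReal (M.density M.φ (linPred (D.x i j) M.β q.1) (q.2 j))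

/-- The estimators jointly maximise the PQL objective at the working covariance matrix and
dispersion. -/
structure IsPQL {Ω : Type*} [MeasurableSpace Ω] (P : Measure Ω) (M : Model p) (D : Design p)
    (S : Sample p Ω) (F : Fit p Ω) : Prop where
  measurable_Ghat : ∀ k l, Measurable fun ω => F.Ghat ω k l
  measurable_φhat : Measurable F.φhat
  measurable_βhat : Measurable F.βhat
  measurable_bhat : ∀ i, Measurable (F.bhat i)
  isMax : ∀ᵐ ω ∂P, ∀ (β : Vec p) (b : ℕ → Vec p),
    M.objective D (fun i j => S.y i j ω) (F.Ghat ω) (F.φhat ω) β b ≤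
      M.objective D (fun i j => S.y i j ω) (F.Ghat ω) (F.φhat ω) (F.βhat ω)
        (fun i => F.bhat i ω)

section Asymptotics

variable {Ω : ℕ → Type*} [∀ t, MeasurableSpace (Ω t)]

/-- `Z t = O_p(1)` as `t → ∞`. -/
def StochBounded (P : ∀ t, Measure (Ω t)) (Z : ∀ t, Ω t → ℝ) : Prop :=
  ∀ ε : ENNReal, 0 < ε → ∃ B : ℝ, ∀ᶠ t in atTop, P t {ω | B < |Z t ω|} ≤ ε

/-- `Z t` converges to the constant `z` in probability as `t → ∞`. -/
def TendstoInProb (P : ∀ t, Measure (Ω t)) (Z : ∀ t, Ω t → ℝ) (z : ℝ) : Prop :=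
  ∀ ε : ℝ, 0 < ε → Tendsto (fun t => P t {ω | ε ≤ |Z t ω - z|}) atTop (𝓝 0)

/-- `Z t` converges in distribution to the probability measure `μ` as `t → ∞`. -/
def TendstoInLaw (P : ∀ t, Measure (Ω t)) [∀ t, IsProbabilityMeasure (P t)]
    (Z : ∀ t, Ω t → Vec p) (μ : Measure (Vec p)) : Prop :=
  ∃ _ : IsProbabilityMeasure μ, TendstoInDistribution Z atTop id P μ

/-- The normal mixture: the law of a vector that, given `b` with law `F`, is normal with mean
`mean b` and covariance matrix `cov b`. -/
def mixN (mean : Vec p → Vec p) (cov : Vec p → Matrix (Fin p) (Fin p) ℝ)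
    (F : Measure (Vec p)) : Measure (Vec p) :=
  F.bind fun b => multivariateGaussian (mean b) (cov b)

/-- Positive definite with all eigenvalues between `c` and `c⁻¹`. -/
def EigenBounded (c : ℝ) (A : Matrix (Fin p) (Fin p) ℝ) : Prop :=
  A.PosDef ∧ ∀ μ ∈ spectrum ℝ A, c ≤ μ ∧ μ ≤ c⁻¹

/-- Growth of the designs: the number of clusters and the minimum cluster size tend to infinity,
and the cluster sizes are uniformly of the order of the smallest one. -/
structure Growth (D : ℕ → Design p) : Prop where
  m_tendsto : Tendsto (fun t => (D t).m) atTop atTop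
  nL_tendsto : Tendsto (fun t => (D t).nL) atTop atTop
  balanced : ∃ C : ℝ, ∀ᶠ t in atTop, ∀ i < (D t).m, ((D t).n i : ℝ) ≤ C * (D t).nL

def C1 (M : Model p) : Prop :=
  ContDiff ℝ 3 M.a ∧ ∃ c₀ : ℝ, 0 < c₀ ∧ ∀ η,
    c₀ ≤ iteratedDeriv 2 M.a η ∧ iteratedDeriv 2 M.a η ≤ c₀⁻¹ ∧ |iteratedDeriv 3 M.a η| ≤ c₀⁻¹

/-- `K i b` is the limit of the matrices `H` of cluster `i` when its random effect is `b`; as the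
random effects are random, this limit is taken for almost every `b`, and the limit of the averages
is taken in probability. -/
structure C2 (P : ∀ t, Measure (Ω t)) (M : Model p) (D : ℕ → Design p)
    (S : ∀ t, Sample p (Ω t)) (K : ℕ → Vec p → Matrix (Fin p) (Fin p) ℝ)
    (Kbar : Matrix (Fin p) (Fin p) ℝ) : Prop where
  bounded_x : ∃ C₁ : ℝ, ∀ t, ∀ i < (D t).m, ∀ j < (D t).n i, ∀ k, |(D t).x i j k| < C₁
  info_invertible : ∀ᶠ t in atTop, ∀ i < (D t).m, ∀ b, IsUnit (M.info (D t) i b)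
  tendsto_H : ∀ i, ∀ᵐ b ∂(multivariateGaussian 0 M.G),
    Tendsto (fun t => M.H (D t) i b) atTop (𝓝 (K i b))
  tendsto_avg : ∀ k l, TendstoInProb P
    (fun t ω => (((D t).m : ℝ)⁻¹ • ∑ i ∈ Finset.range (D t).m,
      ((D t).nbar / (D t).n i) • M.H (D t) i ((S t).b i ω)) k l) (Kbar k l)
  eigen : ∃ c₁ : ℝ, 0 < c₁ ∧ EigenBounded c₁ Kbar ∧
    ∀ i, ∀ᵐ b ∂(multivariateGaussian 0 M.G), EigenBounded c₁ (K i b)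

/-- The vector of all true fixed and random effects is an interior point of some compact set of
parameter vectors; the set may depend on the stage and on the realised random effects. -/
def C3 (M : Model p) (D : ℕ → Design p) (S : ∀ t, Sample p (Ω t)) : Prop :=
  ∀ t ω, ∃ Θ : Set (Vec p × (Fin (D t).m → Vec p)), IsCompact Θ ∧
    (M.β, fun i : Fin (D t).m => (S t).b i ω) ∈ interior Θ

structure C4 (P : ∀ t, Measure (Ω t)) (F : ∀ t, Fit p (Ω t)) : Prop where
  posDef_Ghat : ∀ t, ∀ᵐ ω ∂(P t), ((F t).Ghat ω).PosDef
  bounded_Ghat_inv : ∀ k l, StochBounded P fun t ω => ((F t).Ghat ω)⁻¹ k l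
  φhat_pos : ∀ t, ∀ᵐ ω ∂(P t), 0 < (F t).φhat ω
  bounded_φhat : StochBounded P fun t ω => (F t).φhat ω

/-- The normalised score of cluster `i`, whose fourth moments are required to be finite. -/
def normScore {Ω : Type*} (M : Model p) (D : Design p) (S : Sample p Ω) (F : Fit p Ω) (i : ℕ)
    (ω : Ω) : Fin p → ℝ :=
  √(D.n i : ℝ) • (((D.X i)ᵀ * M.W D (F.φhat ω) i (S.b i ω) * D.X i + (F.Ghat ω)⁻¹)⁻¹ *ᵥ
    ((F.φhat ω)⁻¹ • ((D.X i)ᵀ *ᵥ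
        ((fun j : Fin (D.n i) => S.y i j ω) - M.mean D i (S.b i ω)))
      - (F.Ghat ω)⁻¹ *ᵥ WithLp.ofLp (S.b i ω)))

def C5 (P : ∀ t, Measure (Ω t)) (M : Model p) (D : ℕ → Design p)
    (S : ∀ t, Sample p (Ω t)) (F : ∀ t, Fit p (Ω t)) : Prop :=
  ∀ t, ∀ i < (D t).m, ∀ k,
    ∫⁻ ω, ENNReal.ofReal (normScore M (D t) (S t) (F t) i ω k ^ 4) ∂(P t) < ⊤

end Asymptotics

end PQL

end

/-!
The score equations of the maximiser linearise cluster by cluster: strong convexity and a cubic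
Taylor bound give `β̂ + b̂ₖ - (β + bₖ) = zₖ + O_p(1 / n_L)`, where the linearised deviation `zₖ` is
the conditional score of cluster `k` normalised by its information matrix. Shifting all `bₖ` by one
vector and `β` by the opposite one leaves the likelihood unchanged, so `∑ₖ b̂ₖ = 0` at the maximum,
and `β̂ - β` is the average of the `bₖ` plus the average of these deviations. Hence
`b̂ᵢ - bᵢ = zᵢ - m⁻¹ ∑_{k ≠ i} bₖ` up to negligible terms. The two terms are independent: the first
is of order `nᵢ^{-1/2}` and mixed normal in the limit, by its characteristic function conditional on
`bᵢ`, and the second is exactly Gaussian with covariance of order `m⁻¹`. The limit of `m / nᵢ`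
decides which of them survives.
-/

noncomputable section

namespace PQL

/-! ### Taylor bounds -/

section Taylor

lemma abs_sub_sub_mul_le {f f' f'' : ℝ → ℝ} {C : ℝ} (hf : ∀ s, HasDerivAt f (f' s) s)
    (hf' : ∀ s, HasDerivAt f' (f'' s) s) (hC : ∀ s, |f'' s| ≤ C) (s h : ℝ) :
    |f (s + h) - f s - f' s * h| ≤ C * h ^ 2 := by
  have hC₀ : 0 ≤ C := (abs_nonneg _).trans (hC 0)
  have hlip (u : ℝ) : |f' (s + u) - f' s| ≤ C * |u| := by
    simpa using Convex.norm_image_sub_le_of_norm_hasDerivWithin_le (f := f') (f' := f'')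
      (fun x _ => (hf' x).hasDerivWithinAt) (fun x _ => hC x)
      convex_univ (Set.mem_univ s) (Set.mem_univ (s + u))
  have hd (u : ℝ) : HasDerivAt (fun u => f (s + u) - f' s * u) (f' (s + u) - f' s) u :=
    (HasDerivAt.comp_const_add s u (hf (s + u))).sub
      (by simpa using (hasDerivAt_id u).const_mul (f' s))
  have hbound : ∀ u ∈ Set.uIcc 0 h, |f' (s + u) - f' s| ≤ C * |h| := fun u hu =>
    (hlip u).trans <| by
      have : |u| ≤ |h| := by simpa using Set.abs_sub_left_of_mem_uIcc hu
      gcongr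
  have hmvt := Convex.norm_image_sub_le_of_norm_hasDerivWithin_le
    (fun u _ => (hd u).hasDerivWithinAt) hbound (convex_uIcc 0 h) Set.left_mem_uIcc
    Set.right_mem_uIcc
  simp only [add_zero, mul_zero, sub_zero, Real.norm_eq_abs] at hmvt
  calc |f (s + h) - f s - f' s * h| = |f (s + h) - f' s * h - f s| := by rw [sub_right_comm]
    _ ≤ C * |h| * |h| := hmvt
    _ = C * h ^ 2 := by rw [mul_assoc, abs_mul_abs_self, sq]

lemma mul_sq_le_sub_mul {f f' : ℝ → ℝ} {c : ℝ} (hf : ∀ s, HasDerivAt f (f' s) s)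
    (hc : ∀ s, c ≤ f' s) (s h : ℝ) : c * h ^ 2 ≤ (f (s + h) - f s) * h := by
  have hd (u : ℝ) : HasDerivAt (fun u => f u - c * u) (f' u - c) u :=
    (hf u).sub (by simpa using (hasDerivAt_id u).const_mul c)
  have hmono : Monotone fun u => f u - c * u :=
    monotone_of_deriv_nonneg (fun u => (hd u).differentiableAt)
      fun u => by rw [(hd u).deriv]; exact sub_nonneg.2 (hc u)
  rcases le_total 0 h with h0 | h0
  · have : f s - c * s ≤ f (s + h) - c * (s + h) := hmono (by linarith)
    nlinarith
  · have : f (s + h) - c * (s + h) ≤ f s - c * s := hmono (by linarith)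
    nlinarith

lemma norm_cexp_mul_I_sub_le (x : ℝ) :
    ‖Complex.exp (x * Complex.I) - (1 + x * Complex.I - x ^ 2 / 2)‖ ≤ 4 * |x| ^ 3 := by
  rcases le_total |x| 1 with hx | hx
  · have hnorm : ‖(x : ℂ) * Complex.I‖ = |x| := by simp
    have hsum : ∑ k ∈ Finset.range 3, ((x : ℂ) * Complex.I) ^ k / (k.factorial : ℂ) =
        1 + x * Complex.I - x ^ 2 / 2 := by
      simp [Finset.sum_range_succ, mul_pow, Nat.factorial, neg_div, ← sub_eq_add_neg]
    have hexp := Complex.exp_bound (x := x * Complex.I) (hnorm.trans_le hx) (n := 3) (by norm_num)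
    rw [hnorm, hsum] at hexp
    refine hexp.trans ?_
    have : 0 ≤ |x| ^ 3 := by positivity
    norm_num [Nat.factorial]
    linarith
  · calc ‖Complex.exp (x * Complex.I) - (1 + x * Complex.I - x ^ 2 / 2)‖
        ≤ ‖Complex.exp (x * Complex.I)‖ + (‖(1 : ℂ) + x * Complex.I‖ + ‖(x ^ 2 / 2 : ℂ)‖) :=
          (norm_sub_le _ _).trans (by gcongr; exact norm_sub_le _ _)
      _ ≤ 1 + (1 + |x| + |x| ^ 2 / 2) := by
          rw [Complex.norm_exp_ofReal_mul_I]
          gcongr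
          · exact (norm_add_le _ _).trans (by simp)
          · simp
      _ ≤ 4 * |x| ^ 3 := by
          have h₁ : |x| ≤ |x| ^ 3 := le_self_pow₀ hx (by norm_num)
          have h₂ : |x| ^ 2 ≤ |x| ^ 3 := pow_le_pow_right₀ hx (by norm_num)
          linarith

lemma abs_exp_neg_sub_le {x : ℝ} (hx : 0 ≤ x) : |Real.exp (-x) - (1 - x)| ≤ x ^ 2 := by
  rcases le_total x 1 with hx₁ | hx₁
  · have h := Real.norm_exp_sub_one_sub_id_le (x := -x) (by simpa [abs_of_nonneg hx] using hx₁)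
    simp only [Real.norm_eq_abs, abs_neg, sq_abs] at h
    rwa [sub_sub, ← sub_eq_add_neg] at h
  · have h₁ := Real.add_one_le_exp (-x)
    have h₂ : Real.exp (-x) ≤ 1 := Real.exp_le_one_iff.2 (by linarith)
    rw [abs_of_nonneg (by linarith)]
    nlinarith

end Taylor

lemma norm_prod_sub_prod_le {ι 𝕜 : Type*} [NormedField 𝕜] (s : Finset ι) (f g : ι → 𝕜)
    (hf : ∀ i ∈ s, ‖f i‖ ≤ 1) (hg : ∀ i ∈ s, ‖g i‖ ≤ 1) :
    ‖∏ i ∈ s, f i - ∏ i ∈ s, g i‖ ≤ ∑ i ∈ s, ‖f i - g i‖ := by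
  classical
  induction s using Finset.induction_on with
  | empty => simp
  | insert i s hi ih =>
    have hfi : ‖f i‖ ≤ 1 := hf i (Finset.mem_insert_self i s)
    have hprod : ‖∏ j ∈ s, g j‖ ≤ 1 := by
      rw [norm_prod]
      exact Finset.prod_le_one (fun _ _ => norm_nonneg _)
        fun j hj => hg j (Finset.mem_insert_of_mem hj)
    have hrest := ih (fun j hj => hf j (Finset.mem_insert_of_mem hj))
      (fun j hj => hg j (Finset.mem_insert_of_mem hj))
    rw [Finset.prod_insert hi, Finset.prod_insert hi, Finset.sum_insert hi]
    calc ‖f i * ∏ j ∈ s, f j - g i * ∏ j ∈ s, g j‖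
        = ‖(f i - g i) * ∏ j ∈ s, g j + f i * (∏ j ∈ s, f j - ∏ j ∈ s, g j)‖ := by ring_nf
      _ ≤ ‖f i - g i‖ * ‖∏ j ∈ s, g j‖ + ‖f i‖ * ‖∏ j ∈ s, f j - ∏ j ∈ s, g j‖ := by
          rw [← norm_mul, ← norm_mul]
          exact norm_add_le _ _
      _ ≤ ‖f i - g i‖ + ∑ j ∈ s, ‖f j - g j‖ :=
          add_le_add (mul_le_of_le_one_right (norm_nonneg _) hprod)
            ((mul_le_of_le_one_left (norm_nonneg _) hfi).trans hrest)

section CharacteristicFunction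

variable {Ω : Type*} [MeasurableSpace Ω] {μ : Measure Ω} {X : Ω → ℝ}

lemma integrable_cexp_mul_I [IsFiniteMeasure μ] (hX : AEMeasurable X μ) :
    Integrable (fun ω => Complex.exp (X ω * Complex.I)) μ := by
  refine Integrable.of_bound (C := 1) ?_ (ae_of_all _ fun ω => ?_)
  · exact (Complex.measurable_exp.comp_aemeasurable
      ((Complex.measurable_ofReal.comp_aemeasurable hX).mul_const _)).aestronglyMeasurable
  · rw [Complex.norm_exp_ofReal_mul_I]

variable [IsProbabilityMeasure μ]

lemma integral_cexp_taylor (hX : Integrable X μ) (hX₂ : Integrable (fun ω => X ω ^ 2) μ)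
    (hmean : ∫ ω, X ω ∂μ = 0) :
    Integrable (fun ω => (1 + X ω * Complex.I - (X ω : ℂ) ^ 2 / 2)) μ ∧
      ∫ ω, (1 + X ω * Complex.I - (X ω : ℂ) ^ 2 / 2) ∂μ =
        ((1 - (∫ ω, X ω ^ 2 ∂μ) / 2 : ℝ) : ℂ) := by
  have hlin : Integrable (fun ω => (1 : ℂ) + X ω * Complex.I) μ :=
    (integrable_const _).add (hX.ofReal.mul_const _)
  have hsq : Integrable (fun ω => (X ω : ℂ) ^ 2 / 2) μ := by
    simpa using (hX₂.ofReal (𝕜 := ℂ)).div_const 2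
  have hint_sq : ∫ ω, (X ω : ℂ) ^ 2 / 2 ∂μ = ((∫ ω, X ω ^ 2 ∂μ : ℝ) : ℂ) / 2 := by
    rw [integral_div, ← integral_complex_ofReal]
    simp only [Complex.ofReal_pow]
  refine ⟨hlin.sub hsq, ?_⟩
  rw [integral_sub hlin hsq, integral_add (integrable_const _) (hX.ofReal.mul_const _), hint_sq,
    integral_mul_const, integral_complex_ofReal, hmean]
  simp

lemma norm_integral_cexp_mul_I_sub_le (hX : Integrable X μ)
    (hX₂ : Integrable (fun ω => X ω ^ 2) μ) (hX₃ : Integrable (fun ω => |X ω| ^ 3) μ)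
    (hmean : ∫ ω, X ω ∂μ = 0) :
    ‖∫ ω, Complex.exp (X ω * Complex.I) ∂μ - Real.exp (-((∫ ω, X ω ^ 2 ∂μ) / 2))‖ ≤
      4 * ∫ ω, |X ω| ^ 3 ∂μ + ((∫ ω, X ω ^ 2 ∂μ) / 2) ^ 2 := by
  set v := ∫ ω, X ω ^ 2 ∂μ
  have hv : 0 ≤ v / 2 := by have : 0 ≤ v := integral_nonneg fun _ => sq_nonneg _; positivity
  obtain ⟨hint, htaylor⟩ := integral_cexp_taylor hX hX₂ hmean
  have hexp := integrable_cexp_mul_I hX.aemeasurable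
  calc ‖∫ ω, Complex.exp (X ω * Complex.I) ∂μ - Real.exp (-(v / 2))‖
      ≤ ‖∫ ω, Complex.exp (X ω * Complex.I) ∂μ - ((1 - v / 2 : ℝ) : ℂ)‖
        + ‖((1 - v / 2 : ℝ) : ℂ) - Real.exp (-(v / 2))‖ := norm_sub_le_norm_sub_add_norm_sub ..
    _ ≤ 4 * ∫ ω, |X ω| ^ 3 ∂μ + (v / 2) ^ 2 := by
      refine add_le_add ?_ ?_
      · rw [← htaylor, ← integral_sub hexp hint, ← integral_const_mul]
        exact (norm_integral_le_integral_norm _).trans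
          (integral_mono (hexp.sub hint).norm (hX₃.const_mul _)
            fun ω => norm_cexp_mul_I_sub_le (X ω))
      · rw [← Complex.ofReal_sub, Complex.norm_real, Real.norm_eq_abs, abs_sub_comm]
        exact abs_exp_neg_sub_le hv

end CharacteristicFunction

/-! ### The penalised score equation of one cluster -/

section Form

variable {E : Type*} [NormedAddCommGroup E] [InnerProductSpace ℝ E] {Λ : E →ₗ[ℝ] E →ₗ[ℝ] ℝ}

lemma bilin_sub_le {lam : ℝ} (hΛ : Λ.IsPosSemidef) (hlam : ∀ v, Λ v v ≤ lam * ‖v‖ ^ 2) (u v : E) :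
    Λ (u - v) (u - v) ≤ 2 * lam * (‖u‖ ^ 2 + ‖v‖ ^ 2) := by
  have hadd := hΛ.nonneg (u + v)
  have hu := hlam u
  have hv := hlam v
  simp only [map_add, map_sub, LinearMap.add_apply, LinearMap.sub_apply] at hadd ⊢
  linarith

lemma bilin_add_le {τ : ℝ} (hΛ : Λ.IsPosSemidef) {u v : E} (hu : Λ u u ≤ τ) (hv : Λ v v ≤ τ) :
    Λ (u + v) (u + v) ≤ 4 * τ := by
  have hsub := hΛ.nonneg (u - v)
  simp only [map_add, map_sub, LinearMap.add_apply, LinearMap.sub_apply] at hsub ⊢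
  linarith

end Form

section Energy

variable {E : Type*} [NormedAddCommGroup E] [InnerProductSpace ℝ E] {J : Type*} [Fintype J]
  {x : J → E} {c : ℝ}

/-- The squared length of the vector of linear predictors `⟪x j, v⟫`. -/
def energy (x : J → E) (v : E) : ℝ := ∑ j, inner ℝ (x j) v ^ 2

lemma energy_nonneg (x : J → E) (v : E) : 0 ≤ energy x v :=
  Finset.sum_nonneg fun _ _ => sq_nonneg _

lemma sum_mul_inner_mul_inner_le {w : J → ℝ} (hc : 0 < c) (hw₀ : ∀ j, 0 ≤ w j)
    (hw : ∀ j, w j ≤ c⁻¹) (u v : E) :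
    ∑ j, w j * inner ℝ (x j) u * inner ℝ (x j) v ≤
      c / 2 * energy x v + (c ^ 3)⁻¹ / 2 * energy x u := by
  simp only [energy, Finset.mul_sum, ← Finset.sum_add_distrib]
  refine Finset.sum_le_sum fun j _ => ?_
  set s := inner ℝ (x j) u
  set t := inner ℝ (x j) v
  have hwc : c * w j ≤ 1 := by simpa [hc.ne'] using mul_le_mul_of_nonneg_left (hw j) hc.le
  have hws : (c * w j) ^ 2 * s ^ 2 ≤ s ^ 2 :=
    mul_le_of_le_one_left (sq_nonneg s) (pow_le_one₀ (mul_nonneg hc.le (hw₀ j)) hwc)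
  refine le_of_mul_le_mul_left ?_ (pow_pos hc 3)
  have : c ^ 3 * (c / 2 * t ^ 2 + (c ^ 3)⁻¹ / 2 * s ^ 2) = c ^ 4 / 2 * t ^ 2 + s ^ 2 / 2 := by
    field_simp
  rw [this]
  nlinarith [sq_nonneg (c ^ 2 * t - c * w j * s)]

/-- The penalised score equation of one cluster at the maximiser, which deviates by `δ` from the
true coefficient and predicts the random effect `b + δ - ε`; `z` is the linearised deviation, `g`
the mean function, `η` the true linear predictors, `e` the errors, `w` the weights and `Λ` the
penalty, of size at most `lam`. -/
structure ClusterScore (x : J → E) (g : ℝ → ℝ) (η w e : J → ℝ) (Λ : E →ₗ[ℝ] E →ₗ[ℝ] ℝ)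
    (c lam : ℝ) (b ε δ z : E) : Prop where
  score : ∀ v, ∑ j, e j * inner ℝ (x j) v
    - ∑ j, (g (η j + inner ℝ (x j) δ) - g (η j)) * inner ℝ (x j) v = Λ (b + δ - ε) v
  linearised : ∀ v, ∑ j, e j * inner ℝ (x j) v =
    ∑ j, w j * inner ℝ (x j) z * inner ℝ (x j) v
  c_pos : 0 < c
  le_weight : ∀ j, c ≤ w j
  weight_le : ∀ j, w j ≤ c⁻¹
  monotone : ∀ j h, c * h ^ 2 ≤ (g (η j + h) - g (η j)) * h
  taylor : ∀ j h, |g (η j + h) - g (η j) - w j * h| ≤ c⁻¹ * h ^ 2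
  posSemidef : Λ.IsPosSemidef
  lam_nonneg : 0 ≤ lam
  penalty_le : ∀ v, Λ v v ≤ lam * ‖v‖ ^ 2

/-- The bound on the energy of the deviation of one cluster, in terms of the energy `q` of the
linearised deviation. -/
def energyBound (c lam q : ℝ) (b ε : E) : ℝ := (c ^ 3)⁻¹ * q + 2 * lam * (‖b‖ ^ 2 + ‖ε‖ ^ 2)

namespace ClusterScore

variable {g : ℝ → ℝ} {η w e : J → ℝ} {Λ : E →ₗ[ℝ] E →ₗ[ℝ] ℝ} {lam : ℝ} {b ε δ z : E}

-- Test the score equation against `δ`, and complete the square in the penalty.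
lemma energy_add_penalty_le (h : ClusterScore x g η w e Λ c lam b ε δ z) :
    c * energy x δ + Λ δ δ ≤ energyBound c lam (energy x z) b ε := by
  have hscore := h.score δ
  rw [h.linearised δ] at hscore
  have hyoung := sum_mul_inner_mul_inner_le (x := x) h.c_pos
    (fun j => h.c_pos.le.trans (h.le_weight j)) h.weight_le z δ
  have hmono : c * energy x δ ≤
      ∑ j, (g (η j + inner ℝ (x j) δ) - g (η j)) * inner ℝ (x j) δ := by
    rw [energy, Finset.mul_sum]
    exact Finset.sum_le_sum fun j _ => h.monotone j _
  have hsplit : Λ (b + δ - ε) δ = Λ (b - ε) δ + Λ δ δ := by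
    rw [add_sub_right_comm, map_add, LinearMap.add_apply]
  have hsymm : Λ δ (b - ε) = Λ (b - ε) δ := (h.posSemidef.isSymm.eq _ _).symm
  have hsquare := h.posSemidef.nonneg ((b - ε) + δ)
  rw [map_add Λ, LinearMap.add_apply, map_add, map_add, hsymm] at hsquare
  have hbε := bilin_sub_le h.posSemidef h.penalty_le b ε
  rw [energyBound]
  linarith

lemma energy_le (h : ClusterScore x g η w e Λ c lam b ε δ z) :
    energy x δ ≤ c⁻¹ * energyBound c lam (energy x z) b ε := by
  rw [← div_eq_inv_mul, le_div_iff₀' h.c_pos]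
  linarith [h.energy_add_penalty_le, h.posSemidef.nonneg δ]

lemma energyBound_nonneg (h : ClusterScore x g η w e Λ c lam b ε δ z) :
    0 ≤ energyBound c lam (energy x z) b ε := by
  have := h.c_pos
  have := h.lam_nonneg
  have := energy_nonneg x z
  unfold energyBound
  positivity

lemma abs_penalty_le (h : ClusterScore x g η w e Λ c lam b ε δ z) (v : E) :
    |Λ (b + δ - ε) v| ≤ (energyBound c lam (energy x z) b ε + lam) * ‖v‖ := by
  have hc := h.c_pos
  have hlam := h.lam_nonneg
  have hτ := h.energyBound_nonneg
  have hδ := h.energy_add_penalty_le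
  have hbε := bilin_sub_le h.posSemidef h.penalty_le b ε
  set τ := energyBound c lam (energy x z) b ε with hτ_def
  have hδτ : Λ δ δ ≤ τ := by nlinarith [energy_nonneg x δ]
  have hbετ : Λ (b - ε) (b - ε) ≤ τ := by
    have : 0 ≤ (c ^ 3)⁻¹ * energy x z := mul_nonneg (by positivity) (energy_nonneg x z)
    rw [hτ_def, energyBound]
    linarith
  refine abs_le_of_sq_le_sq ?_ (by positivity)
  calc Λ (b + δ - ε) v ^ 2 ≤ Λ (b + δ - ε) (b + δ - ε) * Λ v v :=
        LinearMap.BilinForm.apply_sq_le_of_symm Λ h.posSemidef.nonneg h.posSemidef.isSymm _ _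
    _ ≤ (4 * τ) * (lam * ‖v‖ ^ 2) := by
        refine mul_le_mul ?_ (h.penalty_le v) (h.posSemidef.nonneg v) (by positivity)
        rw [add_sub_right_comm]
        exact bilin_add_le h.posSemidef hbετ hδτ
    _ ≤ ((τ + lam) * ‖v‖) ^ 2 := by
        rw [mul_pow, ← mul_assoc]
        gcongr
        linarith [four_mul_le_sq_add τ lam]

lemma abs_remainder_le (h : ClusterScore x g η w e Λ c lam b ε δ z) {Cx : ℝ}
    (hx : ∀ j, ‖x j‖ ≤ Cx) (v : E) :
    |∑ j, (g (η j + inner ℝ (x j) δ) - g (η j) - w j * inner ℝ (x j) δ) * inner ℝ (x j) v| ≤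
      c⁻¹ * energy x δ * (Cx * ‖v‖) := by
  have := h.c_pos
  refine (Finset.abs_sum_le_sum_abs _ _).trans ?_
  rw [energy, Finset.mul_sum, Finset.sum_mul]
  refine Finset.sum_le_sum fun j _ => ?_
  rw [abs_mul]
  refine mul_le_mul (h.taylor j _) ?_ (abs_nonneg _) (by positivity)
  exact (abs_real_inner_le_norm _ _).trans (mul_le_mul_of_nonneg_right (hx j) (norm_nonneg _))

lemma sum_weight_mul_sq_sub (h : ClusterScore x g η w e Λ c lam b ε δ z) :
    ∑ j, w j * inner ℝ (x j) (δ - z) ^ 2 =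
      -∑ j, (g (η j + inner ℝ (x j) δ) - g (η j) - w j * inner ℝ (x j) δ)
          * inner ℝ (x j) (δ - z) - Λ (b + δ - ε) (δ - z) := by
  rw [← h.score, h.linearised, ← Finset.sum_sub_distrib, ← Finset.sum_neg_distrib,
    ← Finset.sum_sub_distrib]
  refine Finset.sum_congr rfl fun j _ => ?_
  rw [inner_sub_right]
  ring

lemma energy_sub_le (h : ClusterScore x g η w e Λ c lam b ε δ z) {Cx : ℝ} (hCx : 0 ≤ Cx)
    (hx : ∀ j, ‖x j‖ ≤ Cx) :
    energy x (δ - z) ≤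
      c⁻¹ * (((Cx * (c ^ 2)⁻¹ + 1) * energyBound c lam (energy x z) b ε + lam) * ‖δ - z‖) := by
  have hc := h.c_pos
  have hpen := h.abs_penalty_le (δ - z)
  have hrem := h.abs_remainder_le hx (δ - z)
  have hδ := h.energy_le
  set τ := energyBound c lam (energy x z) b ε
  have hlow : c * energy x (δ - z) ≤ ∑ j, w j * inner ℝ (x j) (δ - z) ^ 2 := by
    rw [energy, Finset.mul_sum]
    exact Finset.sum_le_sum fun j _ => mul_le_mul_of_nonneg_right (h.le_weight j) (sq_nonneg _)
  rw [h.sum_weight_mul_sq_sub] at hlow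
  have hquad : c⁻¹ * energy x δ * (Cx * ‖δ - z‖) ≤ Cx * (c ^ 2)⁻¹ * τ * ‖δ - z‖ :=
    calc c⁻¹ * energy x δ * (Cx * ‖δ - z‖) ≤ c⁻¹ * (c⁻¹ * τ) * (Cx * ‖δ - z‖) := by gcongr
      _ = Cx * (c ^ 2)⁻¹ * τ * ‖δ - z‖ := by field_simp
  rw [← div_eq_inv_mul, le_div_iff₀' hc]
  linarith [abs_le.1 hpen, abs_le.1 hrem]

variable {n κ : ℝ}

lemma norm_sub_le (h : ClusterScore x g η w e Λ c lam b ε δ z) {Cx : ℝ} (hCx : 0 ≤ Cx)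
    (hx : ∀ j, ‖x j‖ ≤ Cx) (hκ₀ : 0 ≤ κ) (hκ : ∀ v, n * ‖v‖ ^ 2 ≤ κ * energy x v) :
    n * ‖δ - z‖ ≤
      κ * (c⁻¹ * ((Cx * (c ^ 2)⁻¹ + 1) * energyBound c lam (energy x z) b ε + lam)) := by
  have hE := mul_le_mul_of_nonneg_left (h.energy_sub_le hCx hx) hκ₀
  have hc := h.c_pos
  have hlam := h.lam_nonneg
  have hτ := h.energyBound_nonneg
  rcases (norm_nonneg (δ - z)).eq_or_lt with h0 | h0
  · rw [← h0, mul_zero]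
    positivity
  · refine le_of_mul_le_mul_right ?_ h0
    linarith [hκ (δ - z)]

lemma norm_sq_le (h : ClusterScore x g η w e Λ c lam b ε δ z) (hκ₀ : 0 ≤ κ)
    (hκ : ∀ v, n * ‖v‖ ^ 2 ≤ κ * energy x v) :
    n * ‖δ‖ ^ 2 ≤ κ * (c⁻¹ * energyBound c lam (energy x z) b ε) :=
  (hκ δ).trans (mul_le_mul_of_nonneg_left h.energy_le hκ₀)

end ClusterScore

end Energy

section Average

variable {E : Type*} [SeminormedAddCommGroup E]

lemma norm_sum_sq_le_card_mul (s : Finset ℕ) (v : ℕ → E) :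
    ‖∑ k ∈ s, v k‖ ^ 2 ≤ s.card * ∑ k ∈ s, ‖v k‖ ^ 2 :=
  (pow_le_pow_left₀ (norm_nonneg _) (norm_sum_le _ _) 2).trans sq_sum_le_card_mul_sum_sq

variable [NormedSpace ℝ E]

lemma norm_average_sq_le (m : ℕ) (v : ℕ → E) :
    ‖(m : ℝ)⁻¹ • ∑ k ∈ Finset.range m, v k‖ ^ 2 ≤
      (m : ℝ)⁻¹ * ∑ k ∈ Finset.range m, ‖v k‖ ^ 2 := by
  rcases m.eq_zero_or_pos with rfl | hm
  · simp
  have : (0 : ℝ) < m := by exact_mod_cast hm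
  have h := norm_sum_sq_le_card_mul (Finset.range m) v
  rw [Finset.card_range] at h
  calc ‖(m : ℝ)⁻¹ • ∑ k ∈ Finset.range m, v k‖ ^ 2
      = (m : ℝ)⁻¹ ^ 2 * ‖∑ k ∈ Finset.range m, v k‖ ^ 2 := by
        rw [norm_smul, mul_pow, Real.norm_of_nonneg (by positivity)]
    _ ≤ (m : ℝ)⁻¹ ^ 2 * (m * ∑ k ∈ Finset.range m, ‖v k‖ ^ 2) := by gcongr
    _ = (m : ℝ)⁻¹ * ∑ k ∈ Finset.range m, ‖v k‖ ^ 2 := by field_simp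

end Average

section FixedEffect

variable {E : Type*} [NormedAddCommGroup E]

variable {m : ℕ} {c lam N : ℝ} {κ q : ℕ → ℝ} {b δ : ℕ → E} {ε : E}

lemma average_mul_energyBound (c lam : ℝ) (m : ℕ) (κ q : ℕ → ℝ) (b : ℕ → E) (ε : E) :
    (m : ℝ)⁻¹ * ∑ k ∈ Finset.range m, κ k * energyBound c lam (q k) (b k) ε =
      (c ^ 3)⁻¹ * ((m : ℝ)⁻¹ * ∑ k ∈ Finset.range m, κ k * q k)
        + 2 * lam * ((m : ℝ)⁻¹ * ∑ k ∈ Finset.range m, κ k * ‖b k‖ ^ 2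
          + (m : ℝ)⁻¹ * (∑ k ∈ Finset.range m, κ k) * ‖ε‖ ^ 2) := by
  simp only [Finset.mul_sum, Finset.sum_mul, ← Finset.sum_add_distrib, energyBound]
  exact Finset.sum_congr rfl fun k _ => by ring

variable [NormedSpace ℝ E]

-- The bounds on `δ k` involve `‖ε‖ ^ 2` too, but with a factor that is small relative to `c * N`.
lemma norm_sq_average_le (hκ : 8 * lam * ((m : ℝ)⁻¹ * ∑ k ∈ Finset.range m, κ k) ≤ c * N)
    (hc : 0 < c) (hN : 1 ≤ c * N) (hlam : 0 ≤ lam)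
    (hδ : ∀ k < m, N * ‖δ k‖ ^ 2 ≤ κ k * (c⁻¹ * energyBound c lam (q k) (b k) ε))
    (hκq : 0 ≤ (m : ℝ)⁻¹ * ∑ k ∈ Finset.range m, κ k * q k)
    (hκb : 0 ≤ (m : ℝ)⁻¹ * ∑ k ∈ Finset.range m, κ k * ‖b k‖ ^ 2)
    (hε : ε = (m : ℝ)⁻¹ • ∑ k ∈ Finset.range m, δ k + (m : ℝ)⁻¹ • ∑ k ∈ Finset.range m, b k) :
    ‖ε‖ ^ 2 ≤ 4 * ((c ^ 3)⁻¹ * ((m : ℝ)⁻¹ * ∑ k ∈ Finset.range m, κ k * q k)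
        + 2 * lam * ((m : ℝ)⁻¹ * ∑ k ∈ Finset.range m, κ k * ‖b k‖ ^ 2)
        + (m : ℝ)⁻¹ * ∑ k ∈ Finset.range m, ‖b k‖ ^ 2) := by
  have hτ := average_mul_energyBound c lam m κ q b ε
  have hδ' : c * N * ((m : ℝ)⁻¹ * ∑ k ∈ Finset.range m, ‖δ k‖ ^ 2) ≤
      (m : ℝ)⁻¹ * ∑ k ∈ Finset.range m, κ k * energyBound c lam (q k) (b k) ε := by
    rw [mul_left_comm, Finset.mul_sum]
    refine mul_le_mul_of_nonneg_left (Finset.sum_le_sum fun k hk => ?_) (by positivity)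
    calc c * N * ‖δ k‖ ^ 2 = c * (N * ‖δ k‖ ^ 2) := mul_assoc ..
      _ ≤ c * (κ k * (c⁻¹ * energyBound c lam (q k) (b k) ε)) :=
          mul_le_mul_of_nonneg_left (hδ k (Finset.mem_range.1 hk)) hc.le
      _ = κ k * energyBound c lam (q k) (b k) ε := by field_simp
  have hε' : ‖ε‖ ^ 2 ≤ 2 * ((m : ℝ)⁻¹ * ∑ k ∈ Finset.range m, ‖δ k‖ ^ 2
      + (m : ℝ)⁻¹ * ∑ k ∈ Finset.range m, ‖b k‖ ^ 2) := by
    rw [hε]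
    calc _ ≤ 2 * (‖(m : ℝ)⁻¹ • ∑ k ∈ Finset.range m, δ k‖ ^ 2
          + ‖(m : ℝ)⁻¹ • ∑ k ∈ Finset.range m, b k‖ ^ 2) :=
          (pow_le_pow_left₀ (norm_nonneg _) (norm_add_le _ _) 2).trans add_sq_le
      _ ≤ _ := by gcongr <;> exact norm_average_sq_le m _
  set Aκ := (m : ℝ)⁻¹ * ∑ k ∈ Finset.range m, κ k
  set Aq := (m : ℝ)⁻¹ * ∑ k ∈ Finset.range m, κ k * q k
  set Ab := (m : ℝ)⁻¹ * ∑ k ∈ Finset.range m, κ k * ‖b k‖ ^ 2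
  set T := (c ^ 3)⁻¹ * Aq + 2 * lam * Ab
  have hT₀ : T ≤ c * N * T := le_mul_of_one_le_left (by positivity) hN
  have habsorb := mul_le_mul_of_nonneg_right hκ (sq_nonneg ‖ε‖)
  have hcN : 0 < c * N := one_pos.trans_le hN
  refine le_of_mul_le_mul_left ?_ hcN
  nlinarith [mul_le_mul_of_nonneg_left hε' hcN.le]

end FixedEffect

/-! ### The exponential family -/

/-- The bounds of condition (C1) on the derivatives of the cumulant function `a`, with `deriv M.a`
and `iteratedDeriv 2 M.a` as its first two derivatives, in the form in which they are used: the
bound on the third derivative enters only through Taylor's formula for `deriv M.a`. -/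
structure CumulantBounds {p : ℕ} (M : Model p) (c : ℝ) : Prop where
  pos : 0 < c
  hasDerivAt : ∀ s, HasDerivAt M.a (deriv M.a s) s
  hasDerivAt_deriv : ∀ s, HasDerivAt (deriv M.a) (iteratedDeriv 2 M.a s) s
  continuous_two : Continuous (iteratedDeriv 2 M.a)
  le_two : ∀ s, c ≤ iteratedDeriv 2 M.a s
  two_le : ∀ s, iteratedDeriv 2 M.a s ≤ c⁻¹
  taylor : ∀ s h, |deriv M.a (s + h) - deriv M.a s - iteratedDeriv 2 M.a s * h| ≤ c⁻¹ * h ^ 2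

section ExponentialFamily

variable {p : ℕ} {M : Model p} {c : ℝ}

lemma C1.cumulantBounds (h : C1 M) : ∃ c, CumulantBounds M c := by
  obtain ⟨ha, c, hc, hbound⟩ := h
  have hderiv : ∀ s, HasDerivAt M.a (deriv M.a s) s := fun s =>
    (ha.differentiable (by norm_num) s).hasDerivAt
  have hderiv₂ : ∀ s, HasDerivAt (deriv M.a) (iteratedDeriv 2 M.a s) s := fun s => by
    simpa only [iteratedDeriv_succ (n := 1), iteratedDeriv_one] using
      (ha.differentiable_iteratedDeriv 1 (by norm_num) s).hasDerivAt
  have hderiv₃ : ∀ s, HasDerivAt (iteratedDeriv 2 M.a) (iteratedDeriv 3 M.a s) s := fun s => by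
    simpa only [iteratedDeriv_succ (n := 2)] using
      (ha.differentiable_iteratedDeriv 2 (by norm_num) s).hasDerivAt
  exact ⟨c, hc, hderiv, hderiv₂, continuous_iff_continuousAt.2 fun s => (hderiv₃ s).continuousAt,
    fun s => (hbound s).1, fun s => (hbound s).2.1,
    abs_sub_sub_mul_le hderiv₂ hderiv₃ fun s => (hbound s).2.2⟩

namespace CumulantBounds

lemma continuous (h : CumulantBounds M c) : Continuous M.a :=
  continuous_iff_continuousAt.2 fun s => (h.hasDerivAt s).continuousAt

lemma continuous_deriv (h : CumulantBounds M c) : Continuous (deriv M.a) :=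
  continuous_iff_continuousAt.2 fun s => (h.hasDerivAt_deriv s).continuousAt

lemma two_nonneg (h : CumulantBounds M c) (s : ℝ) : 0 ≤ iteratedDeriv 2 M.a s :=
  h.pos.le.trans (h.le_two s)

lemma sub_sub_mul_le (h : CumulantBounds M c) (s t : ℝ) :
    M.a (s + t) - M.a s - deriv M.a s * t ≤ c⁻¹ * t ^ 2 :=
  (le_abs_self _).trans <| abs_sub_sub_mul_le h.hasDerivAt h.hasDerivAt_deriv
    (fun u => (abs_of_nonneg (h.two_nonneg u)).trans_le (h.two_le u)) s t

end CumulantBounds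

namespace Model

/-- The law of a response with canonical parameter `η`, at the true dispersion. -/
def law (M : Model p) (η : ℝ) : Measure ℝ :=
  M.ν.withDensity fun y => ENNReal.ofReal (M.density M.φ η y)

lemma density_pos (M : Model p) (φ η y : ℝ) : 0 < M.density φ η y := Real.exp_pos _

lemma measurable_density (hM : M.IsValid) (ha : Measurable M.a) :
    Measurable fun q : ℝ × ℝ => M.density M.φ q.1 q.2 := by
  have := hM.measurable_c
  unfold density
  fun_prop

lemma measurable_density_right (hM : M.IsValid) (η : ℝ) : Measurable (M.density M.φ η) := by
  have := hM.measurable_c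
  unfold density
  fun_prop

lemma isProbabilityMeasure_law (hM : M.IsValid) (η : ℝ) : IsProbabilityMeasure (M.law η) :=
  ⟨by simpa only [law, withDensity_apply _ MeasurableSet.univ, Measure.restrict_univ]
    using hM.lintegral_density η⟩

lemma density_mul_exp (hφ : M.φ ≠ 0) (η s y : ℝ) :
    M.density M.φ η y * Real.exp (s * y) =
      Real.exp (M.φ⁻¹ * (M.a (η + M.φ * s) - M.a η)) * M.density M.φ (η + M.φ * s) y := by
  rw [density, density, ← Real.exp_add, ← Real.exp_add]
  congr 1
  field_simp
  ring

lemma lintegral_exp_law (hM : M.IsValid) (η s : ℝ) :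
    ∫⁻ y, ENNReal.ofReal (Real.exp (s * y)) ∂(M.law η) =
      ENNReal.ofReal (Real.exp (M.φ⁻¹ * (M.a (η + M.φ * s) - M.a η))) := by
  rw [law, lintegral_withDensity_eq_lintegral_mul _
    (measurable_density_right hM η).ennreal_ofReal (by fun_prop)]
  simp only [Pi.mul_apply, ← ENNReal.ofReal_mul (density_pos ..).le,
    density_mul_exp hM.φ_pos.ne', ENNReal.ofReal_mul (Real.exp_pos _).le]
  rw [lintegral_const_mul _ (measurable_density_right hM _).ennreal_ofReal,
    hM.lintegral_density, mul_one]

lemma integrable_exp_law (hM : M.IsValid) (η s : ℝ) :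
    Integrable (fun y => Real.exp (s * y)) (M.law η) := by
  refine ⟨by fun_prop, ?_⟩
  rw [hasFiniteIntegral_iff_ofReal (ae_of_all _ fun y => (Real.exp_pos _).le),
    lintegral_exp_law hM]
  exact ENNReal.ofReal_lt_top

lemma integrableExpSet_law (hM : M.IsValid) (η : ℝ) :
    integrableExpSet id (M.law η) = Set.univ :=
  Set.eq_univ_of_forall fun s => integrable_exp_law hM η s

lemma mgf_law (hM : M.IsValid) (η s : ℝ) :
    mgf id (M.law η) s = Real.exp (M.φ⁻¹ * (M.a (η + M.φ * s) - M.a η)) := by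
  simp only [mgf, id]
  rw [integral_eq_lintegral_of_nonneg_ae (ae_of_all _ fun y => (Real.exp_pos _).le) (by fun_prop),
    lintegral_exp_law hM, ENNReal.toReal_ofReal (Real.exp_pos _).le]

lemma cgf_law (hM : M.IsValid) (η : ℝ) :
    cgf id (M.law η) = fun s => M.φ⁻¹ * (M.a (η + M.φ * s) - M.a η) := by
  ext s
  rw [cgf, mgf_law hM, Real.log_exp]

lemma deriv_cgf_law (hM : M.IsValid) (h : CumulantBounds M c) (η : ℝ) :
    deriv (cgf id (M.law η)) = fun s => deriv M.a (η + M.φ * s) := by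
  ext s
  have hlin : HasDerivAt (fun s => η + M.φ * s) M.φ s := by
    simpa using ((hasDerivAt_id s).const_mul M.φ).const_add η
  have hcomp := (((h.hasDerivAt _).comp s hlin).sub_const (M.a η)).const_mul M.φ⁻¹
  rw [cgf_law hM]
  refine hcomp.deriv.trans ?_
  rw [mul_comm, mul_assoc, mul_inv_cancel₀ hM.φ_pos.ne', mul_one]

lemma integral_law (hM : M.IsValid) (h : CumulantBounds M c) (η : ℝ) :
    ∫ y, y ∂(M.law η) = deriv M.a η := by
  have := isProbabilityMeasure_law hM η
  have hcgf := deriv_cgf_zero (X := id) (μ := M.law η) (by simp [integrableExpSet_law hM])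
  simpa [deriv_cgf_law hM h] using hcgf.symm

lemma integral_sq_law (hM : M.IsValid) (h : CumulantBounds M c) (η : ℝ) :
    ∫ y, (y - deriv M.a η) ^ 2 ∂(M.law η) = M.φ * iteratedDeriv 2 M.a η := by
  have := isProbabilityMeasure_law hM η
  have hlin : HasDerivAt (fun s => η + M.φ * s) M.φ 0 := by
    simpa using ((hasDerivAt_id (0 : ℝ)).const_mul M.φ).const_add η
  have hcgf := iteratedDeriv_two_cgf_eq_integral (X := id) (μ := M.law η) (v := 0)
    (by simp [integrableExpSet_law hM])
  rw [iteratedDeriv_succ, iteratedDeriv_one, deriv_cgf_law hM h] at hcgf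
  have hcomp := ((h.hasDerivAt_deriv _).comp (0 : ℝ) hlin).deriv
  simpa [mul_comm M.φ] using hcgf.symm.trans hcomp

lemma hasSubgaussianMGF_sub_law (hM : M.IsValid) (h : CumulantBounds M c) (η : ℝ) :
    HasSubgaussianMGF (fun y => y - deriv M.a η) (2 * (c⁻¹ * M.φ)).toNNReal (M.law η) where
  integrable_exp_mul s := by
    refine ((integrable_exp_law hM η s).const_mul (Real.exp (-(s * deriv M.a η)))).congr
      (ae_of_all _ fun y => ?_)
    simp only [← Real.exp_add]
    ring_nf
  mgf_le s := by
    have hφ := hM.φ_pos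
    have hc := h.pos
    have hmgf : mgf (fun y => y - deriv M.a η) (M.law η) s =
        Real.exp (M.φ⁻¹ * (M.a (η + M.φ * s) - M.a η)) * Real.exp (-(s * deriv M.a η)) := by
      rw [← mgf_law hM]
      simpa [sub_eq_add_neg] using
        mgf_add_const (X := id) (μ := M.law η) (t := s) (-deriv M.a η)
    rw [hmgf, ← Real.exp_add, Real.exp_le_exp, Real.coe_toNNReal _ (by positivity)]
    calc M.φ⁻¹ * (M.a (η + M.φ * s) - M.a η) + -(s * deriv M.a η)
        = M.φ⁻¹ * (M.a (η + M.φ * s) - M.a η - deriv M.a η * (M.φ * s)) := by field_simp; ring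
      _ ≤ M.φ⁻¹ * (c⁻¹ * (M.φ * s) ^ 2) := by gcongr; exact h.sub_sub_mul_le _ _
      _ = 2 * (c⁻¹ * M.φ) * s ^ 2 / 2 := by field_simp

end Model

end ExponentialFamily

lemma integral_abs_pow_le_of_hasSubgaussianMGF {Ω : Type*} [MeasurableSpace Ω] {μ : Measure Ω}
    {X : Ω → ℝ} {v : NNReal} (hX : HasSubgaussianMGF X v μ) (k : ℕ) :
    ∫ ω, |X ω| ^ k ∂μ ≤ 2 * k.factorial * Real.exp (v / 2) := by
  have hpos : Integrable (fun ω => Real.exp (X ω)) μ := by simpa using hX.integrable_exp_mul 1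
  have hneg : Integrable (fun ω => Real.exp (-X ω)) μ := by simpa using hX.integrable_exp_mul (-1)
  have hpow (t : ℝ) : |t| ^ k ≤ k.factorial * (Real.exp t + Real.exp (-t)) := by
    rw [← div_le_iff₀' (by positivity)]
    exact (Real.pow_div_factorial_le_exp _ (abs_nonneg t) k).trans (Real.exp_abs_le t)
  have hmgf_pos : ∫ ω, Real.exp (X ω) ∂μ ≤ Real.exp (v / 2) := by
    simpa [mgf] using hX.mgf_le 1
  have hmgf_neg : ∫ ω, Real.exp (-X ω) ∂μ ≤ Real.exp (v / 2) := by
    simpa [mgf] using hX.mgf_le (-1)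
  calc ∫ ω, |X ω| ^ k ∂μ
      ≤ ∫ ω, k.factorial * (Real.exp (X ω) + Real.exp (-X ω)) ∂μ :=
        integral_mono_of_nonneg (ae_of_all _ fun ω => by positivity)
          ((hpos.add hneg).const_mul _) (ae_of_all _ fun ω => hpow (X ω))
    _ = k.factorial * (∫ ω, Real.exp (X ω) ∂μ + ∫ ω, Real.exp (-X ω) ∂μ) := by
        rw [integral_const_mul, integral_add hpos hneg]
    _ ≤ k.factorial * (Real.exp (v / 2) + Real.exp (v / 2)) := by gcongr
    _ = 2 * k.factorial * Real.exp (v / 2) := by ring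

namespace Model

variable {p : ℕ} {M : Model p} {c : ℝ}

lemma integral_sub_law (hM : M.IsValid) (h : CumulantBounds M c) (η : ℝ) :
    ∫ y, (y - deriv M.a η) ∂(M.law η) = 0 := by
  have := isProbabilityMeasure_law hM η
  have hid : Integrable (fun y : ℝ => y) (M.law η) :=
    integrable_of_mem_interior_integrableExpSet (X := id) (by simp [integrableExpSet_law hM])
  simp [integral_sub hid (integrable_const _), integral_law hM h]

lemma memLp_sub_law (hM : M.IsValid) (h : CumulantBounds M c) (η : ℝ) (r : NNReal) :
    MemLp (fun y => y - deriv M.a η) r (M.law η) :=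
  (hasSubgaussianMGF_sub_law hM h η).memLp r

lemma integral_abs_sub_pow_three_law_le (hM : M.IsValid) (h : CumulantBounds M c) (η : ℝ) :
    ∫ y, |y - deriv M.a η| ^ 3 ∂(M.law η) ≤ 12 * Real.exp (c⁻¹ * M.φ) := by
  have hφ := hM.φ_pos
  have hc := h.pos
  have hpow := integral_abs_pow_le_of_hasSubgaussianMGF (hasSubgaussianMGF_sub_law hM h η) 3
  rw [Real.coe_toNNReal _ (by positivity), mul_div_cancel_left₀ _ two_ne_zero] at hpow
  exact hpow.trans_eq (by norm_num [Nat.factorial])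

lemma norm_charFun_law_sub_le (hM : M.IsValid) (h : CumulantBounds M c) (η w : ℝ) :
    ‖∫ y, Complex.exp ((w * (y - deriv M.a η) : ℝ) * Complex.I) ∂(M.law η)
        - Real.exp (-(w ^ 2 * (M.φ * iteratedDeriv 2 M.a η) / 2))‖ ≤
      48 * Real.exp (c⁻¹ * M.φ) * |w| ^ 3 + (w ^ 2 * (M.φ * c⁻¹) / 2) ^ 2 := by
  have := isProbabilityMeasure_law hM η
  have hφ := hM.φ_pos
  have hmoment (r : NNReal) := (memLp_sub_law hM h η r).const_mul w
  have htaylor := norm_integral_cexp_mul_I_sub_le ((hmoment 1).integrable le_rfl)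
    (hmoment 2).integrable_sq (by simpa using (hmoment 3).integrable_norm_pow (p := 3) (by simp))
    (by rw [integral_const_mul, integral_sub_law hM h, mul_zero])
  simp only [mul_pow, abs_mul, integral_const_mul, integral_sq_law hM h] at htaylor
  refine htaylor.trans ?_
  have htwo := h.two_nonneg η
  gcongr ?_ + (w ^ 2 * (M.φ * ?_) / 2) ^ 2
  · calc 4 * (|w| ^ 3 * ∫ y, |y - deriv M.a η| ^ 3 ∂(M.law η))
        ≤ 4 * (|w| ^ 3 * (12 * Real.exp (c⁻¹ * M.φ))) := by
          gcongr
          exact integral_abs_sub_pow_three_law_le hM h η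
      _ = 48 * Real.exp (c⁻¹ * M.φ) * |w| ^ 3 := by ring
  · exact h.two_le η

end Model

/-! ### Information matrices and the linearised deviation -/

section MatForm

variable {p : ℕ} {A : Matrix (Fin p) (Fin p) ℝ}

/-- The bilinear form `(u, v) ↦ uᵀ A v` of a matrix, on the Euclidean space `Vec p`. -/
def matForm (A : Matrix (Fin p) (Fin p) ℝ) : Vec p →ₗ[ℝ] Vec p →ₗ[ℝ] ℝ :=
  Matrix.toBilin (EuclideanSpace.basisFun (Fin p) ℝ).toBasis A

lemma matForm_eq_sum (A : Matrix (Fin p) (Fin p) ℝ) (u v : Vec p) :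
    matForm A u v = ∑ k, ∑ l, u k * A k l * v l := by
  simp [matForm, Matrix.toBilin_apply]

lemma matForm_apply (A : Matrix (Fin p) (Fin p) ℝ) (u v : Vec p) :
    matForm A u v = WithLp.ofLp u ⬝ᵥ (A *ᵥ WithLp.ofLp v) := by
  simp only [matForm_eq_sum, dotProduct, Matrix.mulVec, Finset.mul_sum, mul_assoc]

lemma inner_toLp_mulVec (A : Matrix (Fin p) (Fin p) ℝ) (u v : Vec p) :
    inner ℝ u (WithLp.toLp 2 (A *ᵥ WithLp.ofLp v)) = matForm A u v := by
  rw [matForm_apply, EuclideanSpace.inner_eq_star_dotProduct, star_trivial, dotProduct_comm]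

lemma matForm_comm (hA : A.IsHermitian) (u v : Vec p) : matForm A u v = matForm A v u := by
  have hAT : Aᵀ = A := Matrix.conjTranspose_eq_transpose_of_trivial A ▸ hA
  rw [matForm_apply, matForm_apply, Matrix.dotProduct_mulVec, ← Matrix.mulVec_transpose, hAT,
    dotProduct_comm]

lemma isPosSemidef_matForm (hA : A.PosSemidef) : (matForm A).IsPosSemidef :=
  LinearMap.isPosSemidef_def.2 ⟨⟨matForm_comm hA.isHermitian⟩, ⟨fun v => by
    simpa [matForm_apply] using hA.dotProduct_mulVec_nonneg (WithLp.ofLp v)⟩⟩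

lemma matForm_nonneg (hA : A.PosSemidef) (v : Vec p) : 0 ≤ matForm A v v :=
  (isPosSemidef_matForm hA).nonneg v

lemma abs_coord_le (v : Vec p) (k : Fin p) : |v k| ≤ ‖v‖ := by
  simpa using PiLp.norm_apply_le v k

lemma matForm_self_le (A : Matrix (Fin p) (Fin p) ℝ) (v : Vec p) :
    matForm A v v ≤ (∑ k, ∑ l, |A k l|) * ‖v‖ ^ 2 := by
  simp only [matForm_eq_sum, Finset.sum_mul]
  refine Finset.sum_le_sum fun k _ => Finset.sum_le_sum fun l _ => ?_
  calc v k * A k l * v l ≤ |v k| * |A k l| * |v l| := by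
        rw [← abs_mul, ← abs_mul]
        exact le_abs_self _
    _ ≤ ‖v‖ * |A k l| * ‖v‖ := by gcongr <;> exact abs_coord_le _ _
    _ = |A k l| * ‖v‖ ^ 2 := by ring

-- Cauchy–Schwarz for the form of `A`, applied to `v` and the columns of `A⁻¹`.
lemma norm_sq_le_trace_inv_mul (hA : A.PosDef) (v : Vec p) :
    ‖v‖ ^ 2 ≤ A⁻¹.trace * matForm A v v := by
  rw [EuclideanSpace.real_norm_sq_eq, Matrix.trace, Finset.sum_mul]
  refine Finset.sum_le_sum fun k _ => ?_
  let u : Vec p := WithLp.toLp 2 (A⁻¹ *ᵥ Pi.single k 1)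
  have hu : A *ᵥ WithLp.ofLp u = Pi.single k 1 := by
    rw [Matrix.mulVec_mulVec, Matrix.mul_nonsing_inv _ hA.det_pos.ne'.isUnit, Matrix.one_mulVec]
  have hΛ := isPosSemidef_matForm hA.posSemidef
  have hcs := LinearMap.BilinForm.apply_sq_le_of_symm (matForm A) hΛ.nonneg hΛ.isSymm v u
  rw [matForm_apply A v u, hu, matForm_apply A u u, hu, dotProduct_single_one,
    dotProduct_single_one, mul_comm] at hcs
  simpa [u] using hcs

lemma charFun_multivariateGaussian_zero (hA : A.PosSemidef) (u : Vec p) :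
    charFun (multivariateGaussian 0 A) u = Real.exp (-matForm A u u / 2) := by
  rw [charFun_multivariateGaussian hA, inner_zero_right, ← matForm_apply]
  push_cast
  ring_nf

end MatForm

/-- The smallest eigenvalue of `∑ⱼ xᵢⱼ xᵢⱼᵀ` is at least `n i / κ`; stated without division, as a
bound on quadratic forms. -/
structure Design.CurvatureBound {p : ℕ} (D : Design p) (i : ℕ) (κ : ℝ) : Prop where
  nonneg : 0 ≤ κ
  mul_norm_sq_le : ∀ v, (D.n i : ℝ) * ‖v‖ ^ 2 ≤
    κ * energy (fun j : Fin (D.n i) => D.x i j) v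

lemma Design.CurvatureBound.mono {p : ℕ} {D : Design p} {i : ℕ} {κ κ' : ℝ}
    (h : D.CurvatureBound i κ) (hle : κ ≤ κ') : D.CurvatureBound i κ' where
  nonneg := h.nonneg.trans hle
  mul_norm_sq_le v :=
    (h.mul_norm_sq_le v).trans (mul_le_mul_of_nonneg_right hle (energy_nonneg _ _))

namespace Model

variable {p : ℕ}

section Info

variable (M : Model p) (D : Design p) (i : ℕ)

/-- The variance function `a''` of measurement `j` of cluster `i` with random effect `b`. -/
def weight (b : Vec p) (j : Fin (D.n i)) : ℝ := iteratedDeriv 2 M.a (linPred (D.x i j) M.β b)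

lemma info_apply (b : Vec p) (k l : Fin p) :
    M.info D i b k l =
      ((D.n i : ℝ) * M.φ)⁻¹ * ∑ j : Fin (D.n i), M.weight D i b j * D.x i j k * D.x i j l := by
  simp only [info, W, Matrix.smul_apply, Matrix.mul_smul, Matrix.smul_mul,
    Matrix.mul_apply (M := _ * _), Matrix.mul_diagonal, Matrix.transpose_apply, Design.X,
    Matrix.of_apply, smul_eq_mul, mul_inv, weight, mul_assoc]
  congr 2
  exact Finset.sum_congr rfl fun j _ => mul_left_comm ..

lemma matForm_info (b u v : Vec p) :
    matForm (M.info D i b) u v = ((D.n i : ℝ) * M.φ)⁻¹ *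
      ∑ j : Fin (D.n i), M.weight D i b j * inner ℝ (D.x i j) u * inner ℝ (D.x i j) v := by
  simp only [matForm_eq_sum, info_apply, PiLp.inner_apply, RCLike.inner_apply, conj_trivial,
    Finset.mul_sum, Finset.sum_mul]
  rw [Finset.sum_congr rfl fun k _ => Finset.sum_comm, Finset.sum_comm]
  refine Finset.sum_congr rfl fun j _ => ?_
  rw [Finset.sum_comm]
  refine Finset.sum_congr rfl fun k _ => Finset.sum_congr rfl fun l _ => ?_
  ring

lemma isHermitian_info (b : Vec p) : (M.info D i b).IsHermitian := by
  ext k l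
  simp only [Matrix.conjTranspose_apply, info_apply, star_trivial]
  congr 1
  exact Finset.sum_congr rfl fun j _ => mul_right_comm ..

lemma isHermitian_H (b : Vec p) : (M.H D i b).IsHermitian := (M.isHermitian_info D i b).inv

/-- The linearised deviation `(nᵢ φ)⁻¹ Hᵢ Xᵢᵀ (y - μᵢ)` of the estimated coefficient of cluster `i`
from the true one, as a function of the random effect and of the responses. -/
def linDev (b : Vec p) (y : Fin (D.n i) → ℝ) : Vec p :=
  WithLp.toLp 2 (((D.n i : ℝ) * M.φ)⁻¹ • (M.H D i b *ᵥ ((D.X i)ᵀ *ᵥ (y - M.mean D i b))))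

/-- The coefficients of the residuals in the coordinate of the linearised deviation in the
direction `u`. -/
def linCoef (b u : Vec p) (j : Fin (D.n i)) : ℝ :=
  ((D.n i : ℝ) * M.φ)⁻¹ * matForm (M.H D i b) (D.x i j) u

end Info

variable {M : Model p} {D : Design p} {i : ℕ} {c : ℝ} {b : Vec p}

lemma info_mul_H (hu : IsUnit (M.info D i b)) : M.info D i b * M.H D i b = 1 :=
  Matrix.mul_nonsing_inv _ ((Matrix.isUnit_iff_isUnit_det _).1 hu)

lemma H_mul_info (hu : IsUnit (M.info D i b)) : M.H D i b * M.info D i b = 1 :=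
  Matrix.nonsing_inv_mul _ ((Matrix.isUnit_iff_isUnit_det _).1 hu)

section PosDef

variable (hM : M.IsValid) (hc : CumulantBounds M c)

include hM hc

lemma posSemidef_info (b : Vec p) : (M.info D i b).PosSemidef := by
  refine .of_dotProduct_mulVec_nonneg (M.isHermitian_info D i b) fun v => ?_
  have hform := M.matForm_info D i b (WithLp.toLp 2 v) (WithLp.toLp 2 v)
  rw [matForm_apply] at hform
  rw [star_trivial, hform]
  have hφ := hM.φ_pos
  refine mul_nonneg (by positivity) (Finset.sum_nonneg fun j _ => ?_)
  rw [mul_assoc]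
  exact mul_nonneg (hc.two_nonneg _) (mul_self_nonneg _)

lemma posDef_info (hu : IsUnit (M.info D i b)) : (M.info D i b).PosDef :=
  (posSemidef_info hM hc b).posDef_iff_isUnit.2 hu

lemma posDef_H (hu : IsUnit (M.info D i b)) : (M.H D i b).PosDef := (posDef_info hM hc hu).inv

lemma matForm_info_self_le (b v : Vec p) :
    matForm (M.info D i b) v v ≤
      ((D.n i : ℝ) * M.φ)⁻¹ * (c⁻¹ * energy (fun j : Fin (D.n i) => D.x i j) v) := by
  have hφ := hM.φ_pos
  have hscale : 0 ≤ ((D.n i : ℝ) * M.φ)⁻¹ := by positivity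
  rw [matForm_info, energy, Finset.mul_sum _ _ c⁻¹]
  refine mul_le_mul_of_nonneg_left (Finset.sum_le_sum fun j _ => ?_) hscale
  rw [mul_assoc, ← sq]
  exact mul_le_mul_of_nonneg_right (hc.two_le _) (sq_nonneg _)

lemma curvatureBound_trace_H (hu : IsUnit (M.info D i b)) (hn : 0 < D.n i) :
    D.CurvatureBound i ((M.H D i b).trace * (M.φ * c)⁻¹) := by
  have hφ := hM.φ_pos
  have hc₀ := hc.pos
  have htrace : 0 ≤ (M.H D i b).trace := (posDef_H hM hc hu).posSemidef.trace_nonneg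
  refine ⟨by positivity, fun v => ?_⟩
  calc (D.n i : ℝ) * ‖v‖ ^ 2
      ≤ D.n i * ((M.H D i b).trace * matForm (M.info D i b) v v) := by
        gcongr
        exact norm_sq_le_trace_inv_mul (posDef_info hM hc hu) v
    _ ≤ D.n i * ((M.H D i b).trace * (((D.n i : ℝ) * M.φ)⁻¹ *
          (c⁻¹ * energy (fun j : Fin (D.n i) => D.x i j) v))) := by
        gcongr
        exact matForm_info_self_le hM hc b v
    _ = _ := by field_simp

end PosDef

lemma X_transpose_mulVec_dotProduct (e : Fin (D.n i) → ℝ) (v : Vec p) :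
    ((D.X i)ᵀ *ᵥ e) ⬝ᵥ WithLp.ofLp v = ∑ j, e j * inner ℝ (D.x i j) v := by
  rw [Matrix.mulVec_transpose, ← Matrix.dotProduct_mulVec, dotProduct]
  refine Finset.sum_congr rfl fun j _ => ?_
  congr 1
  simp [Matrix.mulVec, dotProduct, Design.X, PiLp.inner_apply, mul_comm]

lemma inner_linDev (b u : Vec p) (y : Fin (D.n i) → ℝ) :
    inner ℝ u (M.linDev D i b y) = ∑ j, M.linCoef D i b u j * (y j - M.mean D i b j) := by
  let score : Vec p := WithLp.toLp 2 ((D.X i)ᵀ *ᵥ (y - M.mean D i b))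
  calc inner ℝ u (M.linDev D i b y)
      = ((D.n i : ℝ) * M.φ)⁻¹ * matForm (M.H D i b) u score := by
        rw [linDev, WithLp.toLp_smul, inner_smul_right, ← inner_toLp_mulVec]
    _ = ((D.n i : ℝ) * M.φ)⁻¹ *
          (WithLp.ofLp score ⬝ᵥ (M.H D i b *ᵥ WithLp.ofLp u)) := by
        rw [matForm_comm (M.isHermitian_H D i b), matForm_apply]
    _ = ∑ j, M.linCoef D i b u j * (y j - M.mean D i b j) := by
        rw [X_transpose_mulVec_dotProduct (v := WithLp.toLp 2 (M.H D i b *ᵥ WithLp.ofLp u)),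
          Finset.mul_sum]
        refine Finset.sum_congr rfl fun j _ => ?_
        rw [inner_toLp_mulVec, linCoef, Pi.sub_apply]
        ring

section Identities

variable (hM : M.IsValid) (hu : IsUnit (M.info D i b)) (hn : 0 < D.n i)

include hM hu hn

lemma sum_mul_inner_eq_linDev (v : Vec p) (y : Fin (D.n i) → ℝ) :
    ∑ j, (y j - M.mean D i b j) * inner ℝ (D.x i j) v =
      ∑ j : Fin (D.n i), M.weight D i b j * inner ℝ (D.x i j) (M.linDev D i b y)
        * inner ℝ (D.x i j) v := by
  have hnφ : ((D.n i : ℝ) * M.φ)⁻¹ ≠ 0 := by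
    have := hM.φ_pos
    positivity
  refine mul_left_cancel₀ hnφ ?_
  calc ((D.n i : ℝ) * M.φ)⁻¹ * ∑ j, (y j - M.mean D i b j) * inner ℝ (D.x i j) v
      = matForm (M.info D i b) v (M.linDev D i b y) := by
        rw [matForm_apply, linDev, Matrix.mulVec_smul, Matrix.mulVec_mulVec, info_mul_H hu,
          Matrix.one_mulVec, dotProduct_smul, smul_eq_mul, dotProduct_comm,
          X_transpose_mulVec_dotProduct]
        rfl
    _ = _ := by
        rw [matForm_info]
        simp only [mul_right_comm (M.weight D i b _)]

lemma sum_linCoef_sq (u : Vec p) :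
    ∑ j, M.linCoef D i b u j ^ 2 * (M.φ * M.weight D i b j) =
      (D.n i : ℝ)⁻¹ * matForm (M.H D i b) u u := by
  have hφ := hM.φ_pos
  let w : Vec p := WithLp.toLp 2 (M.H D i b *ᵥ WithLp.ofLp u)
  have hw : matForm (M.info D i b) w w = matForm (M.H D i b) u u := by
    rw [matForm_apply, Matrix.mulVec_mulVec, info_mul_H hu, Matrix.one_mulVec, dotProduct_comm,
      matForm_apply]
  rw [← hw, matForm_info, Finset.mul_sum, Finset.mul_sum]
  refine Finset.sum_congr rfl fun j _ => ?_
  rw [linCoef, show matForm (M.H D i b) (D.x i j) u = inner ℝ (D.x i j) w from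
    (inner_toLp_mulVec ..).symm]
  field_simp

lemma sum_weight_mul_matForm_H :
    ∑ j : Fin (D.n i), (D.n i : ℝ)⁻¹ *
      (M.weight D i b j * matForm (M.H D i b) (D.x i j) (D.x i j)) = M.φ * p := by
  have hφ := hM.φ_pos
  have htrace : (M.H D i b * M.info D i b).trace = p := by
    rw [H_mul_info hu, Matrix.trace_one, Fintype.card_fin]
  rw [← htrace, Matrix.trace]
  simp only [Matrix.diag, Matrix.mul_apply, info_apply, matForm_eq_sum, Finset.mul_sum]
  rw [Finset.sum_comm]
  refine Finset.sum_congr rfl fun k _ => ?_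
  rw [Finset.sum_comm]
  refine Finset.sum_congr rfl fun l _ => Finset.sum_congr rfl fun j _ => ?_
  field_simp

lemma sum_matForm_H_le (hc : CumulantBounds M c) :
    ∑ j : Fin (D.n i), (D.n i : ℝ)⁻¹ * matForm (M.H D i b) (D.x i j) (D.x i j) ≤
      c⁻¹ * (M.φ * p) := by
  have hc₀ := hc.pos
  rw [← sum_weight_mul_matForm_H hM hu hn, Finset.mul_sum]
  refine Finset.sum_le_sum fun j _ => ?_
  have hH : 0 ≤ matForm (M.H D i b) (D.x i j) (D.x i j) :=
    matForm_nonneg (posDef_H hM hc hu).posSemidef _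
  have hw : 1 ≤ c⁻¹ * M.weight D i b j := by
    rw [← div_eq_inv_mul, one_le_div hc₀]
    exact hc.le_two _
  calc (D.n i : ℝ)⁻¹ * matForm (M.H D i b) (D.x i j) (D.x i j)
      ≤ (D.n i : ℝ)⁻¹ *
          ((c⁻¹ * M.weight D i b j) * matForm (M.H D i b) (D.x i j) (D.x i j)) := by
        gcongr
        exact le_mul_of_one_le_left hH hw
    _ = _ := by ring

end Identities

section Measurability

lemma continuous_linPred (x β : Vec p) : Continuous fun b : Vec p => linPred x β b := by
  unfold linPred
  fun_prop

lemma continuous_info (hc : CumulantBounds M c) : Continuous fun b => M.info D i b := by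
  refine continuous_matrix fun k l => ?_
  simp only [info_apply, weight]
  exact continuous_const.mul <| continuous_finsetSum _ fun j _ =>
    ((hc.continuous_two.comp (continuous_linPred _ _)).mul_const _).mul_const _

lemma measurable_H (hc : CumulantBounds M c) (k l : Fin p) :
    Measurable fun b => M.H D i b k l := by
  have hinfo : Continuous fun b => M.info D i b := continuous_info hc
  simp only [H, Matrix.inv_def, Matrix.smul_apply, Ring.inverse_eq_inv', smul_eq_mul]
  exact hinfo.matrix_det.measurable.inv.mul (hinfo.matrix_adjugate.matrix_elem k l).measurable

lemma measurable_mean (hc : CumulantBounds M c) (j : Fin (D.n i)) :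
    Measurable fun b => M.mean D i b j :=
  (hc.continuous_deriv.comp (continuous_linPred _ _)).measurable

lemma measurable_linDev (hc : CumulantBounds M c) :
    Measurable fun q : Vec p × (Fin (D.n i) → ℝ) => M.linDev D i q.1 q.2 := by
  have hH := fun k l => measurable_H (D := D) (i := i) hc k l
  have hmean := fun j => measurable_mean (D := D) (i := i) hc j
  unfold linDev
  refine (PiLp.continuous_toLp 2 _).measurable.comp (measurable_pi_lambda _ fun k => ?_)
  simp only [Pi.smul_apply, smul_eq_mul, Matrix.mulVec, dotProduct, Pi.sub_apply]
  fun_prop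

end Measurability

end Model

/-! ### The conditional law of the responses of one cluster -/

section PiDensity

lemma lintegral_fin_prod_eq_prod {n : ℕ} {α : Fin n → Type*} [∀ j, MeasurableSpace (α j)]
    {μ : ∀ j, Measure (α j)} [∀ j, SigmaFinite (μ j)] {f : ∀ j, α j → ENNReal}
    (hf : ∀ j, Measurable (f j)) :
    ∫⁻ y, ∏ j, f j (y j) ∂(Measure.pi μ) = ∏ j, ∫⁻ y, f j y ∂(μ j) := by
  induction n with
  | zero => simp
  | succ n ih =>
    calc ∫⁻ y, ∏ j, f j (y j) ∂(Measure.pi μ)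
        = ∫⁻ q, f 0 q.1 * ∏ j : Fin n, f j.succ (q.2 j)
            ∂((μ 0).prod (Measure.pi fun j : Fin n => μ j.succ)) := by
          rw [← ((measurePreserving_piFinSuccAbove μ 0).symm).lintegral_comp_emb
            (MeasurableEquiv.measurableEmbedding _)]
          simp_rw [MeasurableEquiv.piFinSuccAbove_symm_apply, Fin.insertNthEquiv,
            Fin.prod_univ_succ, Fin.insertNth_zero, Equiv.coe_fn_mk, Fin.cons_succ, Fin.cons_zero]
          rfl
      _ = ∏ j, ∫⁻ y, f j y ∂(μ j) := by
          rw [lintegral_prod_mul (μ := μ 0) (ν := Measure.pi fun j : Fin n => μ j.succ)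
              (g := fun y => ∏ j : Fin n, f j.succ (y j)) (hf 0).aemeasurable
              (Finset.measurable_fun_prod _ fun j _ =>
                (hf j.succ).comp (measurable_pi_apply j)).aemeasurable,
            ih fun j => hf j.succ, Fin.prod_univ_succ]

lemma pi_withDensity {n : ℕ} {α : Fin n → Type*} [∀ j, MeasurableSpace (α j)]
    {μ : ∀ j, Measure (α j)} [∀ j, SigmaFinite (μ j)] {f : ∀ j, α j → ENNReal}
    (hf : ∀ j, Measurable (f j)) [∀ j, SigmaFinite ((μ j).withDensity (f j))] :
    (Measure.pi fun j => (μ j).withDensity (f j)) =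
      (Measure.pi μ).withDensity fun y => ∏ j, f j (y j) := by
  refine Measure.pi_eq fun s hs => ?_
  have hindicator (y : ∀ j, α j) : (Set.univ.pi s).indicator (fun y => ∏ j, f j (y j)) y =
      ∏ j, (s j).indicator (f j) (y j) := by
    by_cases hy : y ∈ Set.univ.pi s
    · rw [Set.indicator_of_mem hy]
      exact Finset.prod_congr rfl fun j _ => (Set.indicator_of_mem (hy j (Set.mem_univ j)) _).symm
    · rw [Set.indicator_of_notMem hy]
      simp only [Set.mem_pi, Set.mem_univ, true_implies, not_forall] at hy
      obtain ⟨j, hj⟩ := hy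
      exact (Finset.prod_eq_zero (Finset.mem_univ j) (Set.indicator_of_notMem hj _)).symm
  rw [withDensity_apply _ (MeasurableSet.univ_pi hs),
    ← lintegral_indicator (MeasurableSet.univ_pi hs)]
  simp_rw [hindicator]
  rw [lintegral_fin_prod_eq_prod fun j => (hf j).indicator (hs j)]
  refine Finset.prod_congr rfl fun j _ => ?_
  rw [lintegral_indicator (hs j), withDensity_apply _ (hs j)]

end PiDensity

namespace Model

variable {p : ℕ}

/-- The conditional law of the responses of cluster `i` given that its random effect is `b`. -/
def condLaw (M : Model p) (D : Design p) (i : ℕ) (b : Vec p) : Measure (Fin (D.n i) → ℝ) :=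
  Measure.pi fun j => M.law (linPred (D.x i j) M.β b)

variable {M : Model p} {D : Design p} {i : ℕ} {c : ℝ}

section CondLaw

variable (hM : M.IsValid)

include hM

lemma isProbabilityMeasure_condLaw (b : Vec p) : IsProbabilityMeasure (M.condLaw D i b) := by
  have := isProbabilityMeasure_law hM
  unfold condLaw
  infer_instance

lemma condLaw_eq_withDensity (b : Vec p) :
    M.condLaw D i b = (Measure.pi fun _ => M.ν).withDensity fun y => ∏ j : Fin (D.n i),
      ENNReal.ofReal (M.density M.φ (linPred (D.x i j) M.β b) (y j)) := by
  have := hM.sigmaFinite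
  have (j : Fin (D.n i)) : SigmaFinite (M.ν.withDensity fun y =>
      ENNReal.ofReal (M.density M.φ (linPred (D.x i j) M.β b) y)) :=
    have : IsProbabilityMeasure (M.law (linPred (D.x i j) M.β b)) := isProbabilityMeasure_law hM _
    inferInstanceAs (SigmaFinite (M.law _))
  exact pi_withDensity fun j => (measurable_density_right hM _).ennreal_ofReal

lemma measurePreserving_condLaw (b : Vec p) (j : Fin (D.n i)) :
    MeasurePreserving (fun y => y j) (M.condLaw D i b) (M.law (linPred (D.x i j) M.β b)) :=
  have := isProbabilityMeasure_law hM
  measurePreserving_eval (fun j : Fin (D.n i) => M.law (linPred (D.x i j) M.β b)) j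

variable (hc : CumulantBounds M c)

include hc

lemma exists_condKernel :
    ∃ κ : Kernel (Vec p) (Fin (D.n i) → ℝ), IsMarkovKernel κ ∧ (∀ b, κ b = M.condLaw D i b) ∧
      ((multivariateGaussian 0 M.G).prod (Measure.pi fun _ : Fin (D.n i) => M.ν)).withDensity
        (fun q => ∏ j : Fin (D.n i),
          ENNReal.ofReal (M.density M.φ (linPred (D.x i j) M.β q.1) (q.2 j))) =
        (multivariateGaussian 0 M.G) ⊗ₘ κ := by
  have := hM.sigmaFinite
  let f (b : Vec p) (y : Fin (D.n i) → ℝ) : ENNReal :=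
    ∏ j : Fin (D.n i), ENNReal.ofReal (M.density M.φ (linPred (D.x i j) M.β b) (y j))
  have hf : Measurable (Function.uncurry f) := by
    refine Finset.measurable_fun_prod _ fun j _ => ENNReal.measurable_ofReal.comp ?_
    exact (measurable_density hM hc.continuous.measurable).comp
      (((continuous_linPred _ _).measurable.comp measurable_fst).prodMk
        ((measurable_pi_apply j).comp measurable_snd))
  let κ := Kernel.withDensity (Kernel.const (Vec p) (Measure.pi fun _ : Fin (D.n i) => M.ν)) f
  have hκ (b : Vec p) : κ b = M.condLaw D i b := by
    rw [Kernel.withDensity_apply _ hf, Kernel.const_apply, condLaw_eq_withDensity hM]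
  have hmarkov : IsMarkovKernel κ := ⟨fun b => hκ b ▸ isProbabilityMeasure_condLaw hM b⟩
  refine ⟨κ, hmarkov, hκ, ?_⟩
  rw [Measure.compProd_withDensity hf, Measure.compProd_const]

lemma memLp_condLaw (b : Vec p) (w : Fin (D.n i) → ℝ) :
    MemLp (fun y => ∑ j, w j * (y j - M.mean D i b j)) 2 (M.condLaw D i b) :=
  memLp_finsetSum _ fun j _ => ((memLp_sub_law hM hc _ 2).comp_measurePreserving
    (measurePreserving_condLaw hM b j)).const_mul _

lemma integral_sub_mean_condLaw (b : Vec p) (j : Fin (D.n i)) :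
    ∫ y, (y j - M.mean D i b j) ∂(M.condLaw D i b) = 0 := by
  have hj := measurePreserving_condLaw hM b j
  have h₀ := integral_sub_law hM hc (linPred (D.x i j) M.β b)
  rwa [← hj.map_eq, integral_map hj.aemeasurable (by fun_prop)] at h₀

lemma integral_condLaw (b : Vec p) (w : Fin (D.n i) → ℝ) :
    ∫ y, ∑ j, w j * (y j - M.mean D i b j) ∂(M.condLaw D i b) = 0 := by
  have := isProbabilityMeasure_condLaw (D := D) (i := i) hM b
  rw [integral_finsetSum]
  · exact Finset.sum_eq_zero fun j _ => by
      rw [integral_const_mul, integral_sub_mean_condLaw hM hc, mul_zero]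
  · exact fun j _ => (((memLp_sub_law hM hc _ 1).comp_measurePreserving
      (measurePreserving_condLaw hM b j)).integrable le_rfl).const_mul _

lemma integral_sq_condLaw (b : Vec p) (w : Fin (D.n i) → ℝ) :
    ∫ y, (∑ j, w j * (y j - M.mean D i b j)) ^ 2 ∂(M.condLaw D i b) =
      ∑ j, w j ^ 2 * (M.φ * M.weight D i b j) := by
  have := isProbabilityMeasure_law hM
  have hsum : (fun y : Fin (D.n i) → ℝ => ∑ j, w j * (y j - M.mean D i b j)) =
      ∑ j, fun y : Fin (D.n i) → ℝ => w j * (y j - deriv M.a (linPred (D.x i j) M.β b)) := by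
    ext y
    simp only [mean, Finset.sum_apply]
  rw [← variance_of_integral_eq_zero (memLp_condLaw hM hc b w).aestronglyMeasurable.aemeasurable
    (integral_condLaw hM hc b w), hsum, condLaw,
    variance_sum_pi (μ := fun j : Fin (D.n i) => M.law (linPred (D.x i j) M.β b))
      (X := fun j y => w j * (y - deriv M.a (linPred (D.x i j) M.β b)))
      fun j => (memLp_sub_law hM hc _ 2).const_mul _]
  refine Finset.sum_congr rfl fun j _ => ?_
  rw [variance_const_mul, variance_of_integral_eq_zero (by fun_prop) (integral_sub_law hM hc _),
    integral_sq_law hM hc, weight]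

omit hc in
lemma charFun_condLaw (b : Vec p) (w : Fin (D.n i) → ℝ) :
    ∫ y, Complex.exp ((∑ j, w j * (y j - M.mean D i b j) : ℝ) * Complex.I) ∂(M.condLaw D i b) =
      ∏ j : Fin (D.n i),
        ∫ y, Complex.exp ((w j * (y - deriv M.a (linPred (D.x i j) M.β b)) : ℝ) * Complex.I)
          ∂(M.law (linPred (D.x i j) M.β b)) := by
  have := isProbabilityMeasure_law hM
  rw [← integral_fintype_prod_eq_prod (μ := fun j : Fin (D.n i) =>
    M.law (linPred (D.x i j) M.β b)) (f := fun j y =>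
      Complex.exp ((w j * (y - deriv M.a (linPred (D.x i j) M.β b)) : ℝ) * Complex.I)), condLaw]
  refine integral_congr_ae (ae_of_all _ fun y => ?_)
  simp only [← Complex.exp_sum, Complex.ofReal_sum, Finset.sum_mul]
  rfl

lemma norm_charFun_condLaw_sub_le (b : Vec p) (w : Fin (D.n i) → ℝ) :
    ‖∫ y, Complex.exp ((∑ j, w j * (y j - M.mean D i b j) : ℝ) * Complex.I) ∂(M.condLaw D i b)
        - Real.exp (-(∑ j, w j ^ 2 * (M.φ * M.weight D i b j)) / 2)‖ ≤
      ∑ j, (48 * Real.exp (c⁻¹ * M.φ) * |w j| ^ 3 + (w j ^ 2 * (M.φ * c⁻¹) / 2) ^ 2) := by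
  have := isProbabilityMeasure_law hM
  have hφ := hM.φ_pos
  have hgauss : (Real.exp (-(∑ j, w j ^ 2 * (M.φ * M.weight D i b j)) / 2) : ℂ) =
      ∏ j, (Real.exp (-(w j ^ 2 * (M.φ * M.weight D i b j) / 2)) : ℂ) := by
    rw [← Complex.ofReal_prod, ← Real.exp_sum, Finset.sum_neg_distrib, ← Finset.sum_div, neg_div]
  rw [charFun_condLaw hM, hgauss]
  refine (norm_prod_sub_prod_le _ _ _ (fun j _ => ?_) fun j _ => ?_).trans
    (Finset.sum_le_sum fun j _ => norm_charFun_law_sub_le hM hc _ _)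
  · refine (norm_integral_le_integral_norm _).trans_eq ?_
    simp only [Complex.norm_exp_ofReal_mul_I, integral_const, probReal_univ, smul_eq_mul, mul_one]
  · have hweight : 0 ≤ M.weight D i b j := hc.two_nonneg _
    rw [Complex.norm_real, Real.norm_eq_abs, Real.abs_exp, Real.exp_le_one_iff,
      Left.neg_nonpos_iff]
    positivity

lemma norm_charFun_condLaw_sub_le_of_abs_le (b : Vec p) {w : Fin (D.n i) → ℝ} {r : ℝ}
    (hw : ∀ j, |w j| ≤ r) :
    ‖∫ y, Complex.exp ((∑ j, w j * (y j - M.mean D i b j) : ℝ) * Complex.I) ∂(M.condLaw D i b)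
        - Real.exp (-(∑ j, w j ^ 2 * (M.φ * M.weight D i b j)) / 2)‖ ≤
      D.n i * (48 * Real.exp (c⁻¹ * M.φ) * r ^ 3 + (r ^ 2 * (M.φ * c⁻¹) / 2) ^ 2) := by
  have hφ := hM.φ_pos
  have hc₀ := hc.pos
  calc _ ≤ ∑ j, (48 * Real.exp (c⁻¹ * M.φ) * |w j| ^ 3 + (|w j| ^ 2 * (M.φ * c⁻¹) / 2) ^ 2) := by
        simpa only [sq_abs] using norm_charFun_condLaw_sub_le hM hc b w
    _ ≤ ∑ _j : Fin (D.n i),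
          (48 * Real.exp (c⁻¹ * M.φ) * r ^ 3 + (r ^ 2 * (M.φ * c⁻¹) / 2) ^ 2) := by
        gcongr with j <;> exact hw j
    _ = _ := by rw [Finset.sum_const, Finset.card_univ, Fintype.card_fin, nsmul_eq_mul]

lemma integral_inner_linDev (b u : Vec p) :
    ∫ y, inner ℝ u (M.linDev D i b y) ∂(M.condLaw D i b) = 0 := by
  simp_rw [inner_linDev]
  exact integral_condLaw hM hc b _

lemma memLp_inner_linDev (b u : Vec p) :
    MemLp (fun y => inner ℝ u (M.linDev D i b y)) 2 (M.condLaw D i b) := by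
  simp_rw [inner_linDev]
  exact memLp_condLaw hM hc b _

variable {b : Vec p} (hu : IsUnit (M.info D i b)) (hn : 0 < D.n i)

include hu hn

lemma integral_inner_linDev_sq (u : Vec p) :
    ∫ y, inner ℝ u (M.linDev D i b y) ^ 2 ∂(M.condLaw D i b) =
      (D.n i : ℝ)⁻¹ * matForm (M.H D i b) u u := by
  simp_rw [inner_linDev]
  rw [integral_sq_condLaw hM hc, sum_linCoef_sq hM hu hn]

lemma lintegral_energy_linDev_le :
    ∫⁻ y, ENNReal.ofReal (energy (fun j : Fin (D.n i) => D.x i j) (M.linDev D i b y))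
      ∂(M.condLaw D i b) ≤ ENNReal.ofReal (c⁻¹ * (M.φ * p)) := by
  have hint (j : Fin (D.n i)) :
      Integrable (fun y => inner ℝ (D.x i j) (M.linDev D i b y) ^ 2) (M.condLaw D i b) :=
    (memLp_inner_linDev hM hc b (D.x i j)).integrable_sq
  simp only [energy]
  rw [← ofReal_integral_eq_lintegral_ofReal (integrable_finsetSum _ fun j _ => hint j)
    (ae_of_all _ fun y => energy_nonneg _ _)]
  refine ENNReal.ofReal_le_ofReal ?_
  rw [integral_finsetSum _ fun j _ => hint j]
  simp_rw [integral_inner_linDev_sq hM hc hu hn]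
  exact sum_matForm_H_le hM hu hn hc

lemma norm_charFun_linDev_sub_le {Cx : ℝ} (hx : ∀ j < D.n i, ‖D.x i j‖ ≤ Cx) (u : Vec p) {r : ℝ}
    (hr : ((D.n i : ℝ) * M.φ)⁻¹ * (Cx * ‖WithLp.toLp 2 (M.H D i b *ᵥ WithLp.ofLp u)‖) ≤ r) :
    ‖∫ y, Complex.exp ((inner ℝ u (M.linDev D i b y) : ℝ) * Complex.I) ∂(M.condLaw D i b)
        - Real.exp (-((D.n i : ℝ)⁻¹ * matForm (M.H D i b) u u) / 2)‖ ≤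
      D.n i * (48 * Real.exp (c⁻¹ * M.φ) * r ^ 3 + (r ^ 2 * (M.φ * c⁻¹) / 2) ^ 2) := by
  have hφ := hM.φ_pos
  have hcoef (j : Fin (D.n i)) : |M.linCoef D i b u j| ≤ r := by
    refine le_trans ?_ hr
    rw [linCoef, abs_mul, abs_of_pos (by positivity), ← inner_toLp_mulVec]
    gcongr
    exact (abs_real_inner_le_norm _ _).trans (by gcongr; exact hx j j.2)
  simp_rw [inner_linDev]
  rw [← sum_linCoef_sq hM hu hn]
  exact norm_charFun_condLaw_sub_le_of_abs_le hM hc b hcoef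

end CondLaw

end Model

/-! ### The model as a random sample -/

section IndependentSum

variable {Ω ι : Type*} [MeasurableSpace Ω] {P : Measure Ω} [IsProbabilityMeasure P] [Fintype ι]

lemma integral_sum_sq_of_iIndepFun {X : ι → Ω → ℝ} (hind : iIndepFun X P)
    (hX : ∀ i, MemLp (X i) 2 P) (hmean : ∀ i, ∫ ω, X i ω ∂P = 0) :
    ∫ ω, (∑ i, X i ω) ^ 2 ∂P = ∑ i, ∫ ω, X i ω ^ 2 ∂P := by
  have hsum : ∫ ω, (∑ i, X i) ω ∂P = 0 := by
    simp only [Finset.sum_apply]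
    rw [integral_finsetSum _ fun i _ => (hX i).integrable one_le_two]
    exact Finset.sum_eq_zero fun i _ => hmean i
  have hvar := IndepFun.variance_sum (s := Finset.univ) (fun i _ => hX i)
    fun i _ j _ hij => hind.indepFun hij
  rw [variance_of_integral_eq_zero (Finset.aemeasurable_sum _ fun i _ =>
    (hX i).aestronglyMeasurable.aemeasurable) hsum] at hvar
  simp only [Finset.sum_apply] at hvar
  rw [hvar]
  exact Finset.sum_congr rfl fun i _ =>
    variance_of_integral_eq_zero (hX i).aestronglyMeasurable.aemeasurable (hmean i)

lemma integral_norm_sum_sq_of_iIndepFun {p : ℕ} {V : ι → Ω → Vec p} (hind : iIndepFun V P)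
    (hV : ∀ i, MemLp (V i) 2 P) (hmean : ∀ i k, ∫ ω, V i ω k ∂P = 0) :
    ∫ ω, ‖∑ i, V i ω‖ ^ 2 ∂P = ∑ i, ∫ ω, ‖V i ω‖ ^ 2 ∂P := by
  have hcoord (i : ι) (k : Fin p) : MemLp (fun ω => V i ω k) 2 P := by
    simpa only [EuclideanSpace.inner_single_left, map_one, one_mul] using
      (hV i).const_inner (𝕜 := ℝ) (EuclideanSpace.single k (1 : ℝ))
  have hind_coord (k : Fin p) : iIndepFun (fun i ω => V i ω k) P :=
    hind.comp (fun _ v => v k) fun _ => by fun_prop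
  simp only [EuclideanSpace.real_norm_sq_eq, WithLp.ofLp_sum, Finset.sum_apply]
  rw [integral_finsetSum _ fun k _ => (memLp_finsetSum _ fun i _ => hcoord i k).integrable_sq]
  simp_rw [fun k => integral_sum_sq_of_iIndepFun (hind_coord k) (hcoord · k) (hmean · k)]
  rw [Finset.sum_comm]
  exact Finset.sum_congr rfl fun i _ =>
    (integral_finsetSum _ fun k _ => (hcoord i k).integrable_sq).symm

end IndependentSum

namespace Sample

variable {p : ℕ} {Ω : Type*} (S : Sample p Ω) (M : Model p) (D : Design p) (i : ℕ)

/-- The random effect and the responses of cluster `i`. -/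
def cluster (ω : Ω) : Vec p × (Fin (D.n i) → ℝ) := (S.b i ω, fun j => S.y i j ω)

/-- The linearised deviation of cluster `i`, as a random variable. -/
def dev (ω : Ω) : Vec p := M.linDev D i (S.b i ω) fun j => S.y i j ω

/-- The energy `∑ⱼ (xᵢⱼᵀ zᵢ)²` of the linearised deviation `zᵢ` of cluster `i`. -/
def devEnergy (ω : Ω) : ℝ := energy (fun j : Fin (D.n i) => D.x i j) (S.dev M D i ω)

lemma devEnergy_nonneg (ω : Ω) : 0 ≤ S.devEnergy M D i ω := energy_nonneg _ _

variable {S M D i}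

lemma norm_dev_sq_le {κ : ℝ} (hn : 0 < D.n i) (hκ : D.CurvatureBound i κ) (ω : Ω) :
    ‖S.dev M D i ω‖ ^ 2 ≤ (D.n i : ℝ)⁻¹ * κ * S.devEnergy M D i ω := by
  rw [mul_assoc, le_inv_mul_iff₀ (by exact_mod_cast hn)]
  exact hκ.mul_norm_sq_le _

end Sample

namespace IsGLMM

variable {p : ℕ} {Ω : Type*} [MeasurableSpace Ω] {P : Measure Ω} {M : Model p} {D : Design p}
  {S : Sample p Ω} {i : ℕ} {c : ℝ}

lemma measurable_cluster (h : IsGLMM P M D S) (i : ℕ) : Measurable (S.cluster D i) :=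
  (h.measurable_b i).prodMk (measurable_pi_lambda _ fun j => h.measurable_y i j)

lemma measurable_dev (h : IsGLMM P M D S) (hc : CumulantBounds M c) (i : ℕ) :
    Measurable (S.dev M D i) := by
  have hlin := (Model.measurable_linDev (D := D) (i := i) hc).comp (h.measurable_cluster i)
  simp only [Function.comp_def, Sample.cluster] at hlin
  exact hlin

lemma measurable_devEnergy (h : IsGLMM P M D S) (hc : CumulantBounds M c) (i : ℕ) :
    Measurable (S.devEnergy M D i) := by
  have := h.measurable_dev hc i
  unfold Sample.devEnergy energy
  fun_prop

section Law

variable (h : IsGLMM P M D S) (hM : M.IsValid) (hc : CumulantBounds M c) (hi : i < D.m)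

include h hM hc hi

lemma exists_condKernel : ∃ κ : Kernel (Vec p) (Fin (D.n i) → ℝ), IsMarkovKernel κ ∧
    (∀ b, κ b = M.condLaw D i b) ∧
    P.map (S.cluster D i) = (multivariateGaussian 0 M.G) ⊗ₘ κ := by
  obtain ⟨κ, hκ, hcond, hlaw⟩ := Model.exists_condKernel (D := D) (i := i) hM hc
  exact ⟨κ, hκ, hcond, (h.law i hi).trans hlaw⟩

lemma map_b : P.map (S.b i) = multivariateGaussian 0 M.G := by
  obtain ⟨κ, _, _, hlaw⟩ := h.exists_condKernel hM hc hi
  have hfst : P.map (S.b i) = (P.map (S.cluster D i)).fst :=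
    (Measure.map_map measurable_fst (h.measurable_cluster i)).symm
  rw [hfst, hlaw, Measure.fst_compProd]

lemma charFun_map_smul_b (τ : ℝ) (u : Vec p) :
    charFun (P.map fun ω => τ • S.b i ω) u = Real.exp (-(τ ^ 2 * matForm M.G u u) / 2) := by
  rw [charFun_map_smul_comp (h.measurable_b i).aemeasurable, h.map_b hM hc hi,
    charFun_multivariateGaussian_zero hM.posSemidef_G, map_smul, map_smul, LinearMap.smul_apply,
    smul_eq_mul, smul_eq_mul, ← mul_assoc, ← sq]

lemma lintegral_norm_b_sq : ∫⁻ ω, ENNReal.ofReal (‖S.b i ω‖ ^ 2) ∂P =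
    ∫⁻ b, ENNReal.ofReal (‖b‖ ^ 2) ∂(multivariateGaussian 0 M.G) := by
  rw [← h.map_b hM hc hi, lintegral_map (by fun_prop) (h.measurable_b i)]

lemma lintegral_cluster {f : Vec p × (Fin (D.n i) → ℝ) → ENNReal} (hf : Measurable f) :
    ∫⁻ ω, f (S.cluster D i ω) ∂P =
      ∫⁻ b, ∫⁻ y, f (b, y) ∂(M.condLaw D i b) ∂(multivariateGaussian 0 M.G) := by
  obtain ⟨κ, _, hcond, hlaw⟩ := h.exists_condKernel hM hc hi
  rw [← lintegral_map hf (h.measurable_cluster i), hlaw, Measure.lintegral_compProd hf]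
  simp_rw [hcond]

lemma integral_cluster {E : Type*} [NormedAddCommGroup E] [NormedSpace ℝ E]
    {f : Vec p × (Fin (D.n i) → ℝ) → E} (hf : StronglyMeasurable f)
    (hint : Integrable (fun ω => f (S.cluster D i ω)) P) :
    ∫ ω, f (S.cluster D i ω) ∂P =
      ∫ b, ∫ y, f (b, y) ∂(M.condLaw D i b) ∂(multivariateGaussian 0 M.G) := by
  obtain ⟨κ, _, hcond, hlaw⟩ := h.exists_condKernel hM hc hi
  have hmeas := (h.measurable_cluster i).aemeasurable (μ := P)
  have hint' := (integrable_map_measure hf.aestronglyMeasurable hmeas).2 hint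
  rw [← integral_map hmeas hf.aestronglyMeasurable, hlaw,
    Measure.integral_compProd (hlaw ▸ hint')]
  simp_rw [hcond]

lemma charFun_map_dev [IsProbabilityMeasure P] (u : Vec p) :
    charFun (P.map (S.dev M D i)) u =
      ∫ b, ∫ y, Complex.exp ((inner ℝ u (M.linDev D i b y) : ℝ) * Complex.I)
        ∂(M.condLaw D i b) ∂(multivariateGaussian 0 M.G) := by
  have hmeas : Measurable fun q : Vec p × (Fin (D.n i) → ℝ) =>
      Complex.exp ((inner ℝ u (M.linDev D i q.1 q.2) : ℝ) * Complex.I) := by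
    have := Model.measurable_linDev (D := D) (i := i) hc
    fun_prop
  rw [charFun_apply, integral_map (h.measurable_dev hc i).aemeasurable (by fun_prop)]
  simp_rw [real_inner_comm u]
  exact h.integral_cluster hM hc hi hmeas.stronglyMeasurable <|
    .of_bound (hmeas.comp (h.measurable_cluster i)).aestronglyMeasurable 1
      (ae_of_all _ fun ω => by rw [Complex.norm_exp_ofReal_mul_I])

variable (hn : 0 < D.n i) (hu : ∀ b, IsUnit (M.info D i b))

include hn hu

lemma lintegral_devEnergy_le :
    ∫⁻ ω, ENNReal.ofReal (S.devEnergy M D i ω) ∂P ≤ ENNReal.ofReal (c⁻¹ * (M.φ * p)) := by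
  have hmeas : Measurable fun q : Vec p × (Fin (D.n i) → ℝ) => ENNReal.ofReal
      (energy (fun j : Fin (D.n i) => D.x i j) (M.linDev D i q.1 q.2)) := by
    have := Model.measurable_linDev (D := D) (i := i) hc
    unfold energy
    fun_prop
  calc ∫⁻ ω, ENNReal.ofReal (S.devEnergy M D i ω) ∂P
      = _ := h.lintegral_cluster hM hc hi hmeas
    _ ≤ ∫⁻ _, ENNReal.ofReal (c⁻¹ * (M.φ * p)) ∂(multivariateGaussian 0 M.G) :=
        lintegral_mono fun b => Model.lintegral_energy_linDev_le hM hc (hu b) hn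
    _ = _ := by rw [lintegral_const, measure_univ, mul_one]

lemma integrable_devEnergy : Integrable (S.devEnergy M D i) P := by
  refine ⟨(h.measurable_devEnergy hc i).aestronglyMeasurable, ?_⟩
  rw [hasFiniteIntegral_iff_ofReal (ae_of_all _ (S.devEnergy_nonneg M D i))]
  exact (h.lintegral_devEnergy_le hM hc hi hn hu).trans_lt ENNReal.ofReal_lt_top

lemma integral_devEnergy_le : ∫ ω, S.devEnergy M D i ω ∂P ≤ c⁻¹ * (M.φ * p) := by
  have := hM.φ_pos
  have := hc.pos
  rw [integral_eq_lintegral_of_nonneg_ae (ae_of_all _ (S.devEnergy_nonneg M D i))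
    (h.measurable_devEnergy hc i).aestronglyMeasurable]
  exact ENNReal.toReal_le_of_le_ofReal (by positivity) (h.lintegral_devEnergy_le hM hc hi hn hu)

lemma memLp_dev : MemLp (S.dev M D i) 2 P := by
  refine (memLp_two_iff_integrable_sq_norm (h.measurable_dev hc i).aestronglyMeasurable).2 ?_
  refine ((h.integrable_devEnergy hM hc hi hn hu).const_mul
    ((D.n i : ℝ)⁻¹ * ((M.H D i 0).trace * (M.φ * c)⁻¹))).mono'
    ((h.measurable_dev hc i).norm.pow_const 2).aestronglyMeasurable (ae_of_all _ fun ω => ?_)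
  rw [Real.norm_of_nonneg (sq_nonneg _)]
  exact Sample.norm_dev_sq_le hn (Model.curvatureBound_trace_H hM hc (hu 0) hn) ω

lemma integral_norm_dev_sq_le {κ : ℝ} (hκ : D.CurvatureBound i κ) :
    ∫ ω, ‖S.dev M D i ω‖ ^ 2 ∂P ≤ (D.n i : ℝ)⁻¹ * κ * (c⁻¹ * (M.φ * p)) := by
  have := hκ.nonneg
  calc ∫ ω, ‖S.dev M D i ω‖ ^ 2 ∂P
      ≤ ∫ ω, (D.n i : ℝ)⁻¹ * κ * S.devEnergy M D i ω ∂P :=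
        integral_mono ((h.memLp_dev hM hc hi hn hu).integrable_norm_pow two_ne_zero)
          ((h.integrable_devEnergy hM hc hi hn hu).const_mul _) (Sample.norm_dev_sq_le hn hκ)
    _ ≤ _ := by
        rw [integral_const_mul]
        gcongr
        exact h.integral_devEnergy_le hM hc hi hn hu

lemma integral_inner_dev [IsProbabilityMeasure P] (u : Vec p) :
    ∫ ω, inner ℝ u (S.dev M D i ω) ∂P = 0 := by
  have hmeas : Measurable fun q : Vec p × (Fin (D.n i) → ℝ) =>
      inner ℝ u (M.linDev D i q.1 q.2) := by
    have := Model.measurable_linDev (D := D) (i := i) hc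
    fun_prop
  calc ∫ ω, inner ℝ u (S.dev M D i ω) ∂P
      = _ := h.integral_cluster hM hc hi hmeas.stronglyMeasurable
        (((h.memLp_dev hM hc hi hn hu).integrable one_le_two).const_inner u)
    _ = 0 := by simp_rw [Model.integral_inner_linDev hM hc, integral_zero]

end Law

section Joint

variable (h : IsGLMM P M D S) (hM : M.IsValid) (hc : CumulantBounds M c)

include h hM hc

lemma lintegral_norm_sum_dev_sq_le [IsProbabilityMeasure P] (hn : ∀ i < D.m, 0 < D.n i)
    (hu : ∀ i < D.m, ∀ b, IsUnit (M.info D i b)) {κ : ℕ → ℝ}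
    (hκ : ∀ i < D.m, D.CurvatureBound i (κ i)) :
    ∫⁻ ω, ENNReal.ofReal (‖∑ i ∈ Finset.range D.m, S.dev M D i ω‖ ^ 2) ∂P ≤
      ENNReal.ofReal (∑ i ∈ Finset.range D.m, (D.n i : ℝ)⁻¹ * κ i * (c⁻¹ * (M.φ * p))) := by
  have hmemLp (i : Fin D.m) : MemLp (S.dev M D i) 2 P := h.memLp_dev hM hc i.2 (hn i i.2) (hu i i.2)
  have hind : iIndepFun (fun i : Fin D.m => S.dev M D i) P :=
    h.indep.comp (fun i q => M.linDev D i q.1 q.2) fun i => Model.measurable_linDev hc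
  have hmean (i : Fin D.m) (k : Fin p) : ∫ ω, S.dev M D i ω k ∂P = 0 := by
    simpa only [EuclideanSpace.inner_single_left, map_one, one_mul] using
      h.integral_inner_dev hM hc i.2 (hn i i.2) (hu i i.2) (EuclideanSpace.single k 1)
  simp_rw [Finset.sum_range]
  rw [← ofReal_integral_eq_lintegral_ofReal
    (memLp_finsetSum _ fun i _ => hmemLp i).integrable_norm_pow'
      (ae_of_all _ fun ω => sq_nonneg _),
    integral_norm_sum_sq_of_iIndepFun hind hmemLp hmean]
  exact ENNReal.ofReal_le_ofReal <| Finset.sum_le_sum fun i _ =>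
    h.integral_norm_dev_sq_le hM hc i.2 (hn i i.2) (hu i i.2) (hκ i i.2)

lemma charFun_map_dev_sub_sum (hi : i < D.m) (s τ : ℝ) (u : Vec p) :
    charFun (P.map fun ω => s • S.dev M D i ω
        - τ • ∑ k ∈ (Finset.range D.m).erase i, S.b k ω) u =
      charFun (P.map (S.dev M D i)) (s • u) *
        Real.exp (-((D.m - 1 : ℝ) * τ ^ 2 * matForm M.G u u / 2)) := by
  let V (k : ℕ) (ω : Ω) : Vec p := if k = i then s • S.dev M D k ω else -τ • S.b k ω
  have hV (k : ℕ) : Measurable (V k) := by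
    have hdev := h.measurable_dev hc k
    have hb := h.measurable_b k
    unfold V
    split_ifs <;> fun_prop
  have hind : iIndepFun (fun k : Fin D.m => V k) P := by
    refine h.indep.comp (fun k q => if (k : ℕ) = i then s • M.linDev D k q.1 q.2 else -τ • q.1)
      fun k => ?_
    have := Model.measurable_linDev (D := D) (i := k) hc
    split_ifs <;> fun_prop
  have hVi : V i = fun ω => s • S.dev M D i ω := funext fun ω => if_pos rfl
  have hVk {k : ℕ} (hk : k ∈ (Finset.range D.m).erase i) : V k = fun ω => -τ • S.b k ω :=
    funext fun ω => if_neg (Finset.ne_of_mem_erase hk)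
  have hsum : (fun ω => s • S.dev M D i ω - τ • ∑ k ∈ (Finset.range D.m).erase i, S.b k ω) =
      fun ω => ∑ k : Fin D.m, V k ω := funext fun ω => by
    rw [← Finset.sum_range fun k => V k ω, ← Finset.add_sum_erase _ _ (Finset.mem_range.2 hi), hVi,
      Finset.sum_congr rfl fun k hk => congrFun (hVk hk) ω, ← Finset.smul_sum, neg_smul,
      sub_eq_add_neg]
  rw [hsum, iIndepFun.charFun_map_fun_sum_eq_prod (X := fun k : Fin D.m => V k)
      (fun k => (hV k).aemeasurable) hind, Finset.prod_apply,
    ← Finset.prod_range fun k => charFun (P.map (V k)) u,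
    ← Finset.mul_prod_erase _ _ (Finset.mem_range.2 hi), hVi,
    charFun_map_smul_comp (h.measurable_dev hc i).aemeasurable,
    Finset.prod_congr rfl fun k hk => by
      rw [hVk hk, h.charFun_map_smul_b hM hc (Finset.mem_range.1 (Finset.mem_of_mem_erase hk))],
    Finset.prod_const, Finset.card_erase_of_mem (Finset.mem_range.2 hi), Finset.card_range,
    ← Complex.ofReal_pow, ← Real.exp_nat_mul, Nat.cast_sub (by omega), Nat.cast_one]
  congr 3
  ring

end Joint

end IsGLMM

/-! ### Gaussian mixtures -/

section GaussianMixture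

lemma measurable_toMeasure_of_continuous {X E : Type*} [TopologicalSpace X] [MeasurableSpace X]
    [OpensMeasurableSpace X] [TopologicalSpace E] [MeasurableSpace E] [BorelSpace E]
    [HasOuterApproxClosed E] {g : X → ProbabilityMeasure E} (hg : Continuous g) :
    Measurable fun x => (g x : Measure E) :=
  Measurable.measure_of_isPiSystem_of_isProbabilityMeasure (BorelSpace.measurable_eq (α := E))
    isPiSystem_isOpen fun _ hs => (lowerSemicontinuous_iff_le_liminf.2 fun x =>
      ProbabilityMeasure.le_liminf_measure_open_of_tendsto (hg.tendsto x) hs).measurable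

variable {p : ℕ}

lemma continuous_matForm_of (u v : Vec p) :
    Continuous fun A : Fin p → Fin p → ℝ => matForm (Matrix.of A) u v := by
  simp only [matForm_eq_sum, Matrix.of_apply]
  fun_prop

lemma posSemidef_iff_matForm_nonneg {A : Matrix (Fin p) (Fin p) ℝ} :
    A.PosSemidef ↔ (∀ k l, A k l = A l k) ∧ ∀ v : Vec p, 0 ≤ matForm A v v := by
  refine ⟨fun hA => ⟨fun k l => hA.isHermitian.apply l k, matForm_nonneg hA⟩, fun hA => ?_⟩
  refine Matrix.PosSemidef.of_dotProduct_mulVec_nonneg (Matrix.IsHermitian.ext fun k l => hA.1 l k)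
    fun v => ?_
  simpa only [matForm_apply, star_trivial] using hA.2 (WithLp.toLp 2 v)

lemma isClosed_setOf_posSemidef : IsClosed {A : Fin p → Fin p → ℝ | (Matrix.of A).PosSemidef} := by
  simp only [posSemidef_iff_matForm_nonneg, Matrix.of_apply, Set.ofPred_and, Set.ofPred_forall]
  exact .inter
    (isClosed_iInter fun k => isClosed_iInter fun l => isClosed_eq (by fun_prop) (by fun_prop))
    (isClosed_iInter fun v => isClosed_le continuous_const (continuous_matForm_of v v))

lemma continuous_multivariateGaussian :
    Continuous (Y := ProbabilityMeasure (Vec p))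
      fun A : {A : Fin p → Fin p → ℝ | (Matrix.of A).PosSemidef} =>
        ⟨multivariateGaussian 0 (Matrix.of A.1), inferInstance⟩ := by
  refine continuous_iff_seqContinuous.2 fun A A₀ hA => ?_
  refine ProbabilityMeasure.tendsto_of_tendsto_charFun fun u => ?_
  refine Tendsto.congr (fun t => (charFun_multivariateGaussian_zero (A t).2 u).symm) ?_
  rw [ProbabilityMeasure.coe_mk, charFun_multivariateGaussian_zero A₀.2]
  have hcont : Continuous fun A : Fin p → Fin p → ℝ =>
      ((Real.exp (-matForm (Matrix.of A) u u / 2) : ℝ) : ℂ) := by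
    have := continuous_matForm_of u u
    fun_prop
  exact (hcont.comp continuous_subtype_val).continuousAt.tendsto.comp hA

-- Outside the closed set of positive semidefinite matrices, `multivariateGaussian 0 A` is the
-- junk value `Measure.dirac 0`.
lemma measurable_multivariateGaussian :
    Measurable fun A : Fin p → Fin p → ℝ => multivariateGaussian (0 : Vec p) (Matrix.of A) := by
  refine measurable_of_restrict_of_restrict_compl isClosed_setOf_posSemidef.measurableSet
    (measurable_toMeasure_of_continuous continuous_multivariateGaussian) ?_
  convert measurable_const (a := Measure.dirac (0 : Vec p)) using 1
  ext1 A
  exact multivariateGaussian_of_not_posSemidef 0 A.2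

variable {N : Measure (Vec p)} [IsProbabilityMeasure N] {K : Vec p → Matrix (Fin p) (Fin p) ℝ}

lemma exists_kernel_mixN (hK : ∀ k l, AEMeasurable (fun b => K b k l) N) :
    ∃ κ : Kernel (Vec p) (Vec p), IsMarkovKernel κ ∧
      (∀ᵐ b ∂N, multivariateGaussian 0 (K b) = κ b) ∧ mixN (fun _ => 0) K N = (N ⊗ₘ κ).snd := by
  have hK' : AEMeasurable (fun b k l => K b k l) N :=
    aemeasurable_pi_lambda _ fun k => aemeasurable_pi_lambda _ fun l => hK k l
  let κ : Kernel (Vec p) (Vec p) :=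
    ⟨fun b => multivariateGaussian 0 (Matrix.of (hK'.mk _ b)),
      measurable_multivariateGaussian.comp hK'.measurable_mk⟩
  have hκ : ∀ᵐ b ∂N, multivariateGaussian 0 (K b) = κ b := by
    filter_upwards [hK'.ae_eq_mk] with b hb
    exact congrArg (fun A => multivariateGaussian 0 (Matrix.of A)) hb
  have : IsMarkovKernel κ :=
    ⟨fun b => inferInstanceAs (IsProbabilityMeasure (multivariateGaussian 0 _))⟩
  exact ⟨κ, this, hκ, (Measure.bind_congr_right hκ).trans (Measure.snd_compProd N κ).symm⟩

lemma isProbabilityMeasure_mixN (hK : ∀ k l, AEMeasurable (fun b => K b k l) N) :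
    IsProbabilityMeasure (mixN (fun _ => 0) K N) := by
  obtain ⟨κ, _, -, hmix⟩ := exists_kernel_mixN hK
  rw [hmix]
  infer_instance

lemma charFun_mixN (hK : ∀ k l, AEMeasurable (fun b => K b k l) N)
    (hps : ∀ᵐ b ∂N, (K b).PosSemidef) (u : Vec p) :
    charFun (mixN (fun _ => 0) K N) u = ∫ b, (Real.exp (-matForm (K b) u u / 2) : ℂ) ∂N := by
  obtain ⟨κ, _, hκ, hmix⟩ := exists_kernel_mixN hK
  have hint : Integrable (fun q : Vec p × Vec p =>
      Complex.exp ((inner ℝ q.2 u : ℝ) * Complex.I)) (N ⊗ₘ κ) :=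
    integrable_cexp_mul_I (by fun_prop)
  rw [hmix, charFun_apply, Measure.snd, integral_map measurable_snd.aemeasurable
    (by fun_prop), Measure.integral_compProd hint]
  refine integral_congr_ae ?_
  filter_upwards [hκ, hps] with b hb hb'
  rw [← hb, ← charFun_apply, charFun_multivariateGaussian_zero hb']

end GaussianMixture

/-! ### Stochastic order and Slutsky's theorem -/

section StochasticOrder

variable {Ω : ℕ → Type*} [∀ t, MeasurableSpace (Ω t)] {P : ∀ t, Measure (Ω t)}
  {W Y Z : ∀ t, Ω t → ℝ}

lemma StochBounded.mono (hZ : StochBounded P Z)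
    (h : ∀ᶠ t in atTop, ∀ᵐ ω ∂(P t), |Y t ω| ≤ |Z t ω|) : StochBounded P Y := fun ε hε => by
  obtain ⟨B, hB⟩ := hZ ε hε
  refine ⟨B, ?_⟩
  filter_upwards [hB, h] with t ht hYZ
  refine (measure_mono_ae ?_).trans ht
  filter_upwards [hYZ] with ω hω
  exact fun (hY : B < _) => hY.trans_le hω

lemma StochBounded.abs (hZ : StochBounded P Z) : StochBounded P fun t ω => |Z t ω| := by
  simpa only [StochBounded, abs_abs] using hZ

lemma stochBounded_const (a : ℝ) : StochBounded P fun _ _ => a := fun ε _ => ⟨|a|, by simp⟩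

lemma StochBounded.exists_add (hY : StochBounded P Y) (hZ : StochBounded P Z) {ε : ENNReal}
    (hε : 0 < ε) : ∃ B C, ∀ᶠ t in atTop, P t {ω | B < |Y t ω| ∨ C < |Z t ω|} ≤ ε := by
  obtain ⟨B, hB⟩ := hY (ε / 2) (ENNReal.half_pos hε.ne')
  obtain ⟨C, hC⟩ := hZ (ε / 2) (ENNReal.half_pos hε.ne')
  refine ⟨B, C, ?_⟩
  filter_upwards [hB, hC] with t hB hC
  exact (measure_union_le _ _).trans ((add_le_add hB hC).trans_eq (ENNReal.add_halves ε))

lemma StochBounded.add (hY : StochBounded P Y) (hZ : StochBounded P Z) :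
    StochBounded P fun t ω => Y t ω + Z t ω := fun ε hε => by
  obtain ⟨B, C, hBC⟩ := hY.exists_add hZ hε
  refine ⟨B + C, hBC.mono fun t ht => (measure_mono fun ω hω => ?_).trans ht⟩
  rw [Set.mem_ofPred_eq] at hω
  by_contra! hcon
  simp only [Set.mem_ofPred_eq, not_or, not_lt] at hcon
  linarith [abs_add_le (Y t ω) (Z t ω)]

lemma StochBounded.mul (hY : StochBounded P Y) (hZ : StochBounded P Z) :
    StochBounded P fun t ω => Y t ω * Z t ω := fun ε hε => by
  obtain ⟨B, C, hBC⟩ := hY.exists_add hZ hε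
  refine ⟨B * C, hBC.mono fun t ht => (measure_mono fun ω hω => ?_).trans ht⟩
  rw [Set.mem_ofPred_eq] at hω
  by_contra! hcon
  simp only [Set.mem_ofPred_eq, not_or, not_lt] at hcon
  rw [abs_mul] at hω
  exact hω.not_ge (mul_le_mul hcon.1 hcon.2 (abs_nonneg _) ((abs_nonneg _).trans hcon.1))

lemma StochBounded.sum {ι : Type*} (s : Finset ι) {Z : ι → ∀ t, Ω t → ℝ}
    (hZ : ∀ k, StochBounded P (Z k)) : StochBounded P fun t ω => ∑ k ∈ s, Z k t ω := by
  classical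
  induction s using Finset.induction_on with
  | empty => simpa using stochBounded_const 0
  | insert k s hk ih => simpa only [Finset.sum_insert hk] using (hZ k).add ih

lemma StochBounded.of_sq (hZ : StochBounded P fun t ω => Z t ω ^ 2) : StochBounded P Z :=
  ((stochBounded_const 1).add hZ).mono <| .of_forall fun t => ae_of_all _ fun ω => by
    rw [abs_of_nonneg (a := 1 + _) (by positivity), ← sq_abs]
    nlinarith [sq_nonneg (|Z t ω| - 1)]

lemma StochBounded.of_imp {N : ℕ → ℝ} (hN : Tendsto N atTop atTop) (hW : StochBounded P W)
    (hY : StochBounded P Y)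
    (h : ∀ᶠ t in atTop, ∀ᵐ ω ∂(P t), |W t ω| ≤ N t → |Z t ω| ≤ |Y t ω|) :
    StochBounded P Z := fun ε hε => by
  obtain ⟨B, C, hBC⟩ := hW.exists_add hY hε
  refine ⟨C, ?_⟩
  filter_upwards [hBC, h, hN.eventually_ge_atTop B] with t ht hZ hB
  refine (measure_mono_ae ?_).trans ht
  filter_upwards [hZ] with ω hω (hC : C < _)
  refine or_iff_not_imp_left.2 fun hW => hC.trans_le (hω ((not_lt.1 hW).trans hB))

lemma stochBounded_of_lintegral_le {C : ENNReal} (hC : C ≠ ⊤) (hm : ∀ t, Measurable (Z t))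
    (h : ∀ᶠ t in atTop, ∫⁻ ω, ENNReal.ofReal |Z t ω| ∂(P t) ≤ C) : StochBounded P Z := by
  intro ε hε
  obtain rfl | hε' := eq_or_ne ε ⊤
  · exact ⟨0, by simp⟩
  let B : ℝ := (C / ε).toReal + 1
  have hB : ENNReal.ofReal B ≠ 0 := (ENNReal.ofReal_pos.2 (by positivity)).ne'
  have hCB : C / ε ≤ ENNReal.ofReal B :=
    ENNReal.le_ofReal_iff_toReal_le (ENNReal.div_ne_top hC hε.ne') (by positivity) |>.2
      (le_add_of_nonneg_right zero_le_one)
  refine ⟨B, ?_⟩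
  filter_upwards [h] with t ht
  calc P t {ω | B < |Z t ω|} ≤ P t {ω | ENNReal.ofReal B ≤ ENNReal.ofReal |Z t ω|} :=
        measure_mono fun ω (hω : _ < _) => ENNReal.ofReal_le_ofReal hω.le
    _ ≤ (∫⁻ ω, ENNReal.ofReal |Z t ω| ∂(P t)) / ENNReal.ofReal B :=
        meas_ge_le_lintegral_div (hm t).abs.ennreal_ofReal.aemeasurable hB ENNReal.ofReal_ne_top
    _ ≤ C / ENNReal.ofReal B := by gcongr
    _ ≤ ε := ENNReal.div_le_of_le_mul' ((ENNReal.div_le_iff hε.ne' hε').1 hCB)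

lemma StochBounded.tendstoInProb_mul (hZ : StochBounded P Z) {a : ℕ → ℝ}
    (ha : Tendsto a atTop (𝓝 0)) : TendstoInProb P (fun t ω => a t * Z t ω) 0 := by
  refine fun ε hε => ENNReal.tendsto_nhds_zero.2 fun η hη => ?_
  obtain ⟨B, hB⟩ := hZ η hη
  have haB : Tendsto (fun t => |a t| * |B|) atTop (𝓝 0) := by
    simpa using ha.abs.mul_const |B|
  filter_upwards [hB, haB.eventually_lt_const hε] with t ht htε
  refine (measure_mono fun ω (hω : ε ≤ _) => ?_).trans ht
  by_contra! hcon
  have hZB : |Z t ω| ≤ |B| := (not_lt.1 hcon).trans (le_abs_self B)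
  rw [sub_zero, abs_mul] at hω
  linarith [mul_le_mul_of_nonneg_left hZB (abs_nonneg (a t))]

lemma TendstoInProb.add {y z : ℝ} (hY : TendstoInProb P Y y) (hZ : TendstoInProb P Z z) :
    TendstoInProb P (fun t ω => Y t ω + Z t ω) (y + z) := by
  intro ε hε
  have hYZ := (hY (ε / 2) (half_pos hε)).add (hZ (ε / 2) (half_pos hε))
  rw [add_zero] at hYZ
  refine tendsto_of_tendsto_of_tendsto_of_le_of_le tendsto_const_nhds hYZ (fun _ => zero_le)
    fun t => (measure_mono fun ω (hω : ε ≤ _) => ?_).trans (measure_union_le _ _)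
  by_contra! hcon
  simp only [Set.mem_union, Set.mem_ofPred_eq, not_or, not_le] at hcon
  rw [add_sub_add_comm] at hω
  linarith [abs_add_le (Y t ω - y) (Z t ω - z)]

lemma TendstoInProb.sum {ι : Type*} (s : Finset ι) {Z : ι → ∀ t, Ω t → ℝ} {z : ι → ℝ}
    (hZ : ∀ k, TendstoInProb P (Z k) (z k)) :
    TendstoInProb P (fun t ω => ∑ k ∈ s, Z k t ω) (∑ k ∈ s, z k) := by
  induction s using Finset.cons_induction with
  | empty => exact fun ε hε => by simp [hε.not_ge]
  | cons k s hk ih =>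
    simp only [Finset.sum_cons]
    exact (hZ k).add ih

lemma TendstoInProb.eventually_exists_lt [∀ t, IsProbabilityMeasure (P t)] {z a : ℝ}
    (hZ : TendstoInProb P Z z) (h : z < a) : ∀ᶠ t in atTop, ∃ ω, Z t ω < a := by
  filter_upwards [(hZ (a - z) (sub_pos.2 h)).eventually (gt_mem_nhds zero_lt_one)] with t ht
  by_contra! hcon
  have everywhere : {ω | a - z ≤ |Z t ω - z|} = Set.univ := Set.eq_univ_of_forall fun ω =>
    (sub_le_sub_right (hcon ω) z).trans (le_abs_self _)
  rw [everywhere, measure_univ] at ht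
  exact lt_irrefl _ ht

lemma TendstoInProb.squeeze_zero (hZ : TendstoInProb P Z 0)
    (h : ∀ᶠ t in atTop, ∀ᵐ ω ∂(P t), |Y t ω| ≤ |Z t ω|) : TendstoInProb P Y 0 := by
  intro ε hε
  refine tendsto_of_tendsto_of_tendsto_of_le_of_le' tendsto_const_nhds (hZ ε hε)
    (.of_forall fun _ => zero_le) ?_
  filter_upwards [h] with t ht
  refine measure_mono_ae ?_
  filter_upwards [ht] with ω hω (hY : ε ≤ _)
  change ε ≤ |Z t ω - 0|
  rw [sub_zero] at hY ⊢
  exact hY.trans hω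

end StochasticOrder

section Slutsky

lemma norm_cexp_mul_I_sub_cexp_mul_I_le (x y : ℝ) :
    ‖Complex.exp (x * Complex.I) - Complex.exp (y * Complex.I)‖ ≤ |x - y| := by
  have hfactor : Complex.exp (x * Complex.I) - Complex.exp (y * Complex.I) =
      Complex.exp (y * Complex.I) * (Complex.exp (Complex.I * ((x - y : ℝ) : ℂ)) - 1) := by
    rw [mul_sub, ← Complex.exp_add, mul_one]
    congr 2
    push_cast
    ring
  rw [hfactor, norm_mul, Complex.norm_exp_ofReal_mul_I, one_mul]
  exact Real.norm_exp_I_mul_ofReal_sub_one_le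

lemma norm_charFun_map_sub_le {Ω E : Type*} [MeasurableSpace Ω] {P : Measure Ω}
    [IsProbabilityMeasure P] [NormedAddCommGroup E] [InnerProductSpace ℝ E] [MeasurableSpace E]
    [BorelSpace E] [SecondCountableTopology E] {Z V : Ω → E} (hZ : Measurable Z)
    (hV : Measurable V) (u : E) {ε : ℝ} (hε : 0 ≤ ε) :
    ‖charFun (P.map Z) u - charFun (P.map V) u‖ ≤
      ‖u‖ * ε + 2 * P.real {ω | ε ≤ ‖Z ω - V ω‖} := by
  let s : Set Ω := {ω | ε ≤ ‖Z ω - V ω‖}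
  have hs : MeasurableSet s := measurableSet_le measurable_const (hZ.sub hV).norm
  have hint {X : Ω → E} (hX : Measurable X) :
      Integrable (fun ω => Complex.exp ((inner ℝ (X ω) u : ℝ) * Complex.I)) P :=
    integrable_cexp_mul_I (by fun_prop)
  have hind : Integrable (s.indicator fun _ => (2 : ℝ)) P := (integrable_const _).indicator hs
  have hpoint (ω : Ω) : ‖Complex.exp ((inner ℝ (Z ω) u : ℝ) * Complex.I) -
      Complex.exp ((inner ℝ (V ω) u : ℝ) * Complex.I)‖ ≤
      ‖u‖ * ε + s.indicator (fun _ => (2 : ℝ)) ω := by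
    by_cases hω : ω ∈ s
    · rw [Set.indicator_of_mem hω]
      have htri := norm_sub_le (Complex.exp ((inner ℝ (Z ω) u : ℝ) * Complex.I))
        (Complex.exp ((inner ℝ (V ω) u : ℝ) * Complex.I))
      rw [Complex.norm_exp_ofReal_mul_I, Complex.norm_exp_ofReal_mul_I] at htri
      linarith [mul_nonneg (norm_nonneg u) hε]
    · rw [Set.indicator_of_notMem hω, add_zero]
      calc _ ≤ |inner ℝ (Z ω) u - inner ℝ (V ω) u| := norm_cexp_mul_I_sub_cexp_mul_I_le _ _
        _ = |inner ℝ (Z ω - V ω) u| := by rw [inner_sub_left]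
        _ ≤ ‖Z ω - V ω‖ * ‖u‖ := abs_real_inner_le_norm _ _
        _ ≤ ε * ‖u‖ := by gcongr; exact (not_le.1 hω).le
        _ = ‖u‖ * ε := mul_comm _ _
  rw [charFun_apply, charFun_apply, integral_map hZ.aemeasurable (by fun_prop),
    integral_map hV.aemeasurable (by fun_prop), ← integral_sub (hint hZ) (hint hV)]
  calc _ ≤ ∫ ω, (‖u‖ * ε + s.indicator (fun _ => (2 : ℝ)) ω) ∂P :=
        norm_integral_le_of_norm_le ((integrable_const _).add hind) (ae_of_all _ hpoint)
    _ = ‖u‖ * ε + 2 * P.real s := by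
        rw [integral_add (integrable_const _) hind, integral_indicator hs]
        simp [mul_comm]

lemma TendstoInProb.tendstoInLaw {p : ℕ} {Ω : ℕ → Type*} [∀ t, MeasurableSpace (Ω t)]
    {P : ∀ t, Measure (Ω t)} [∀ t, IsProbabilityMeasure (P t)] {Z V : ∀ t, Ω t → Vec p}
    {μ : Measure (Vec p)} [hμ : IsProbabilityMeasure μ]
    (hZV : TendstoInProb P (fun t ω => ‖Z t ω - V t ω‖) 0) (hZ : ∀ t, Measurable (Z t))
    (hV : ∀ t, Measurable (V t))
    (h : ∀ u, Tendsto (fun t => charFun ((P t).map (V t)) u) atTop (𝓝 (charFun μ u))) :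
    TendstoInLaw P Z μ := by
  refine ⟨hμ, fun t => (hZ t).aemeasurable, aemeasurable_id, ?_⟩
  refine ProbabilityMeasure.tendsto_of_tendsto_charFun fun u => ?_
  simp only [ProbabilityMeasure.coe_mk, Measure.map_id]
  suffices hdiff : Tendsto (fun t => charFun ((P t).map (Z t)) u - charFun ((P t).map (V t)) u)
      atTop (𝓝 0) by
    simpa using hdiff.add (h u)
  refine Metric.tendsto_nhds.2 fun η hη => ?_
  let ε : ℝ := η / (2 * (‖u‖ + 1))
  have hε : 0 < ε := by positivity
  have hprob : Tendsto (fun t => 2 * (P t).real {ω | ε ≤ ‖Z t ω - V t ω‖}) atTop (𝓝 0) := by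
    simpa [Measure.real] using
      ((ENNReal.tendsto_toReal ENNReal.zero_ne_top).comp (hZV ε hε)).const_mul 2
  filter_upwards [hprob.eventually_lt_const (half_pos hη)] with t ht
  have huε : ‖u‖ * ε ≤ η / 2 := by
    calc ‖u‖ * ε ≤ (‖u‖ + 1) * ε := by gcongr; linarith
      _ = η / 2 := by simp only [ε]; field_simp
  rw [dist_zero_right]
  linarith [norm_charFun_map_sub_le (P := P t) (hZ t) (hV t) u hε.le]

end Slutsky

/-! ### The maximiser of the objective function -/

section Maximiser

variable {p : ℕ} {M : Model p} {D : Design p} {c : ℝ}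

lemma matForm_smul (φ : ℝ) (A : Matrix (Fin p) (Fin p) ℝ) (u v : Vec p) :
    matForm (φ • A) u v = φ * matForm A u v := by
  simp only [matForm, map_smul, LinearMap.smul_apply, smul_eq_mul]

lemma hasDerivAt_half_matForm_add_smul {A : Matrix (Fin p) (Fin p) ℝ} (hA : A.IsHermitian)
    (b v : Vec p) :
    HasDerivAt (fun s : ℝ => 1 / 2 * matForm A (b + s • v) (b + s • v)) (matForm A b v) 0 := by
  have expand : ∀ s : ℝ, 1 / 2 * matForm A (b + s • v) (b + s • v) =
      1 / 2 * matForm A b b + s * matForm A b v + s ^ 2 * (1 / 2 * matForm A v v) := fun s => by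
    simp only [map_add, map_smul, LinearMap.add_apply, LinearMap.smul_apply, smul_eq_mul,
      matForm_comm hA v b]
    ring
  simp only [expand]
  have linear := ((hasDerivAt_id (0 : ℝ)).mul_const (matForm A b v)).const_add
    (1 / 2 * matForm A b b)
  exact (linear.add ((hasDerivAt_pow 2 (0 : ℝ)).mul_const (1 / 2 * matForm A v v))).congr_deriv
    (by simp)

namespace Model

variable {y : ℕ → ℕ → ℝ} {G : Matrix (Fin p) (Fin p) ℝ} {φ : ℝ} {β : Vec p} {b : ℕ → Vec p}

lemma hasDerivAt_log_density (hc : CumulantBounds M c) (φ : ℝ) (x β b v : Vec p) (y : ℝ) :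
    HasDerivAt (fun s : ℝ => Real.log (M.density φ (linPred x β (b + s • v)) y))
      (φ⁻¹ * ((y - deriv M.a (linPred x β b)) * inner ℝ x v)) 0 := by
  have line : ∀ s : ℝ, linPred x β (b + s • v) = linPred x β b + s * inner ℝ x v := fun s => by
    simp only [linPred, inner_add_right, inner_smul_right, add_assoc]
  simp only [line, density, Real.log_exp]
  have hη : HasDerivAt (fun s : ℝ => linPred x β b + s * inner ℝ x v) (inner ℝ x v) 0 := by
    simpa using ((hasDerivAt_id (0 : ℝ)).mul_const (inner ℝ x v)).const_add (linPred x β b)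
  have ha := (hc.hasDerivAt (linPred x β b + 0 * inner ℝ x v)).comp 0 hη
  refine ((((hη.const_mul y).sub ha).const_mul φ⁻¹).add_const (M.c y φ)).congr_deriv ?_
  rw [zero_mul, add_zero]
  ring

/-- The contribution to the PQL objective function of cluster `i`, as a function of its random
effect `w`. -/
def clusterObjective (M : Model p) (D : Design p) (y : ℕ → ℕ → ℝ) (G : Matrix (Fin p) (Fin p) ℝ)
    (φ : ℝ) (β : Vec p) (i : ℕ) (w : Vec p) : ℝ :=
  ∑ j ∈ Finset.range (D.n i), Real.log (M.density φ (linPred (D.x i j) β w) (y i j))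
    - 1 / 2 * matForm G⁻¹ w w

lemma objective_eq_sum (y : ℕ → ℕ → ℝ) (G : Matrix (Fin p) (Fin p) ℝ) (φ : ℝ) (β : Vec p)
    (b : ℕ → Vec p) : M.objective D y G φ β b =
      ∑ i ∈ Finset.range D.m, M.clusterObjective D y G φ β i (b i) := by
  simp only [objective, clusterObjective, Finset.sum_sub_distrib, Finset.mul_sum, matForm_apply]

lemma clusterObjective_le {i : ℕ} (hi : i < D.m)
    (hmax : ∀ b', M.objective D y G φ β b' ≤ M.objective D y G φ β b) (w : Vec p) :
    M.clusterObjective D y G φ β i w ≤ M.clusterObjective D y G φ β i (b i) := by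
  have h := hmax (Function.update b i w)
  have others : ∑ k ∈ (Finset.range D.m).erase i,
      M.clusterObjective D y G φ β k (Function.update b i w k) =
      ∑ k ∈ (Finset.range D.m).erase i, M.clusterObjective D y G φ β k (b k) :=
    Finset.sum_congr rfl fun k hk => by
      rw [Function.update_of_ne (Finset.ne_of_mem_erase hk)]
  rwa [objective_eq_sum, objective_eq_sum, ← Finset.add_sum_erase _ _ (Finset.mem_range.2 hi),
    ← Finset.add_sum_erase (Finset.range D.m) (fun k => M.clusterObjective D y G φ β k (b k))
      (Finset.mem_range.2 hi), Function.update_self, others, add_le_add_iff_right] at h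

lemma hasDerivAt_clusterObjective (hc : CumulantBounds M c) (hG : G.PosDef) (i : ℕ)
    (w v : Vec p) :
    HasDerivAt (fun s : ℝ => M.clusterObjective D y G φ β i (w + s • v))
      (φ⁻¹ * ∑ j ∈ Finset.range (D.n i),
        (y i j - deriv M.a (linPred (D.x i j) β w)) * inner ℝ (D.x i j) v - matForm G⁻¹ w v)
      0 := by
  rw [Finset.mul_sum]
  exact (HasDerivAt.fun_sum fun j _ => hasDerivAt_log_density hc φ (D.x i j) β w v (y i j)).sub
    (hasDerivAt_half_matForm_add_smul hG.inv.isHermitian w v)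

lemma score_eq (hc : CumulantBounds M c) (hG : G.PosDef) (hφ : φ ≠ 0) {i : ℕ} (hi : i < D.m)
    (hmax : ∀ b', M.objective D y G φ β b' ≤ M.objective D y G φ β b) (v : Vec p) :
    ∑ j ∈ Finset.range (D.n i),
        (y i j - deriv M.a (linPred (D.x i j) β (b i))) * inner ℝ (D.x i j) v =
      matForm (φ • G⁻¹) (b i) v := by
  have isMax : IsLocalMax (fun s : ℝ => M.clusterObjective D y G φ β i (b i + s • v)) 0 :=
    Eventually.of_forall fun s => by
      simpa only [zero_smul, add_zero] using clusterObjective_le hi hmax _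
  have stationary := isMax.hasDerivAt_eq_zero (hasDerivAt_clusterObjective hc hG i (b i) v)
  rw [matForm_smul, ← sub_eq_zero.1 stationary, mul_inv_cancel_left₀ hφ]

/-- Moving all random effects by the same vector can be compensated by the fixed effects, so that
only the penalty changes. -/
lemma sum_eq_zero_of_isMax (hG : G.PosDef)
    (hmax : ∀ β' b', M.objective D y G φ β' b' ≤ M.objective D y G φ β b) :
    ∑ i ∈ Finset.range D.m, b i = 0 := by
  set w := ∑ i ∈ Finset.range D.m, b i with hw
  have shift : ∀ (s : ℝ) (x u : Vec p), linPred x (β - s • w) (u + s • w) = linPred x β u :=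
    fun s x u => by
      simp only [linPred, inner_add_right, inner_sub_right]
      ring
  have penalty_min : IsLocalMin (fun s : ℝ => ∑ i ∈ Finset.range D.m,
      1 / 2 * matForm G⁻¹ (b i + s • w) (b i + s • w)) 0 := Eventually.of_forall fun s => by
    have h := hmax (β - s • w) fun i => b i + s • w
    simp only [objective, shift, ← matForm_apply, sub_le_sub_iff_left] at h
    simpa only [zero_smul, add_zero, ← Finset.mul_sum] using h
  have stationary := penalty_min.hasDerivAt_eq_zero (HasDerivAt.fun_sum fun i _ =>
    hasDerivAt_half_matForm_add_smul hG.inv.isHermitian (b i) w)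
  have hform : matForm G⁻¹ w w = 0 := by
    rw [← stationary, ← LinearMap.sum_apply, ← map_sum, ← hw]
  have h := norm_sq_le_trace_inv_mul hG.inv w
  rw [hform, mul_zero] at h
  exact norm_eq_zero.1 (pow_eq_zero_iff two_ne_zero |>.1 (le_antisymm h (sq_nonneg _)))

end Model

lemma Design.nL_le (D : Design p) {i : ℕ} (hi : i < D.m) : D.nL ≤ D.n i :=
  ciInf_le (f := fun i : Fin D.m => D.n i) (OrderBot.bddBelow _) ⟨i, hi⟩

section Realisation

variable {Ω : Type*} {S : Sample p Ω} {F : Fit p Ω} {ω : Ω}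

/-- The deviation of the estimated coefficient `β + b i` of cluster `i` from the true one. -/
def coefDev (M : Model p) (S : Sample p Ω) (F : Fit p Ω) (i : ℕ) (ω : Ω) : Vec p :=
  F.βhat ω + F.bhat i ω - (M.β + S.b i ω)

/-- At the realisation `ω`, the fit maximises an objective function with a proper penalty. -/
structure IsMaxAt (M : Model p) (D : Design p) (S : Sample p Ω) (F : Fit p Ω) (ω : Ω) : Prop where
  posDef_Ghat : (F.Ghat ω).PosDef
  φhat_pos : 0 < F.φhat ω
  isMax : ∀ (β : Vec p) (b : ℕ → Vec p),
    M.objective D (fun i j => S.y i j ω) (F.Ghat ω) (F.φhat ω) β b ≤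
      M.objective D (fun i j => S.y i j ω) (F.Ghat ω) (F.φhat ω) (F.βhat ω)
        (fun i => F.bhat i ω)

/-- The matrix of the penalty, relative to the log-likelihood at unit dispersion. -/
def penalty (F : Fit p Ω) (ω : Ω) : Matrix (Fin p) (Fin p) ℝ := F.φhat ω • (F.Ghat ω)⁻¹

/-- The sum of the absolute entries of the penalty matrix, which bounds its quadratic form. -/
def penaltySize (F : Fit p Ω) (ω : Ω) : ℝ := ∑ k, ∑ l, |penalty F ω k l|

lemma penaltySize_nonneg (F : Fit p Ω) (ω : Ω) : 0 ≤ penaltySize F ω :=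
  Finset.sum_nonneg fun _ _ => Finset.sum_nonneg fun _ _ => abs_nonneg _

namespace IsMaxAt

lemma posDef_penalty (h : IsMaxAt M D S F ω) : (penalty F ω).PosDef :=
  h.posDef_Ghat.inv.smul h.φhat_pos

lemma clusterScore (h : IsMaxAt M D S F ω) (hM : M.IsValid) (hc : CumulantBounds M c)
    {i : ℕ} (hi : i < D.m) (hn : 0 < D.n i) (hu : IsUnit (M.info D i (S.b i ω))) :
    ClusterScore (fun j : Fin (D.n i) => D.x i j) (deriv M.a)
      (fun j => linPred (D.x i j) M.β (S.b i ω)) (M.weight D i (S.b i ω))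
      (fun j => S.y i j ω - M.mean D i (S.b i ω) j) (matForm (penalty F ω)) c (penaltySize F ω)
      (S.b i ω) (F.βhat ω - M.β) (coefDev M S F i ω) (S.dev M D i ω) where
  score v := by
    have estimate : S.b i ω + coefDev M S F i ω - (F.βhat ω - M.β) = F.bhat i ω := by
      rw [coefDev]; abel
    have predictor : ∀ j, linPred (D.x i j) M.β (S.b i ω) +
        inner ℝ (D.x i j) (coefDev M S F i ω) = linPred (D.x i j) (F.βhat ω) (F.bhat i ω) :=
      fun j => by
        simp only [linPred, coefDev, inner_add_right, inner_sub_right]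
        ring
    rw [estimate, penalty, ← Model.score_eq hc h.posDef_Ghat h.φhat_pos.ne' hi
      (fun b' => h.isMax _ b') v, Finset.sum_range, ← Finset.sum_sub_distrib]
    refine Finset.sum_congr rfl fun j _ => ?_
    rw [predictor, Model.mean]
    ring
  linearised v := Model.sum_mul_inner_eq_linDev hM hu hn v _
  c_pos := hc.pos
  le_weight _ := hc.le_two _
  weight_le _ := hc.two_le _
  monotone _ t := mul_sq_le_sub_mul hc.hasDerivAt_deriv hc.le_two _ t
  taylor _ t := hc.taylor _ t
  posSemidef := isPosSemidef_matForm h.posDef_penalty.posSemidef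
  lam_nonneg := penaltySize_nonneg F ω
  penalty_le := matForm_self_le _

lemma fixed_eq (h : IsMaxAt M D S F ω) (hm : D.m ≠ 0) :
    F.βhat ω - M.β = (D.m : ℝ)⁻¹ • ∑ i ∈ Finset.range D.m, coefDev M S F i ω
      + (D.m : ℝ)⁻¹ • ∑ i ∈ Finset.range D.m, S.b i ω := by
  have balance : ∑ i ∈ Finset.range D.m, coefDev M S F i ω + ∑ i ∈ Finset.range D.m, S.b i ω =
      (D.m : ℝ) • (F.βhat ω - M.β) := by
    simp only [coefDev, Finset.sum_sub_distrib, Finset.sum_add_distrib, Finset.sum_const,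
      Finset.card_range, ← Nat.cast_smul_eq_nsmul ℝ,
      Model.sum_eq_zero_of_isMax h.posDef_Ghat h.isMax]
    module
  rw [← smul_add, balance, smul_smul, inv_mul_cancel₀ (Nat.cast_ne_zero.2 hm), one_smul]

end IsMaxAt

end Realisation

end Maximiser

/-! ### The sequence of designs -/

section DesignSequence

lemma norm_le_of_abs_coord_le {p : ℕ} {v : Vec p} {C : ℝ} (h : ∀ k, |v k| ≤ C) :
    ‖v‖ ≤ √(p * C ^ 2) := by
  refine Real.le_sqrt_of_sq_le ?_
  rw [EuclideanSpace.real_norm_sq_eq]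
  calc ∑ k, v k ^ 2 ≤ ∑ _k : Fin p, C ^ 2 := Finset.sum_le_sum fun k _ =>
        sq_le_sq' (neg_le_of_abs_le (h k)) (le_of_abs_le (h k))
    _ = p * C ^ 2 := by simp

lemma tendsto_zero_of_tendsto_sq {f : ℕ → ℝ} (hf : Tendsto (fun t => f t ^ 2) atTop (𝓝 0)) :
    Tendsto f atTop (𝓝 0) := by
  refine (tendsto_zero_iff_abs_tendsto_zero _).2 ?_
  simpa only [Function.comp_def, Real.sqrt_sq_eq_abs, Real.sqrt_zero] using hf.sqrt

lemma tendsto_zero_of_sq_div {n s : ℕ → ℝ} {ρ : ℝ} (hn : Tendsto n atTop atTop)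
    (hs : Tendsto (fun t => s t ^ 2 / n t) atTop (𝓝 ρ)) :
    Tendsto (fun t => s t / n t) atTop (𝓝 0) := by
  refine tendsto_zero_of_tendsto_sq ?_
  refine (mul_zero ρ ▸ hs.mul (tendsto_inv_atTop_zero.comp hn)).congr fun t => ?_
  simp only [Function.comp_apply]
  ring

namespace Design

variable {p : ℕ} {D : Design p}

lemma nL_le_nbar (hm : 0 < D.m) : (D.nL : ℝ) ≤ D.nbar := by
  rw [nbar, le_div_iff₀ (by exact_mod_cast hm), mul_comm, ← nsmul_eq_mul]
  simpa using Finset.card_nsmul_le_sum (Finset.range D.m) (fun k => (D.n k : ℝ)) D.nL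
    fun k hk => by exact_mod_cast D.nL_le (Finset.mem_range.1 hk)

lemma average_trace_le {C : ℝ} (hn : ∀ k < D.m, 0 < D.n k)
    (hC : ∀ k < D.m, (D.n k : ℝ) ≤ C * D.nL) {A : ℕ → Matrix (Fin p) (Fin p) ℝ}
    (hA : ∀ k < D.m, 0 ≤ (A k).trace) :
    (D.m : ℝ)⁻¹ * ∑ k ∈ Finset.range D.m, (A k).trace ≤
      C * ((D.m : ℝ)⁻¹ • ∑ k ∈ Finset.range D.m, (D.nbar / D.n k) • A k).trace := by
  simp only [Matrix.trace_smul, Matrix.trace_sum, smul_eq_mul]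
  rw [mul_left_comm, Finset.mul_sum _ _ C]
  refine mul_le_mul_of_nonneg_left (Finset.sum_le_sum fun k hk => ?_) (by positivity)
  rw [Finset.mem_range] at hk
  have hnk : (0 : ℝ) < D.n k := by exact_mod_cast hn k hk
  have hC₀ : 0 ≤ C := (pos_of_mul_pos_left (hnk.trans_le (hC k hk)) (Nat.cast_nonneg _)).le
  have ratio : 1 ≤ C * (D.nbar / D.n k) := by
    rw [← mul_div_assoc, one_le_div hnk]
    exact (hC k hk).trans (by gcongr; exact nL_le_nbar (Nat.zero_lt_of_lt hk))
  rw [← mul_assoc]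
  exact le_mul_of_one_le_left (hA k hk) ratio

end Design

variable {p : ℕ} {Ω : ℕ → Type*} [∀ t, MeasurableSpace (Ω t)] {P : ∀ t, Measure (Ω t)}
  {M : Model p} {D : ℕ → Design p} {S : ∀ t, Sample p (Ω t)}
  {K : ℕ → Vec p → Matrix (Fin p) (Fin p) ℝ} {Kbar : Matrix (Fin p) (Fin p) ℝ} {c : ℝ}

namespace Growth

variable (hD : Growth D)

include hD

lemma eventually_lt_m (i : ℕ) : ∀ᶠ t in atTop, i < (D t).m :=
  hD.m_tendsto.eventually_gt_atTop i

lemma tendsto_m : Tendsto (fun t => ((D t).m : ℝ)) atTop atTop :=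
  tendsto_natCast_atTop_atTop.comp hD.m_tendsto

lemma tendsto_nL : Tendsto (fun t => ((D t).nL : ℝ)) atTop atTop :=
  tendsto_natCast_atTop_atTop.comp hD.nL_tendsto

lemma tendsto_n (i : ℕ) : Tendsto (fun t => ((D t).n i : ℝ)) atTop atTop := by
  refine tendsto_atTop_mono' _ ?_ hD.tendsto_nL
  filter_upwards [hD.eventually_lt_m i] with t hi
  exact_mod_cast (D t).nL_le hi

lemma eventually_n_pos : ∀ᶠ t in atTop, ∀ k < (D t).m, 0 < (D t).n k := by
  filter_upwards [hD.nL_tendsto.eventually_gt_atTop 0] with t hL k hk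
  exact hL.trans_le ((D t).nL_le hk)

lemma tendsto_n_div_nL_sq (i : ℕ) :
    Tendsto (fun t => ((D t).n i : ℝ) / ((D t).nL : ℝ) ^ 2) atTop (𝓝 0) := by
  obtain ⟨C, hC⟩ := hD.balanced
  have hlim : Tendsto (fun t => C * ((D t).nL : ℝ)⁻¹) atTop (𝓝 0) := by
    simpa using (tendsto_inv_atTop_zero.comp hD.tendsto_nL).const_mul C
  refine squeeze_zero' (.of_forall fun t => by positivity) ?_ hlim
  filter_upwards [hC, hD.eventually_lt_m i, hD.nL_tendsto.eventually_gt_atTop 0] with t hC hi hL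
  have : (0 : ℝ) < (D t).nL := by exact_mod_cast hL
  rw [div_le_iff₀ (by positivity)]
  refine (hC i hi).trans_eq ?_
  field_simp

end Growth

namespace C2

variable (h2 : C2 P M D S K Kbar)

include h2

lemma exists_norm_x_le : ∃ Cx : ℝ, 0 ≤ Cx ∧
    ∀ t, ∀ k < (D t).m, ∀ j < (D t).n k, ‖(D t).x k j‖ ≤ Cx := by
  obtain ⟨C, hC⟩ := h2.bounded_x
  exact ⟨√(p * C ^ 2), Real.sqrt_nonneg _, fun t k hk j hj =>
    norm_le_of_abs_coord_le fun l => (hC t k hk j hj l).le⟩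

lemma posSemidef_K (i : ℕ) : ∀ᵐ b ∂(multivariateGaussian 0 M.G), (K i b).PosSemidef := by
  obtain ⟨_, _, _, h⟩ := h2.eigen
  filter_upwards [h i] with b hb using hb.1.posSemidef

variable (hM : M.IsValid) (hc : CumulantBounds M c) (hD : Growth D)

include hc

lemma aemeasurable_K (i : ℕ) (k l : Fin p) :
    AEMeasurable (fun b => K i b k l) (multivariateGaussian 0 M.G) := by
  refine aemeasurable_of_tendsto_metrizable_ae atTop
    (fun t => (Model.measurable_H (D := D t) (i := i) hc k l).aemeasurable) ?_
  filter_upwards [h2.tendsto_H i] with b hb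
  exact ((continuous_id.matrix_elem k l).tendsto (K i b)).comp hb

include hM hD

lemma exists_curvatureBound (i : ℕ) : ∃ κ : ℝ, ∀ᶠ t in atTop, (D t).CurvatureBound i κ := by
  have hφ := hM.φ_pos
  have hc₀ := hc.pos
  obtain ⟨b, hb⟩ := (h2.tendsto_H i).exists
  have htrace : Tendsto (fun t => (M.H (D t) i b).trace) atTop (𝓝 (K i b).trace) :=
    (continuous_id.matrix_trace.tendsto (K i b)).comp hb
  refine ⟨((K i b).trace + 1) * (M.φ * c)⁻¹, ?_⟩
  filter_upwards [htrace.eventually (gt_mem_nhds (lt_add_one _)), h2.info_invertible,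
    hD.eventually_lt_m i, hD.eventually_n_pos] with t ht hu hi hn
  exact (Model.curvatureBound_trace_H hM hc (hu i hi b) (hn i hi)).mono (by gcongr)

variable [∀ t, IsProbabilityMeasure (P t)]

/-- The design is not random, so a single realisation at which the average of the matrices `H` is
near its limit provides the bounds. -/
lemma exists_curvatureBound_average : ∃ (κ : ℕ → ℕ → ℝ) (C : ℝ), ∀ᶠ t in atTop,
    (∀ k < (D t).m, (D t).CurvatureBound k (κ t k)) ∧
      ((D t).m : ℝ)⁻¹ * ∑ k ∈ Finset.range (D t).m, κ t k ≤ C := by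
  have hφ := hM.φ_pos
  have hc₀ := hc.pos
  obtain ⟨C, hC⟩ := hD.balanced
  have htrace := TendstoInProb.sum Finset.univ fun k => h2.tendsto_avg k k
  have hκ : ∀ᶠ t in atTop, ∃ κ : ℕ → ℝ, (∀ k < (D t).m, (D t).CurvatureBound k (κ k)) ∧
      ((D t).m : ℝ)⁻¹ * ∑ k ∈ Finset.range (D t).m, κ k ≤
        max C 0 * (Kbar.trace + 1) * (M.φ * c)⁻¹ := by
    filter_upwards [htrace.eventually_exists_lt (lt_add_one _), hC, h2.info_invertible,
      hD.eventually_n_pos] with t ⟨ω, hω⟩ hC hu hn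
    refine ⟨fun k => (M.H (D t) k ((S t).b k ω)).trace * (M.φ * c)⁻¹, fun k hk =>
      Model.curvatureBound_trace_H hM hc (hu k hk _) (hn k hk), ?_⟩
    rw [← Finset.sum_mul, ← mul_assoc]
    refine mul_le_mul_of_nonneg_right ?_ (by positivity)
    refine (Design.average_trace_le (C := max C 0) hn
      (fun k hk => (hC k hk).trans (by gcongr; exact le_max_left _ _))
      fun k hk => (Model.posDef_H hM hc (hu k hk _)).posSemidef.trace_nonneg).trans ?_
    exact mul_le_mul_of_nonneg_left hω.le (le_max_right _ _)
  obtain ⟨κ, hκ⟩ := Filter.skolem.1 hκ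
  exact ⟨κ, _, hκ⟩

end C2

section CharFun

/-- The constant in the bound on the weights of the responses in `inner ℝ u` of the linearised
deviation, when the inverse information matrix is `A` and the covariates are at most `Cx`. -/
def weightBound (M : Model p) (Cx : ℝ) (u : Vec p) (A : Matrix (Fin p) (Fin p) ℝ) : ℝ :=
  M.φ⁻¹ * (Cx * ‖(WithLp.toLp 2 (A *ᵥ WithLp.ofLp u) : Vec p)‖)

lemma continuous_weightBound (M : Model p) (Cx : ℝ) (u : Vec p) :
    Continuous (weightBound M Cx u) := by
  have : Continuous fun A : Matrix (Fin p) (Fin p) ℝ =>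
      (WithLp.toLp 2 (A *ᵥ WithLp.ofLp u) : Vec p) :=
    (PiLp.continuous_toLp 2 _).comp (continuous_id.matrix_mulVec continuous_const)
  unfold weightBound
  fun_prop

lemma Model.norm_charFun_linDev_smul_sub_le {D : Design p} {i : ℕ} {b : Vec p} (hM : M.IsValid)
    (hc : CumulantBounds M c) (hu : IsUnit (M.info D i b)) (hn : 0 < D.n i) {Cx : ℝ}
    (hx : ∀ j < D.n i, ‖D.x i j‖ ≤ Cx) {s : ℝ} (hs : 0 ≤ s) (u : Vec p) :
    ‖∫ y, Complex.exp ((inner ℝ (s • u) (M.linDev D i b y) : ℝ) * Complex.I) ∂(M.condLaw D i b)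
        - Real.exp (-(s ^ 2 / D.n i * matForm (M.H D i b) u u) / 2)‖ ≤
      s ^ 2 / D.n i * (48 * Real.exp (c⁻¹ * M.φ) * (s / D.n i)
          * weightBound M Cx u (M.H D i b) ^ 3
        + (s / D.n i) ^ 2 * (weightBound M Cx u (M.H D i b) ^ 2 * (M.φ * c⁻¹) / 2) ^ 2) := by
  have : (0 : ℝ) < D.n i := by exact_mod_cast hn
  have hcoef : ((D.n i : ℝ) * M.φ)⁻¹ * (Cx *
      ‖(WithLp.toLp 2 (M.H D i b *ᵥ WithLp.ofLp (s • u)) : Vec p)‖) =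
      s / D.n i * weightBound M Cx u (M.H D i b) := by
    rw [WithLp.ofLp_smul, Matrix.mulVec_smul, WithLp.toLp_smul, norm_smul,
      Real.norm_of_nonneg hs, weightBound, mul_inv, div_eq_mul_inv]
    ring
  have hvar : (D.n i : ℝ)⁻¹ * matForm (M.H D i b) (s • u) (s • u) =
      s ^ 2 / D.n i * matForm (M.H D i b) u u := by
    simp only [map_smul, LinearMap.smul_apply, smul_eq_mul]
    ring
  rw [← hvar]
  refine (norm_charFun_linDev_sub_le hM hc hu hn hx _ hcoef.le).trans_eq ?_
  field_simp

variable {i : ℕ} {s : ℕ → ℝ} {ρ σ : ℝ}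

lemma C2.tendsto_charFun_linDev (h2 : C2 P M D S K Kbar) (hM : M.IsValid)
    (hc : CumulantBounds M c) (hD : Growth D) (hs₀ : ∀ t, 0 ≤ s t)
    (hs : Tendsto (fun t => s t ^ 2 / (D t).n i) atTop (𝓝 ρ)) {b : Vec p}
    (hb : Tendsto (fun t => M.H (D t) i b) atTop (𝓝 (K i b))) (u : Vec p) :
    Tendsto (fun t => ∫ y, Complex.exp ((inner ℝ (s t • u) (M.linDev (D t) i b y) : ℝ) * Complex.I)
        ∂(M.condLaw (D t) i b)) atTop (𝓝 (Real.exp (-(ρ * matForm (K i b) u u) / 2) : ℂ)) := by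
  obtain ⟨Cx, _, hx⟩ := h2.exists_norm_x_le
  have hX := ((continuous_weightBound M Cx u).tendsto (K i b)).comp hb
  have hform := ((continuous_matForm_of u u).tendsto (K i b)).comp hb
  have hratio := tendsto_zero_of_sq_div (hD.tendsto_n i) hs
  have herror : Tendsto (fun t => s t ^ 2 / (D t).n i * (48 * Real.exp (c⁻¹ * M.φ)
      * (s t / (D t).n i) * weightBound M Cx u (M.H (D t) i b) ^ 3 + (s t / (D t).n i) ^ 2
        * (weightBound M Cx u (M.H (D t) i b) ^ 2 * (M.φ * c⁻¹) / 2) ^ 2)) atTop (𝓝 0) := by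
    have hcubic := (hratio.const_mul (48 * Real.exp (c⁻¹ * M.φ))).mul (hX.pow 3)
    have hquartic := (hratio.pow 2).mul ((((hX.pow 2).mul_const (M.φ * c⁻¹)).div_const 2).pow 2)
    simpa using hs.mul (hcubic.add hquartic)
  have hlim : Tendsto (fun t => (Real.exp (-(s t ^ 2 / (D t).n i * matForm (M.H (D t) i b) u u)
      / 2) : ℂ)) atTop (𝓝 (Real.exp (-(ρ * matForm (K i b) u u) / 2) : ℂ)) := by
    exact_mod_cast (Complex.continuous_ofReal.tendsto _).comp
      ((Real.continuous_exp.tendsto _).comp ((hs.mul hform).neg.div_const 2))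
  refine hlim.congr_dist (squeeze_zero' (.of_forall fun _ => dist_nonneg) ?_ herror)
  filter_upwards [h2.info_invertible, hD.eventually_lt_m i, hD.eventually_n_pos] with t hu hi hn
  rw [dist_comm, dist_eq_norm]
  exact Model.norm_charFun_linDev_smul_sub_le hM hc (hu i hi b) (hn i hi) (hx t i hi) (hs₀ t) u

lemma C2.tendsto_charFun_dev (h2 : C2 P M D S K Kbar) (hM : M.IsValid)
    (hS : ∀ t, IsGLMM (P t) M (D t) (S t)) (hc : CumulantBounds M c) (hD : Growth D)
    [∀ t, IsProbabilityMeasure (P t)] (hs₀ : ∀ t, 0 ≤ s t)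
    (hs : Tendsto (fun t => s t ^ 2 / (D t).n i) atTop (𝓝 ρ)) (u : Vec p) :
    Tendsto (fun t => charFun ((P t).map ((S t).dev M (D t) i)) (s t • u)) atTop
      (𝓝 (∫ b, (Real.exp (-(ρ * matForm (K i b) u u) / 2) : ℂ)
        ∂(multivariateGaussian 0 M.G))) := by
  have hlim : Tendsto (fun t => ∫ b, ∫ y,
      Complex.exp ((inner ℝ (s t • u) (M.linDev (D t) i b y) : ℝ) * Complex.I)
        ∂(M.condLaw (D t) i b) ∂(multivariateGaussian 0 M.G)) atTop
      (𝓝 (∫ b, (Real.exp (-(ρ * matForm (K i b) u u) / 2) : ℂ)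
        ∂(multivariateGaussian 0 M.G))) := by
    refine tendsto_integral_of_dominated_convergence (fun _ => 1) (fun t => ?_)
      (integrable_const _) (fun t => ae_of_all _ fun b => ?_) ?_
    · obtain ⟨κ, _, hκ, _⟩ := Model.exists_condKernel (D := D t) (i := i) hM hc
      have := Model.measurable_linDev (D := D t) (i := i) hc
      have hmeas : Measurable fun q : Vec p × (Fin ((D t).n i) → ℝ) => Complex.exp
          ((inner ℝ (s t • u) (M.linDev (D t) i q.1 q.2) : ℝ) * Complex.I) := by fun_prop
      simp_rw [← hκ]
      exact (hmeas.stronglyMeasurable.integral_kernel_prod_right' (κ := κ)).aestronglyMeasurable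
    · have := Model.isProbabilityMeasure_condLaw (D := D t) (i := i) hM b
      refine (norm_integral_le_integral_norm _).trans_eq ?_
      simp only [Complex.norm_exp_ofReal_mul_I, integral_const, probReal_univ, one_smul]
    · filter_upwards [h2.tendsto_H i] with b hb
      exact h2.tendsto_charFun_linDev hM hc hD hs₀ hs hb u
  refine hlim.congr' ?_
  filter_upwards [hD.eventually_lt_m i] with t hi
  exact ((hS t).charFun_map_dev hM hc hi _).symm

lemma tendsto_charFun_dev_sub_sum (hM : M.IsValid) (hS : ∀ t, IsGLMM (P t) M (D t) (S t))
    (hc : CumulantBounds M c) (hD : Growth D)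
    (hs : Tendsto (fun t => s t ^ 2 / (D t).m) atTop (𝓝 σ)) (u : Vec p) {ℓ : ℂ}
    (hdev : Tendsto (fun t => charFun ((P t).map ((S t).dev M (D t) i)) (s t • u)) atTop (𝓝 ℓ)) :
    Tendsto (fun t => charFun ((P t).map fun ω => s t • (S t).dev M (D t) i ω
        - (s t / (D t).m) • ∑ k ∈ (Finset.range (D t).m).erase i, (S t).b k ω) u) atTop
      (𝓝 (ℓ * Real.exp (-(σ * matForm M.G u u / 2)))) := by
  have hvar : Tendsto (fun t => ((D t).m - 1 : ℝ) * (s t / (D t).m) ^ 2) atTop (𝓝 σ) := by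
    have hinv := tendsto_inv_atTop_zero.comp hD.tendsto_m
    have hlim := hs.mul (hinv.const_sub 1)
    rw [sub_zero, mul_one] at hlim
    refine hlim.congr' ?_
    filter_upwards [hD.eventually_lt_m 0] with t hm
    have : (0 : ℝ) < (D t).m := by exact_mod_cast hm
    rw [Function.comp_apply]
    field_simp
  have hexp : Tendsto (fun t => (Real.exp (-(((D t).m - 1 : ℝ) * (s t / (D t).m) ^ 2
      * matForm M.G u u / 2)) : ℂ)) atTop (𝓝 (Real.exp (-(σ * matForm M.G u u / 2)) : ℂ)) := by
    exact_mod_cast (Complex.continuous_ofReal.tendsto _).comp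
      ((Real.continuous_exp.tendsto _).comp ((hvar.mul_const _).div_const 2).neg)
  refine (hdev.mul hexp).congr' ?_
  filter_upwards [hD.eventually_lt_m i] with t hi
  exact ((hS t).charFun_map_dev_sub_sum hM hc hi (s t) _ u).symm

end CharFun

end DesignSequence

/-! ### The error of the linearisation -/

section StochasticBounds

variable {p : ℕ}

lemma lintegral_abs_average_le {Ω : Type*} [MeasurableSpace Ω] {P : Measure Ω} {m : ℕ}
    {κ : ℕ → ℝ} {X : ℕ → Ω → ℝ} {C : ℝ} {A : ENNReal} (hκ : ∀ k < m, 0 ≤ κ k)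
    (hX : ∀ k ω, 0 ≤ X k ω) (hXm : ∀ k, Measurable (X k))
    (hA : ∀ k < m, ∫⁻ ω, ENNReal.ofReal (X k ω) ∂P ≤ A)
    (hC : (m : ℝ)⁻¹ * ∑ k ∈ Finset.range m, κ k ≤ C) :
    ∫⁻ ω, ENNReal.ofReal |(m : ℝ)⁻¹ * ∑ k ∈ Finset.range m, κ k * X k ω| ∂P ≤
      ENNReal.ofReal C * A := by
  have hκ' : ∀ k ∈ Finset.range m, 0 ≤ κ k := fun k hk => hκ k (Finset.mem_range.1 hk)
  have hκX (ω) : ∀ k ∈ Finset.range m, 0 ≤ κ k * X k ω := fun k hk =>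
    mul_nonneg (hκ' k hk) (hX k ω)
  have expand (ω) : ENNReal.ofReal |(m : ℝ)⁻¹ * ∑ k ∈ Finset.range m, κ k * X k ω| =
      ENNReal.ofReal (m : ℝ)⁻¹ *
        ∑ k ∈ Finset.range m, ENNReal.ofReal (κ k) * ENNReal.ofReal (X k ω) := by
    rw [abs_of_nonneg (mul_nonneg (by positivity) (Finset.sum_nonneg (hκX ω))),
      ENNReal.ofReal_mul (by positivity), ENNReal.ofReal_sum_of_nonneg (hκX ω)]
    congr 1
    exact Finset.sum_congr rfl fun k hk => ENNReal.ofReal_mul (hκ' k hk)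
  have hmeas (k) : Measurable fun ω => ENNReal.ofReal (X k ω) := (hXm k).ennreal_ofReal
  simp_rw [expand]
  rw [lintegral_const_mul _ (Finset.measurable_fun_sum _ fun k _ => (hmeas k).const_mul _),
    lintegral_finsetSum _ fun k _ => (hmeas k).const_mul _]
  calc ENNReal.ofReal (m : ℝ)⁻¹ * ∑ k ∈ Finset.range m,
        ∫⁻ ω, ENNReal.ofReal (κ k) * ENNReal.ofReal (X k ω) ∂P
      ≤ ENNReal.ofReal (m : ℝ)⁻¹ * ∑ k ∈ Finset.range m, ENNReal.ofReal (κ k) * A := by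
        gcongr with k hk
        rw [lintegral_const_mul _ (hmeas k)]
        gcongr
        exact hA k (Finset.mem_range.1 hk)
    _ = ENNReal.ofReal ((m : ℝ)⁻¹ * ∑ k ∈ Finset.range m, κ k) * A := by
        rw [← Finset.sum_mul, ← ENNReal.ofReal_sum_of_nonneg hκ', ← mul_assoc,
          ← ENNReal.ofReal_mul (by positivity)]
    _ ≤ ENNReal.ofReal C * A := by gcongr

lemma lintegral_norm_sq_gaussian_lt_top (A : Matrix (Fin p) (Fin p) ℝ) :
    ∫⁻ b : Vec p, ENNReal.ofReal (‖b‖ ^ 2) ∂(multivariateGaussian 0 A) < ⊤ := by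
  have h : MemLp (id : Vec p → Vec p) 2 (multivariateGaussian 0 A) := IsGaussian.memLp_two_id
  have := (h.integrable_norm_pow two_ne_zero).2
  rwa [hasFiniteIntegral_iff_ofReal (ae_of_all _ fun b => by positivity)] at this

section Realisation

variable {Ω : Type*} {S : Sample p Ω} {F : Fit p Ω} {ω : Ω} {M : Model p} {D : Design p} {c κ : ℝ}
  {i : ℕ}

namespace IsMaxAt

section Cluster

variable (h : IsMaxAt M D S F ω) (hM : M.IsValid) (hc : CumulantBounds M c)
  (hi : i < D.m) (hn : 0 < D.n i) (hu : IsUnit (M.info D i (S.b i ω)))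
  (hκ : D.CurvatureBound i κ)

include h hM hc hi hn hu hκ

lemma norm_coefDev_sq_le : D.nL * ‖coefDev M S F i ω‖ ^ 2 ≤
    κ * (c⁻¹ * energyBound c (penaltySize F ω) (S.devEnergy M D i ω) (S.b i ω)
      (F.βhat ω - M.β)) := by
  refine le_trans ?_ ((h.clusterScore hM hc hi hn hu).norm_sq_le hκ.nonneg hκ.mul_norm_sq_le)
  gcongr
  exact D.nL_le hi

lemma norm_coefDev_sub_dev_le {Cx : ℝ} (hCx : 0 ≤ Cx) (hx : ∀ j < D.n i, ‖D.x i j‖ ≤ Cx) :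
    D.nL * ‖coefDev M S F i ω - S.dev M D i ω‖ ≤
      κ * (c⁻¹ * ((Cx * (c ^ 2)⁻¹ + 1) * energyBound c (penaltySize F ω) (S.devEnergy M D i ω)
        (S.b i ω) (F.βhat ω - M.β) + penaltySize F ω)) := by
  refine le_trans ?_ ((h.clusterScore hM hc hi hn hu).norm_sub_le hCx (fun j => hx j j.2)
    hκ.nonneg hκ.mul_norm_sq_le)
  gcongr
  exact D.nL_le hi

end Cluster

lemma norm_bhat_sub_le (h : IsMaxAt M D S F ω) (hi : i < D.m) {s : ℝ} (hs : 0 ≤ s) :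
    ‖s • (F.bhat i ω - S.b i ω) - (s • S.dev M D i ω
        - (s / D.m) • ∑ k ∈ (Finset.range D.m).erase i, S.b k ω)‖ ≤
      s * ‖coefDev M S F i ω - S.dev M D i ω‖
        + s * ((D.m : ℝ)⁻¹ * ∑ k ∈ Finset.range D.m, ‖coefDev M S F k ω - S.dev M D k ω‖)
        + s / D.m * ‖∑ k ∈ Finset.range D.m, S.dev M D k ω‖ + s / D.m * ‖S.b i ω‖ := by
  have hsm : 0 ≤ s / D.m := by positivity
  have estimate : F.bhat i ω - S.b i ω = coefDev M S F i ω - (F.βhat ω - M.β) := by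
    rw [coefDev]; abel
  have split : s • (F.bhat i ω - S.b i ω) - (s • S.dev M D i ω
        - (s / D.m) • ∑ k ∈ (Finset.range D.m).erase i, S.b k ω) =
      s • (coefDev M S F i ω - S.dev M D i ω)
        - (s / D.m) • ∑ k ∈ Finset.range D.m, (coefDev M S F k ω - S.dev M D k ω)
        - (s / D.m) • ∑ k ∈ Finset.range D.m, S.dev M D k ω - (s / D.m) • S.b i ω := by
    rw [estimate, h.fixed_eq (Nat.ne_zero_of_lt hi), Finset.sum_sub_distrib,
      ← Finset.add_sum_erase _ (fun k => S.b k ω) (Finset.mem_range.2 hi)]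
    module
  rw [split]
  refine (norm_sub_le _ _).trans (add_le_add ((norm_sub_le _ _).trans
    (add_le_add ((norm_sub_le _ _).trans (add_le_add ?_ ?_)) ?_)) ?_)
  · rw [norm_smul, Real.norm_of_nonneg hs]
  · rw [norm_smul, Real.norm_of_nonneg hsm, ← mul_assoc, ← div_eq_mul_inv]
    gcongr
    exact norm_sum_le _ _
  · rw [norm_smul, Real.norm_of_nonneg hsm]
  · rw [norm_smul, Real.norm_of_nonneg hsm]

end IsMaxAt

end Realisation

variable {Ω : ℕ → Type*} [∀ t, MeasurableSpace (Ω t)] {P : ∀ t, Measure (Ω t)}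
  {M : Model p} {D : ℕ → Design p} {S : ∀ t, Sample p (Ω t)} {F : ∀ t, Fit p (Ω t)}
  {K : ℕ → Vec p → Matrix (Fin p) (Fin p) ℝ} {Kbar : Matrix (Fin p) (Fin p) ℝ} {c : ℝ} {i : ℕ}

lemma C4.stochBounded_penaltySize (h4 : C4 P F) :
    StochBounded P fun t ω => penaltySize (F t) ω :=
  .sum _ fun k => .sum _ fun l => .abs (h4.bounded_φhat.mul (h4.bounded_Ghat_inv k l))

lemma C4.eventually_isMaxAt (h4 : C4 P F) (hF : ∀ t, IsPQL (P t) M (D t) (S t) (F t)) (t : ℕ) :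
    ∀ᵐ ω ∂(P t), IsMaxAt M (D t) (S t) (F t) ω := by
  filter_upwards [h4.posDef_Ghat t, h4.φhat_pos t, (hF t).isMax] with ω hG hφ hmax
  exact ⟨hG, hφ, hmax⟩

section Moments

variable (hM : M.IsValid) (hS : ∀ t, IsGLMM (P t) M (D t) (S t)) (hc : CumulantBounds M c)
  (hD : Growth D)

include hM hS hc

lemma stochBounded_average_norm_b_sq {κ : ℕ → ℕ → ℝ} {C : ℝ}
    (hκ₀ : ∀ᶠ t in atTop, ∀ k < (D t).m, 0 ≤ κ t k)
    (hκ : ∀ᶠ t in atTop, ((D t).m : ℝ)⁻¹ * ∑ k ∈ Finset.range (D t).m, κ t k ≤ C) :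
    StochBounded P fun t ω => ((D t).m : ℝ)⁻¹ *
      ∑ k ∈ Finset.range (D t).m, κ t k * ‖(S t).b k ω‖ ^ 2 := by
  have hb := fun t k => (hS t).measurable_b k
  refine stochBounded_of_lintegral_le (ENNReal.mul_ne_top (ENNReal.ofReal_ne_top (r := C))
    (lintegral_norm_sq_gaussian_lt_top M.G).ne) (fun t => by fun_prop) ?_
  filter_upwards [hκ₀, hκ] with t hκ₀ hκ
  exact lintegral_abs_average_le hκ₀ (fun _ _ => by positivity) (fun k => by fun_prop)
    (fun k hk => ((hS t).lintegral_norm_b_sq hM hc hk).le) hκ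

include hD

lemma stochBounded_norm_b_sq (i : ℕ) : StochBounded P fun t ω => ‖(S t).b i ω‖ ^ 2 := by
  have hb := fun t => (hS t).measurable_b i
  refine stochBounded_of_lintegral_le (lintegral_norm_sq_gaussian_lt_top M.G).ne
    (fun t => by fun_prop) ?_
  filter_upwards [hD.eventually_lt_m i] with t hi
  simp_rw [abs_sq]
  exact ((hS t).lintegral_norm_b_sq hM hc hi).le

variable (hu : ∀ᶠ t in atTop, ∀ k < (D t).m, ∀ b, IsUnit (M.info (D t) k b))

include hu

lemma stochBounded_devEnergy (i : ℕ) : StochBounded P fun t ω => (S t).devEnergy M (D t) i ω := by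
  refine stochBounded_of_lintegral_le (C := ENNReal.ofReal (c⁻¹ * (M.φ * p)))
    ENNReal.ofReal_ne_top (fun t => (hS t).measurable_devEnergy hc i) ?_
  filter_upwards [hu, hD.eventually_lt_m i, hD.eventually_n_pos] with t hu hi hn
  simp_rw [abs_of_nonneg (Sample.devEnergy_nonneg _ M (D t) i _)]
  exact (hS t).lintegral_devEnergy_le hM hc hi (hn i hi) (hu i hi)

variable {κ : ℕ → ℕ → ℝ} {C : ℝ}
  (hκ : ∀ᶠ t in atTop, ((D t).m : ℝ)⁻¹ * ∑ k ∈ Finset.range (D t).m, κ t k ≤ C)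

include hκ

lemma stochBounded_average_devEnergy (hκ₀ : ∀ᶠ t in atTop, ∀ k < (D t).m, 0 ≤ κ t k) :
    StochBounded P fun t ω => ((D t).m : ℝ)⁻¹ *
      ∑ k ∈ Finset.range (D t).m, κ t k * (S t).devEnergy M (D t) k ω := by
  have hq := fun t k => (hS t).measurable_devEnergy hc k
  refine stochBounded_of_lintegral_le (ENNReal.mul_ne_top (ENNReal.ofReal_ne_top (r := C))
    (ENNReal.ofReal_ne_top (r := c⁻¹ * (M.φ * p)))) (fun t => by fun_prop) ?_
  filter_upwards [hκ₀, hκ, hu, hD.eventually_n_pos] with t hκ₀ hκ hu hn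
  exact lintegral_abs_average_le hκ₀ (Sample.devEnergy_nonneg _ M (D t)) (hq t)
    (fun k hk => (hS t).lintegral_devEnergy_le hM hc hk (hn k hk) (hu k hk)) hκ

lemma stochBounded_norm_sum_dev [∀ t, IsProbabilityMeasure (P t)]
    (hcurv : ∀ᶠ t in atTop, ∀ k < (D t).m, (D t).CurvatureBound k (κ t k)) :
    StochBounded P fun t ω => √((D t).nL / (D t).m) *
      ‖∑ k ∈ Finset.range (D t).m, (S t).dev M (D t) k ω‖ := by
  have hφ := hM.φ_pos
  have hc₀ := hc.pos
  have hd := fun t k => (hS t).measurable_dev hc k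
  have hsq (t) (ω) : (√((D t).nL / (D t).m) *
      ‖∑ k ∈ Finset.range (D t).m, (S t).dev M (D t) k ω‖) ^ 2 =
      (D t).nL / (D t).m * ‖∑ k ∈ Finset.range (D t).m, (S t).dev M (D t) k ω‖ ^ 2 := by
    rw [mul_pow, Real.sq_sqrt (by positivity)]
  refine .of_sq (stochBounded_of_lintegral_le (C := ENNReal.ofReal (C * (c⁻¹ * (M.φ * p))))
    ENNReal.ofReal_ne_top (fun t => by fun_prop) ?_)
  filter_upwards [hκ, hcurv, hu, hD.eventually_n_pos, hD.nL_tendsto.eventually_gt_atTop 0]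
    with t hκ hcurv hu hn hL
  simp_rw [abs_sq, hsq, ENNReal.ofReal_mul (show (0 : ℝ) ≤ (D t).nL / (D t).m by positivity)]
  rw [lintegral_const_mul _ (by fun_prop)]
  refine (mul_le_mul_right ((hS t).lintegral_norm_sum_dev_sq_le hM hc hn hu hcurv) _).trans ?_
  rw [← ENNReal.ofReal_mul (by positivity)]
  refine ENNReal.ofReal_le_ofReal ?_
  have : (0 : ℝ) < (D t).nL := by exact_mod_cast hL
  calc (D t).nL / (D t).m * ∑ k ∈ Finset.range (D t).m,
        ((D t).n k : ℝ)⁻¹ * κ t k * (c⁻¹ * (M.φ * p))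
      ≤ (D t).nL / (D t).m * ∑ k ∈ Finset.range (D t).m,
          ((D t).nL : ℝ)⁻¹ * κ t k * (c⁻¹ * (M.φ * p)) := by
        gcongr with k hk
        · exact (hcurv k (Finset.mem_range.1 hk)).nonneg
        · exact (D t).nL_le (Finset.mem_range.1 hk)
    _ = ((D t).m : ℝ)⁻¹ * (∑ k ∈ Finset.range (D t).m, κ t k) * (c⁻¹ * (M.φ * p)) := by
        rw [← Finset.sum_mul, ← Finset.mul_sum]
        field_simp
    _ ≤ C * (c⁻¹ * (M.φ * p)) := by gcongr

end Moments

end StochasticBounds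

section LinearisationError

variable {p : ℕ} {Ω : ℕ → Type*} [∀ t, MeasurableSpace (Ω t)] {P : ∀ t, Measure (Ω t)}
  [∀ t, IsProbabilityMeasure (P t)]
  {M : Model p} {D : ℕ → Design p} {S : ∀ t, Sample p (Ω t)} {F : ∀ t, Fit p (Ω t)}
  {K : ℕ → Vec p → Matrix (Fin p) (Fin p) ℝ} {Kbar : Matrix (Fin p) (Fin p) ℝ} {c : ℝ} {i : ℕ}

section Remainder

variable (hM : M.IsValid) (hS : ∀ t, IsGLMM (P t) M (D t) (S t))
  (hF : ∀ t, IsPQL (P t) M (D t) (S t) (F t)) (hc : CumulantBounds M c) (hD : Growth D)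
  (h2 : C2 P M D S K Kbar) (h4 : C4 P F)

include hM hS hF hc hD h2 h4

lemma stochBounded_norm_fixed_sq : StochBounded P fun t ω => ‖(F t).βhat ω - M.β‖ ^ 2 := by
  obtain ⟨κ, C, hκC⟩ := h2.exists_curvatureBound_average hM hc hD
  have hκ := hκC.mono fun t h => h.2
  have hκ₀ : ∀ᶠ t in atTop, ∀ k < (D t).m, 0 ≤ κ t k :=
    hκC.mono fun t h k hk => (h.1 k hk).nonneg
  have hc₀ := hc.pos
  have hu := h2.info_invertible
  have hlam := h4.stochBounded_penaltySize
  have hb : StochBounded P fun t ω => ((D t).m : ℝ)⁻¹ *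
      ∑ k ∈ Finset.range (D t).m, ‖(S t).b k ω‖ ^ 2 := by
    simpa only [one_mul] using stochBounded_average_norm_b_sq (κ := fun _ _ => 1) (C := 1) hM hS hc
      (.of_forall fun _ _ _ => zero_le_one) (.of_forall fun t => by simp [inv_mul_le_one])
  have hbound := (stochBounded_const (P := P) 4).mul <|
    (((stochBounded_const (c ^ 3)⁻¹).mul
      (stochBounded_average_devEnergy hM hS hc hD hu hκ hκ₀)).add
      (((stochBounded_const 2).mul hlam).mul (stochBounded_average_norm_b_sq hM hS hc hκ₀ hκ))).add
      hb
  refine .of_imp (hD.tendsto_nL.const_mul_atTop hc₀)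
    (((stochBounded_const (P := P) 8).mul hlam).mul (stochBounded_const C)) hbound ?_
  filter_upwards [hκC, hu, hD.eventually_lt_m 0, hD.eventually_n_pos,
    (hD.tendsto_nL.const_mul_atTop hc₀).eventually_ge_atTop 1] with t hκ hu hm hn hN
  filter_upwards [h4.eventually_isMaxAt hF t] with ω hω hW
  have hlam₀ := penaltySize_nonneg (F t) ω
  have hsum (q : ℕ → ℝ) (hq : ∀ k, 0 ≤ q k) :
      0 ≤ ((D t).m : ℝ)⁻¹ * ∑ k ∈ Finset.range (D t).m, κ t k * q k :=
    mul_nonneg (by positivity) <| Finset.sum_nonneg fun k hk =>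
      mul_nonneg (hκ.1 k (Finset.mem_range.1 hk)).nonneg (hq k)
  rw [abs_of_nonneg (by positivity)]
  refine (norm_sq_average_le (N := (D t).nL) (κ := κ t) ?_ hc₀ hN hlam₀
    (fun k hk => hω.norm_coefDev_sq_le hM hc hk (hn k hk) (hu k hk _) (hκ.1 k hk))
    (hsum _ fun k => Sample.devEnergy_nonneg _ M (D t) k ω) (hsum _ fun k => by positivity)
    (hω.fixed_eq hm.ne')).trans (le_abs_self _)
  refine le_trans ?_ ((le_abs_self _).trans hW)
  gcongr
  exact hκ.2

lemma stochBounded_energyBound (i : ℕ) : StochBounded P fun t ω => energyBound c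
    (penaltySize (F t) ω) ((S t).devEnergy M (D t) i ω) ((S t).b i ω) ((F t).βhat ω - M.β) :=
  ((stochBounded_const _).mul (stochBounded_devEnergy hM hS hc hD h2.info_invertible i)).add <|
    ((stochBounded_const 2).mul h4.stochBounded_penaltySize).mul <|
      (stochBounded_norm_b_sq hM hS hc hD i).add
        (stochBounded_norm_fixed_sq hM hS hF hc hD h2 h4)

lemma stochBounded_average_energyBound {κ : ℕ → ℕ → ℝ} {C : ℝ}
    (hκ₀ : ∀ᶠ t in atTop, ∀ k < (D t).m, 0 ≤ κ t k)
    (hκ : ∀ᶠ t in atTop, ((D t).m : ℝ)⁻¹ * ∑ k ∈ Finset.range (D t).m, κ t k ≤ C) :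
    StochBounded P fun t ω => ((D t).m : ℝ)⁻¹ * ∑ k ∈ Finset.range (D t).m,
      κ t k * energyBound c (penaltySize (F t) ω) ((S t).devEnergy M (D t) k ω) ((S t).b k ω)
        ((F t).βhat ω - M.β) := by
  have hκO : StochBounded P fun t _ => ((D t).m : ℝ)⁻¹ * ∑ k ∈ Finset.range (D t).m, κ t k := by
    refine (stochBounded_const C).mono ?_
    filter_upwards [hκ₀, hκ] with t hκ₀ hκ
    refine ae_of_all _ fun _ => abs_le_abs_of_nonneg (mul_nonneg (by positivity) ?_) hκ
    exact Finset.sum_nonneg fun k hk => hκ₀ k (Finset.mem_range.1 hk)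
  simp_rw [average_mul_energyBound]
  exact ((stochBounded_const _).mul
    (stochBounded_average_devEnergy hM hS hc hD h2.info_invertible hκ hκ₀)).add <|
    ((stochBounded_const 2).mul h4.stochBounded_penaltySize).mul <|
      (stochBounded_average_norm_b_sq hM hS hc hκ₀ hκ).add
        (hκO.mul (stochBounded_norm_fixed_sq hM hS hF hc hD h2 h4))

lemma stochBounded_norm_coefDev_sub_dev (i : ℕ) : StochBounded P fun t ω =>
    (D t).nL * ‖coefDev M (S t) (F t) i ω - (S t).dev M (D t) i ω‖ := by
  obtain ⟨κ, hκ⟩ := h2.exists_curvatureBound hM hc hD i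
  obtain ⟨Cx, hCx, hx⟩ := h2.exists_norm_x_le
  refine ((stochBounded_const κ).mul <| (stochBounded_const c⁻¹).mul <|
    ((stochBounded_const (Cx * (c ^ 2)⁻¹ + 1)).mul
      (stochBounded_energyBound hM hS hF hc hD h2 h4 i)).add h4.stochBounded_penaltySize).mono ?_
  filter_upwards [hκ, h2.info_invertible, hD.eventually_lt_m i, hD.eventually_n_pos]
    with t hκ hu hi hn
  filter_upwards [h4.eventually_isMaxAt hF t] with ω hω
  rw [abs_of_nonneg (by positivity)]
  exact (hω.norm_coefDev_sub_dev_le hM hc hi (hn i hi) (hu i hi _) hκ hCx (hx t i hi)).trans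
    (le_abs_self _)

lemma stochBounded_average_norm_coefDev_sub_dev : StochBounded P fun t ω =>
    ((D t).m : ℝ)⁻¹ * ∑ k ∈ Finset.range (D t).m,
      (D t).nL * ‖coefDev M (S t) (F t) k ω - (S t).dev M (D t) k ω‖ := by
  obtain ⟨κ, C, hκC⟩ := h2.exists_curvatureBound_average hM hc hD
  have hκ := hκC.mono fun t h => h.2
  have hκ₀ : ∀ᶠ t in atTop, ∀ k < (D t).m, 0 ≤ κ t k :=
    hκC.mono fun t h k hk => (h.1 k hk).nonneg
  obtain ⟨Cx, hCx, hx⟩ := h2.exists_norm_x_le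
  have hc₀ := hc.pos
  refine ((stochBounded_const c⁻¹).mul <| ((stochBounded_const (Cx * (c ^ 2)⁻¹ + 1)).mul
      (stochBounded_average_energyBound hM hS hF hc hD h2 h4 hκ₀ hκ)).add <|
        h4.stochBounded_penaltySize.mul (stochBounded_const C)).mono ?_
  filter_upwards [hκC, h2.info_invertible, hD.eventually_n_pos] with t hκ hu hn
  filter_upwards [h4.eventually_isMaxAt hF t] with ω hω
  have hlam₀ := penaltySize_nonneg (F t) ω
  rw [abs_of_nonneg (by positivity)]
  refine le_trans ?_ (le_abs_self _)
  calc _ ≤ ((D t).m : ℝ)⁻¹ * ∑ k ∈ Finset.range (D t).m, κ t k * (c⁻¹ * ((Cx * (c ^ 2)⁻¹ + 1)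
          * energyBound c (penaltySize (F t) ω) ((S t).devEnergy M (D t) k ω) ((S t).b k ω)
            ((F t).βhat ω - M.β) + penaltySize (F t) ω)) := by
        refine mul_le_mul_of_nonneg_left (Finset.sum_le_sum fun k hk => ?_) (by positivity)
        rw [Finset.mem_range] at hk
        exact hω.norm_coefDev_sub_dev_le hM hc hk (hn k hk) (hu k hk _) (hκ.1 k hk) hCx (hx t k hk)
    _ = c⁻¹ * ((Cx * (c ^ 2)⁻¹ + 1) * (((D t).m : ℝ)⁻¹ * ∑ k ∈ Finset.range (D t).m, κ t k *
          energyBound c (penaltySize (F t) ω) ((S t).devEnergy M (D t) k ω) ((S t).b k ω)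
            ((F t).βhat ω - M.β)) + penaltySize (F t) ω *
              (((D t).m : ℝ)⁻¹ * ∑ k ∈ Finset.range (D t).m, κ t k)) := by
        simp only [Finset.mul_sum, ← Finset.sum_add_distrib]
        exact Finset.sum_congr rfl fun k _ => by ring
    _ ≤ _ := by
        gcongr
        exact hκ.2

end Remainder

end LinearisationError

/-! ### The limit laws -/

section LimitLaws

variable {p : ℕ} {Ω : ℕ → Type*} [∀ t, MeasurableSpace (Ω t)] {P : ∀ t, Measure (Ω t)}
  [∀ t, IsProbabilityMeasure (P t)]
  {M : Model p} {D : ℕ → Design p} {S : ∀ t, Sample p (Ω t)} {F : ∀ t, Fit p (Ω t)}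
  {K : ℕ → Vec p → Matrix (Fin p) (Fin p) ℝ} {Kbar : Matrix (Fin p) (Fin p) ℝ} {c : ℝ} {i : ℕ}

section Limit

variable (hM : M.IsValid) (hS : ∀ t, IsGLMM (P t) M (D t) (S t))
  (hF : ∀ t, IsPQL (P t) M (D t) (S t) (F t)) (hc : CumulantBounds M c) (hD : Growth D)
  (h2 : C2 P M D S K Kbar) (h4 : C4 P F) {s : ℕ → ℝ} {ρ σ : ℝ} (hs₀ : ∀ t, 0 ≤ s t)
  (hsm : Tendsto (fun t => s t ^ 2 / (D t).m) atTop (𝓝 σ))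
  (hsL : Tendsto (fun t => s t ^ 2 / ((D t).nL : ℝ) ^ 2) atTop (𝓝 0))

include hM hS hF hc hD h2 h4 hs₀ hsm hsL

lemma tendstoInProb_bhat_sub : TendstoInProb P (fun t ω =>
    ‖s t • ((F t).bhat i ω - (S t).b i ω) - (s t • (S t).dev M (D t) i ω
      - (s t / (D t).m) • ∑ k ∈ (Finset.range (D t).m).erase i, (S t).b k ω)‖) 0 := by
  have hsL' : Tendsto (fun t => s t / (D t).nL) atTop (𝓝 0) :=
    tendsto_zero_of_tendsto_sq (by simpa only [div_pow] using hsL)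
  have hsm' : Tendsto (fun t => s t / (D t).m) atTop (𝓝 0) :=
    tendsto_zero_of_sq_div hD.tendsto_m hsm
  have hsmL : Tendsto (fun t => √(s t ^ 2 / (D t).m * ((D t).nL : ℝ)⁻¹)) atTop (𝓝 0) := by
    simpa using (hsm.mul (tendsto_inv_atTop_zero.comp hD.tendsto_nL)).sqrt
  obtain ⟨κ, C, hκ⟩ := h2.exists_curvatureBound_average hM hc hD
  have hlim := ((((stochBounded_norm_coefDev_sub_dev hM hS hF hc hD h2 h4 i).tendstoInProb_mul
      hsL').add ((stochBounded_average_norm_coefDev_sub_dev hM hS hF hc hD h2 h4).tendstoInProb_mul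
      hsL')).add ((stochBounded_norm_sum_dev hM hS hc hD h2.info_invertible
        (hκ.mono fun _ h => h.2) (hκ.mono fun _ h => h.1)).tendstoInProb_mul hsmL)).add
    ((stochBounded_norm_b_sq hM hS hc hD i).of_sq.tendstoInProb_mul hsm')
  simp only [add_zero] at hlim
  refine hlim.squeeze_zero ?_
  filter_upwards [hD.eventually_lt_m i, hD.nL_tendsto.eventually_gt_atTop 0] with t hi hL
  filter_upwards [h4.eventually_isMaxAt hF t] with ω hω
  have : (0 : ℝ) < (D t).nL := by exact_mod_cast hL
  have hsqrt : √(s t ^ 2 / (D t).m * ((D t).nL : ℝ)⁻¹) * √((D t).nL / (D t).m) =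
      s t / (D t).m := by
    rw [← Real.sqrt_mul (by positivity), ← Real.sqrt_sq (div_nonneg (hs₀ t) (Nat.cast_nonneg _))]
    congr 1
    field_simp
  rw [abs_norm]
  refine (hω.norm_bhat_sub_le hi (hs₀ t)).trans (le_of_eq_of_le ?_ (le_abs_self _))
  rw [← mul_assoc √_, hsqrt, ← Finset.mul_sum]
  field_simp

lemma tendstoInLaw_bhat_sub (hsn : Tendsto (fun t => s t ^ 2 / (D t).n i) atTop (𝓝 ρ))
    {μ : Measure (Vec p)} [IsProbabilityMeasure μ]
    (hμ : ∀ u, charFun μ u = (∫ b, (Real.exp (-(ρ * matForm (K i b) u u) / 2) : ℂ)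
      ∂(multivariateGaussian 0 M.G)) * Real.exp (-(σ * matForm M.G u u / 2))) :
    TendstoInLaw P (fun t ω => s t • ((F t).bhat i ω - (S t).b i ω)) μ := by
  have hb := fun t k => (hS t).measurable_b k
  have hbhat := fun t => (hF t).measurable_bhat i
  have hdev := fun t => (hS t).measurable_dev hc i
  refine (tendstoInProb_bhat_sub hM hS hF hc hD h2 h4 hs₀ hsm hsL).tendstoInLaw
    (fun t => by fun_prop) (fun t => by fun_prop) fun u => ?_
  rw [hμ]
  exact tendsto_charFun_dev_sub_sum hM hS hc hD hsm u
    (h2.tendsto_charFun_dev hM hS hc hD hs₀ hsn u)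

end Limit

section Regimes

variable (hM : M.IsValid) (hS : ∀ t, IsGLMM (P t) M (D t) (S t))
  (hF : ∀ t, IsPQL (P t) M (D t) (S t) (F t)) (hc : CumulantBounds M c) (hD : Growth D)
  (h2 : C2 P M D S K Kbar) (h4 : C4 P F)

include hM hS hF hc hD h2 h4

lemma tendstoInLaw_sqrt_n_bhat_sub {σ : ℝ}
    (hnm : Tendsto (fun t => ((D t).n i : ℝ) / (D t).m) atTop (𝓝 σ))
    {μ : Measure (Vec p)} [IsProbabilityMeasure μ]
    (hμ : ∀ u, charFun μ u = charFun (mixN (fun _ => 0) (K i) (multivariateGaussian 0 M.G)) u *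
      Real.exp (-(σ * matForm M.G u u / 2))) :
    TendstoInLaw P (fun t ω => √((D t).n i : ℝ) • ((F t).bhat i ω - (S t).b i ω)) μ := by
  have hsq (t) : √((D t).n i : ℝ) ^ 2 = (D t).n i := Real.sq_sqrt (Nat.cast_nonneg _)
  refine tendstoInLaw_bhat_sub hM hS hF hc hD h2 h4 (ρ := 1) (fun t => Real.sqrt_nonneg _)
    (by simpa only [hsq] using hnm) (by simpa only [hsq] using hD.tendsto_n_div_nL_sq i) ?_
    fun u => ?_
  · refine tendsto_const_nhds.congr' ?_
    filter_upwards [(hD.tendsto_n i).eventually_ne_atTop 0] with t hn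
    rw [hsq, div_self hn]
  · simpa only [charFun_mixN (h2.aemeasurable_K hc i) (h2.posSemidef_K i), one_mul] using hμ u

lemma tendstoInLaw_sqrt_m_bhat_sub
    (hmn : Tendsto (fun t => ((D t).m : ℝ) / (D t).n i) atTop (𝓝 0)) :
    TendstoInLaw P (fun t ω => √((D t).m : ℝ) • ((F t).bhat i ω - (S t).b i ω))
      (multivariateGaussian 0 M.G) := by
  have hsq (t) : √((D t).m : ℝ) ^ 2 = (D t).m := Real.sq_sqrt (Nat.cast_nonneg _)
  refine tendstoInLaw_bhat_sub hM hS hF hc hD h2 h4 (ρ := 0) (σ := 1)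
    (fun t => Real.sqrt_nonneg _) ?_ ?_ (by simpa only [hsq] using hmn) fun u => ?_
  · refine tendsto_const_nhds.congr' ?_
    filter_upwards [hD.tendsto_m.eventually_ne_atTop 0] with t hm
    rw [hsq, div_self hm]
  · have hlim := hmn.mul (hD.tendsto_n_div_nL_sq i)
    rw [mul_zero] at hlim
    refine hlim.congr' ?_
    filter_upwards [(hD.tendsto_n i).eventually_ne_atTop 0] with t hn
    rw [hsq, div_mul_div_cancel₀ hn]
  · simp [charFun_multivariateGaussian_zero hM.posSemidef_G, neg_div]

end Regimes

end LimitLaws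

end PQL

end

theorem theorem4_general {p : ℕ} {Ω : ℕ → Type*} [∀ t, MeasurableSpace (Ω t)]
    (P : ∀ t, Measure (Ω t)) [∀ t, IsProbabilityMeasure (P t)]
    (M : PQL.Model p) (D : ℕ → PQL.Design p)
    (S : ∀ t, PQL.Sample p (Ω t)) (F : ∀ t, PQL.Fit p (Ω t))
    (K : ℕ → PQL.Vec p → Matrix (Fin p) (Fin p) ℝ) (Kbar : Matrix (Fin p) (Fin p) ℝ)
    (hM : M.IsValid)
    (hS : ∀ t, PQL.IsGLMM (P t) M (D t) (S t))
    (hF : ∀ t, PQL.IsPQL (P t) M (D t) (S t) (F t))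
    (hD : PQL.Growth D)
    (h1 : PQL.C1 M) (h2 : PQL.C2 P M D S K Kbar) (h4 : PQL.C4 P F) (i : ℕ) :
    (Tendsto (fun t => ((D t).m : ℝ) / (D t).n i) atTop atTop →
      PQL.TendstoInLaw P
        (fun t ω => √((D t).n i : ℝ) • ((F t).bhat i ω - (S t).b i ω))
        (PQL.mixN (fun _ => 0) (K i) (multivariateGaussian 0 M.G))) ∧
    (∀ γ : ℝ, 0 < γ → Tendsto (fun t => ((D t).m : ℝ) / (D t).n i) atTop (𝓝 γ) →
      PQL.TendstoInLaw P
        (fun t ω => √((D t).n i : ℝ) • ((F t).bhat i ω - (S t).b i ω))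
        ((PQL.mixN (fun _ => 0) (K i) (multivariateGaussian 0 M.G)).conv
          (multivariateGaussian 0 (γ⁻¹ • M.G)))) ∧
    (Tendsto (fun t => ((D t).m : ℝ) / (D t).n i) atTop (𝓝 0) →
      PQL.TendstoInLaw P
        (fun t ω => √((D t).m : ℝ) • ((F t).bhat i ω - (S t).b i ω))
        (multivariateGaussian 0 M.G)) := by
  obtain ⟨c, hc⟩ := h1.cumulantBounds
  have hmix := PQL.isProbabilityMeasure_mixN (h2.aemeasurable_K hc i)
  refine ⟨fun hlim => ?_, fun γ hγ hlim => ?_,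
    PQL.tendstoInLaw_sqrt_m_bhat_sub hM hS hF hc hD h2 h4⟩
  · refine PQL.tendstoInLaw_sqrt_n_bhat_sub hM hS hF hc hD h2 h4 (σ := 0) ?_ fun u => by simp
    simpa only [Pi.inv_def, inv_div] using hlim.inv_tendsto_atTop
  · refine PQL.tendstoInLaw_sqrt_n_bhat_sub hM hS hF hc hD h2 h4 (σ := γ⁻¹)
      (by simpa only [inv_div] using hlim.inv₀ hγ.ne') fun u => ?_
    rw [charFun_conv, PQL.charFun_multivariateGaussian_zero
      (hM.posSemidef_G.smul (inv_nonneg.2 hγ.le)), PQL.matForm_smul, neg_div]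

theorem theorem4 {p : ℕ} {Ω : ℕ → Type*} [∀ t, MeasurableSpace (Ω t)]
    (P : ∀ t, Measure (Ω t)) [∀ t, IsProbabilityMeasure (P t)]
    (M : PQL.Model p) (D : ℕ → PQL.Design p)
    (S : ∀ t, PQL.Sample p (Ω t)) (F : ∀ t, PQL.Fit p (Ω t))
    (K : ℕ → PQL.Vec p → Matrix (Fin p) (Fin p) ℝ) (Kbar : Matrix (Fin p) (Fin p) ℝ)
    (hM : M.IsValid)
    (hS : ∀ t, PQL.IsGLMM (P t) M (D t) (S t))
    (hF : ∀ t, PQL.IsPQL (P t) M (D t) (S t) (F t))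
    (hD : PQL.Growth D)
    (h1 : PQL.C1 M) (h2 : PQL.C2 P M D S K Kbar) (h3 : PQL.C3 M D S)
    (h4 : PQL.C4 P F) (h5 : PQL.C5 P M D S F)
    (hmn : Tendsto (fun t => ((D t).m : ℝ) / ((D t).nL : ℝ) ^ 2) atTop (𝓝 0)) (i : ℕ) :
    (Tendsto (fun t => ((D t).m : ℝ) / (D t).n i) atTop atTop →
      PQL.TendstoInLaw P
        (fun t ω => √((D t).n i : ℝ) • ((F t).bhat i ω - (S t).b i ω))
        (PQL.mixN (fun _ => 0) (K i) (multivariateGaussian 0 M.G))) ∧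
    (∀ γ : ℝ, 0 < γ → Tendsto (fun t => ((D t).m : ℝ) / (D t).n i) atTop (𝓝 γ) →
      PQL.TendstoInLaw P
        (fun t ω => √((D t).n i : ℝ) • ((F t).bhat i ω - (S t).b i ω))
        ((PQL.mixN (fun _ => 0) (K i) (multivariateGaussian 0 M.G)).conv
          (multivariateGaussian 0 (γ⁻¹ • M.G)))) ∧
    (Tendsto (fun t => ((D t).m : ℝ) / (D t).n i) atTop (𝓝 0) →
      PQL.TendstoInLaw P
        (fun t ω => √((D t).m : ℝ) • ((F t).bhat i ω - (S t).b i ω))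
        (multivariateGaussian 0 M.G)) :=
  theorem4_general P M D S F K Kbar hM hS hF hD h1 h2 h4 i
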